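/- Conventions. All groups are finite. For a positive integer $m$, a prime $p$ and a set of primes $\pi$: $\pi(m)$ is the set of primes dividing $m$, $m_p$ is the largest power of $p$ dividing $m$, $m_\pi=\prod_{p\in\pi}m_p$, $m_{2'}=m/m_2$, and $\mathcal U_m=(\mathbb Z/m\mathbb Z)^\times$. For $q\mid m$, $\mathrm{Res}_q:\mathcal U_m\to\mathcal U_q$ is the natural map. $T_{\nu'}$ is the Hall $\nu'$-subgroup of a finite abelian group $T$ (the elements whose order is divisible by no prime in $\nu$). For a cyclic subgroup $T$ of $\mathcal U_m$ put $[T]=(r,\epsilon,o)$, where $r$ is the greatest divisor of $m$ with $\mathrm{Res}_{r_{2'}}(T)=1$ and $\mathrm{Res}_{r_2}(T)\subseteq\langle -1\rangle$; $\epsilon=-1$ if $\mathrm{Res}_{r_2}(T)\neq 1$ and $\epsilon=1$ otherwise; and $o=|\mathrm{Res}_{m_\nu}(T_{\nu'})|$ with $\nu=\pi(m)\setminus\pi(r)$. For positive integers $n,s$ put $[T,n,s]=m_\nu\prod_{p\in\pi(r)}m'_p$, where - if $\epsilon^{p-1}=1$, then $m'_p=\min\bigl(m_p,\;o_pr_p,\;\max(r_p,\,s_p,\,r_p\tfrac{s_po_p}{n_p})\bigr)$;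 - if $\epsilon=-1$, then $m'_2=r_2$ if $o_2\le 2$ or $m_2\le 2r_2$; otherwise $m'_2=\tfrac{m_2}{2}$ if $4\le o_2<n_2$, $4r_2\le m_2$ and ($s_2\neq n_2r_2$ implies $2s_2=m_2<n_2r_2$); and $m'_2=m_2$ in all remaining cases. If $A$ is a cyclic normal subgroup of order $m$ of a group $G$, let $T_G(A)\le\mathcal U_m$ be the subgroup of those classes $[t]_m$ for which the automorphism $a\mapsto a^t$ of $A$ is the restriction to $A$ of an inner automorphism of $G$, and let $r_G(A)$ be the first entry of $[T_G(A)]$. A group $G$ is metacyclic if it has a cyclic normal subgroup $A$ with $G/A$ cyclic. A metacyclic factorization of $G$ is an expression $G=AB$ with $A$ a cyclic normal subgroup and $B$ a cyclic subgroup of $G$; it is minimal if the triple $(|A|,r_G(A),[G:B])$ is minimal in the lexicographical order among all metacyclic factorizations of $G$. For a metacyclic factorization $G=AB$ put $n=[G:A]$, $s=[G:B]$, $T=T_G(A)$, $m'=[T,n,s]$ and $\Delta(AB)=\mathrm{Res}_{m'}(T)$, a subgroup of $\mathcal U_{m'}$ (subgroups of $\mathcal U_{m'}$ and $\mathcal U_{m''}$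 with $m'\ne m''$ are considered different). Theorem. (1) Every finite metacyclic group $G$ has a minimal metacyclic factorization, and the tuple $$\mathrm{MCINV}(G)=(m_G,n_G,s_G,\Delta_G)=(|A|,[G:A],[G:B],\Delta(AB))$$ is the same for all minimal metacyclic factorizations $G=AB$ of $G$. Moreover $\Delta_G$ is a cyclic subgroup of $\mathcal U_{m'}$ for a divisor $m'$ of $m_G$. (2) Two finite metacyclic groups $G$ and $H$ are isomorphic if and only if $\mathrm{MCINV}(G)=\mathrm{MCINV}(H)$. -/

import Mathlib

noncomputable section

namespace Metacyclic

open scoped Classical in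
/-- The `π`-part `m_π = ∏_{p ∈ π} m_p` of a positive integer `m`, for a set `π` of primes, where
`m_p` is the largest power of `p` dividing `m`. -/
def piPart (π : Set ℕ) (m : ℕ) : ℕ :=
  ∏ p ∈ m.primeFactors with p ∈ π, p ^ m.factorization p

/-- The natural map `Res_q : U_m → U_q` (for `q ∣ m`) applied to a subgroup `T` of
`U_m = (ZMod m)ˣ`. It is only meaningful, and only used, for `q ∣ m`. -/
def res (q : ℕ) {m : ℕ} (T : Subgroup (ZMod m)ˣ) : Subgroup (ZMod q)ˣ :=
  if h : q ∣ m then T.map (ZMod.unitsMap h) else ⊥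

/-- The Hall `π`-subgroup `T_π` of a finite subgroup `T` of a commutative group: the elements of
`T` whose order is divisible by no prime outside `π`. -/
def hallPart {M : Type*} [CommGroup M] (π : Set ℕ) (T : Subgroup M) : Subgroup M where
  carrier := {x | x ∈ T ∧ ∀ p : ℕ, p.Prime → p ∣ orderOf x → p ∈ π}
  one_mem' := ⟨T.one_mem, fun p hp h => by
    rw [orderOf_one] at h
    exact absurd (Nat.dvd_one.mp h) hp.ne_one⟩
  mul_mem' := by
    rintro x y ⟨hx, hx'⟩ ⟨hy, hy'⟩
    refine ⟨T.mul_mem hx hy, fun p hp h => ?_⟩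
    have h1 : p ∣ orderOf x * orderOf y := h.trans (Commute.all x y).orderOf_mul_dvd_mul_orderOf
    rcases hp.dvd_mul.mp h1 with h2 | h2
    · exact hx' p hp h2
    · exact hy' p hp h2
  inv_mem' := by
    rintro x ⟨hx, hx'⟩
    refine ⟨T.inv_mem hx, fun p hp h => ?_⟩
    rw [orderOf_inv] at h
    exact hx' p hp h

section Invariants

variable {m : ℕ} (T : Subgroup (ZMod m)ˣ)

open scoped Classical in
/-- The integer `r` of `[T] = (r, ε, o)`: the greatest divisor `d` of `m` such that
`Res_{d_{2'}}(T) = 1` and `Res_{d_2}(T) ⊆ ⟨-1⟩`. -/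
def rInv : ℕ :=
  (m.divisors.filter fun d => res (piPart {2}ᶜ d) T = ⊥ ∧
    res (piPart {2} d) T ≤ Subgroup.zpowers (-1)).sup id

open scoped Classical in
/-- The sign `ε` of `[T] = (r, ε, o)`. -/
def epsInv : ℤ :=
  if res (piPart {2} (rInv T)) T ≠ ⊥ then -1 else 1

/-- The set of primes `ν = π(m) \ π(r)`, where `[T] = (r, ε, o)`. -/
def nu : Finset ℕ := m.primeFactors \ (rInv T).primeFactors

/-- The integer `o` of `[T] = (r, ε, o)`: the order of `Res_{m_ν}(T_{ν'})`. -/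
def oInv : ℕ :=
  Nat.card (res (piPart (nu T : Set ℕ) m) (hallPart ((nu T : Set ℕ)ᶜ) T))

end Invariants

/-- The number `m'_p`, as a function of `p`, of `ε` and of the `p`-parts `m_p, n_p, s_p, r_p, o_p`
(all of them powers of `p`). The division by `n_p` is the truncated one; where it is not exact, the
rational quotient is smaller than `1 ≤ r_p`, so that the maximum is not affected. -/
def localModulus (p : ℕ) (ε : ℤ) (mp np sp rp op : ℕ) : ℕ :=
  if ε ^ (p - 1) = 1 then
    min mp (min (op * rp) (max rp (max sp (rp * (sp * op) / np))))
  else if op ≤ 2 ∨ mp ≤ 2 * rp then rp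
  else if 4 ≤ op ∧ op < np ∧ 4 * rp ≤ mp ∧ (sp ≠ np * rp → 2 * sp = mp ∧ mp < np * rp) then mp / 2
  else mp

/-- The number `[T, n, s] = m_ν ∏_{p ∈ π(r)} m'_p`. -/
def modulus {m : ℕ} (T : Subgroup (ZMod m)ˣ) (n s : ℕ) : ℕ :=
  piPart (nu T : Set ℕ) m *
    ∏ p ∈ (rInv T).primeFactors,
      localModulus p (epsInv T) (piPart {p} m) (piPart {p} n) (piPart {p} s)
        (piPart {p} (rInv T)) (piPart {p} (oInv T))

section Groups

variable {G : Type*} [Group G]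

/-- `T_G(A)`, for a cyclic normal subgroup `A` of order `m` of a group `G`: the subgroup of `U_m`
of the classes `u` such that the automorphism `a ↦ a ^ u` of `A` is the restriction to `A` of an
inner automorphism of `G`. -/
def actionSubgroup (A : Subgroup G) : Subgroup (ZMod (Nat.card A))ˣ where
  carrier := {u | ∃ g : G, ∀ a ∈ A, g * a * g⁻¹ = a ^ ((u : ZMod (Nat.card A)).cast : ℤ)}
  one_mem' := ⟨1, fun a ha => by
    have h : a ^ (((1 : ZMod (Nat.card A)).cast : ℤ)) = a ^ (1 : ℤ) := by
      rw [zpow_eq_zpow_iff_modEq]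
      refine Int.ModEq.of_dvd (Int.natCast_dvd_natCast.mpr (Subgroup.orderOf_dvd_natCard A ha)) ?_
      rw [← ZMod.intCast_eq_intCast_iff]
      simp
    simp [h]⟩
  mul_mem' := by
    rintro u v ⟨g, hg⟩ ⟨k, hk⟩
    refine ⟨g * k, fun a ha => ?_⟩
    have h : a ^ (((u * v : (ZMod (Nat.card A))ˣ) : ZMod (Nat.card A)).cast : ℤ) =
        a ^ (((v : ZMod (Nat.card A)).cast : ℤ) * ((u : ZMod (Nat.card A)).cast : ℤ)) := by
      rw [zpow_eq_zpow_iff_modEq]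
      refine Int.ModEq.of_dvd (Int.natCast_dvd_natCast.mpr (Subgroup.orderOf_dvd_natCard A ha)) ?_
      rw [← ZMod.intCast_eq_intCast_iff]
      simp [mul_comm]
    rw [h, zpow_mul, ← hg _ (A.zpow_mem ha _), ← hk a ha]
    group
  inv_mem' := by
    rintro u ⟨g, hg⟩
    refine ⟨g⁻¹, fun a ha => ?_⟩
    have h : a ^ ((((u⁻¹ : (ZMod (Nat.card A))ˣ) : ZMod (Nat.card A)).cast : ℤ) *
        ((u : ZMod (Nat.card A)).cast : ℤ)) = a ^ (1 : ℤ) := by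
      rw [zpow_eq_zpow_iff_modEq]
      refine Int.ModEq.of_dvd (Int.natCast_dvd_natCast.mpr (Subgroup.orderOf_dvd_natCard A ha)) ?_
      rw [← ZMod.intCast_eq_intCast_iff]
      simp
    have h2 := hg _ (A.zpow_mem ha (((u⁻¹ : (ZMod (Nat.card A))ˣ) : ZMod (Nat.card A)).cast : ℤ))
    rw [← zpow_mul, h, zpow_one] at h2
    calc g⁻¹ * a * g⁻¹⁻¹
        = g⁻¹ * (g * a ^ (((u⁻¹ : (ZMod (Nat.card A))ˣ) : ZMod (Nat.card A)).cast : ℤ) * g⁻¹) *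
            g⁻¹⁻¹ := by rw [h2]
      _ = a ^ (((u⁻¹ : (ZMod (Nat.card A))ˣ) : ZMod (Nat.card A)).cast : ℤ) := by
        simp [mul_assoc]

end Groups

/-- A group is metacyclic if it has a cyclic normal subgroup with cyclic quotient. -/
def IsMetacyclic (G : Type*) [Group G] : Prop :=
  ∃ (A : Subgroup G) (_ : A.Normal), IsCyclic A ∧ IsCyclic (G ⧸ A)

/-- A metacyclic factorization `G = AB`: `A` is a cyclic normal subgroup and `B` a cyclic
subgroup. -/
structure Factorization (G : Type*) [Group G] where
  /-- the normal factor -/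
  A : Subgroup G
  /-- the other factor -/
  B : Subgroup G
  normal : A.Normal
  isCyclic_left : IsCyclic A
  isCyclic_right : IsCyclic B
  exists_mul_eq : ∀ g : G, ∃ a ∈ A, ∃ b ∈ B, a * b = g

/-- The type of the values `(m, n, s, Δ)` of the invariant: `Δ` is a subgroup of `U_{m'}` and comes
with its modulus `m'`. -/
abbrev Invariant : Type := ℕ × ℕ × ℕ × (Σ m' : ℕ, Subgroup (ZMod m')ˣ)

namespace Factorization

variable {G : Type*} [Group G] (F : Factorization G)

/-- The triple `(|A|, r_G(A), [G : B])`, lexicographically ordered. -/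
def weight : ℕ ×ₗ ℕ ×ₗ ℕ :=
  toLex (Nat.card F.A, toLex (rInv (actionSubgroup F.A), F.B.index))

/-- A metacyclic factorization `G = AB` is minimal if `(|A|, r_G(A), [G : B])` is minimal in the
lexicographical order. -/
def IsMinimal : Prop := ∀ F' : Factorization G, F.weight ≤ F'.weight

/-- The tuple `(|A|, [G : A], [G : B], Δ(AB))`, where `Δ(AB) = Res_{[T, n, s]}(T)` with
`T = T_G(A)`, `n = [G : A]` and `s = [G : B]`. -/
def invariant : Invariant :=
  (Nat.card F.A, F.A.index, F.B.index,
    ⟨modulus (actionSubgroup F.A) F.A.index F.B.index,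
      res (modulus (actionSubgroup F.A) F.A.index F.B.index) (actionSubgroup F.A)⟩)

end Factorization

open scoped Classical in
/-- `MCINV(G) = (m_G, n_G, s_G, Δ_G)`, read off from some minimal metacyclic factorization of `G`
(with a junk value if there is none). -/
def MCINV (G : Type*) [Group G] : Invariant :=
  if h : ∃ F : Factorization G, F.IsMinimal then h.choose.invariant else (0, 0, 0, ⟨0, ⊥⟩)

end Metacyclic

end

/-!
A metacyclic factorization `G = ⟨a⟩⟨b⟩` can be normalized so that `b ^ n = a ^ s`, where
`n = [G : ⟨a⟩]` and `s = [G : ⟨b⟩]`. With `m = |a|` and `b * a * b⁻¹ = a ^ t`, the numbers `m`, `n`,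
`s`, `t` determine `G` (`GenPair.nonempty_mulEquiv`): `a ^ i * b ^ j = a ^ k * b ^ l` is decided by
congruences between them. The group `T` is generated by the class of `t`, and `r`, `ε`, `o` are read
off from `t` one prime at a time (`pow_dvd_rInv_iff`, `epsInv_eq_one_iff`,
`factorization_oInv_natCast`). What has to be shown is that among the factorizations with given `m`,
`n`, `s`, `r`, the number `t` is determined modulo `[T, n, s]`, up to the choice of a generator of
`T`, and no further.

*Invariance* (`GenPair.modulus_eq_and_res_eq`). Let `a₁ = a ^ z * b ^ w` and `b₁ = a ^ x * b ^ y`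
generate another factorization with the same `m`, `n`, `s`, `r`. On the `ν`-part of `⟨a₁⟩`, which
consists of commutators and so lies in `⟨a⟩`, the element `b₁` acts as `b ^ y` and `b ^ w` acts
trivially; hence `t₁ ≡ t ^ y` there, and `w` is divisible by the `π(r)`-part of `o`. Written in
coordinates, the relation `b₁ * a₁ * b₁⁻¹ = a₁ ^ t₁` is a congruence modulo `m`
(`GenPair.relation`), and reducing it modulo the factor `m'_p` of `[T, n, s]` gives `t₁ ≡ t ^ y`
modulo `m'_p` (`local_comparison_pos`, `local_comparison_neg`). The definition of `m'_p` is exactly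
what makes the other terms of the congruence vanish. When `ε = -1` there is one configuration in
which a term survives unless `x` is even; there the order of `b₁` forces `x` to be even
(`GenPair.two_dvd_of_orderOf`).

*Completeness* (`GenPair.nonempty_mulEquiv_of_res_eq`). If two minimal factorizations have the same
`m`, `n`, `s` and `Δ`, their numbers `t` and `t'` may be taken congruent modulo `[T, n, s]`; then
they have the same `r`, `ε`, `o`. For each prime `p ∣ r` in turn the generators of the first group
are changed so that `t` becomes `t'` modulo `m_p` and stays as it is modulo the rest of `m`
(`GenPair.exists_change_at`). If `t'` is a power of `t` at `p` with an exponent that is trivial on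
the `ν`-part, then `b` is replaced by a power (`GenPair.exists_change_right`). Otherwise `a` is
replaced by some `a ^ z * b ^ w`, with `w` divisible enough for `b ^ w` to be trivial on the
`p'`-part of `⟨a⟩` and with `z` solving the congruence above (`GenPair.exists_change_left_at`). The
order of the new element divides `m`, and it is `m` because `m` is minimal: this is where minimality
enters. In the end `t ≡ t'` modulo `m`, and the two groups are isomorphic.
-/

namespace Metacyclic

/-! ### Parts of integers, and restriction of cyclic groups of units -/

theorem piPart_eq_prod (π : Set ℕ) [DecidablePred (· ∈ π)] (m : ℕ) :
    piPart π m = (m.factorization.filter (· ∈ π)).prod fun p k => p ^ k := by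
  classical
  rw [Finsupp.prod_filter_index, piPart, Finsupp.support_filter]
  refine Finset.prod_congr ?_ fun _ _ => rfl
  ext; simp

theorem factorization_piPart (π : Set ℕ) [DecidablePred (· ∈ π)] (m : ℕ) :
    (piPart π m).factorization = m.factorization.filter (· ∈ π) := by
  rw [piPart_eq_prod]
  refine Nat.prod_pow_factorization_eq_self fun p hp => ?_
  rw [Finsupp.support_filter, Finset.mem_filter] at hp
  exact Nat.prime_of_mem_primeFactors hp.1

theorem piPart_ne_zero (π : Set ℕ) (m : ℕ) : piPart π m ≠ 0 := by
  classical
  refine Finset.prod_ne_zero_iff.mpr fun p hp => ?_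
  exact pow_ne_zero _ (Nat.prime_of_mem_primeFactors (Finset.mem_filter.mp hp).1).ne_zero

theorem pow_dvd_piPart_iff {π : Set ℕ} {m p k : ℕ} (hm : m ≠ 0) (hp : p.Prime) :
    p ^ k ∣ piPart π m ↔ k = 0 ∨ (p ∈ π ∧ p ^ k ∣ m) := by
  classical
  rw [hp.pow_dvd_iff_le_factorization (piPart_ne_zero _ _), factorization_piPart,
    hp.pow_dvd_iff_le_factorization hm, Finsupp.filter_apply]
  split_ifs with h <;> simp [h]
  intro h0; simp [h0]

theorem piPart_dvd (π : Set ℕ) {m : ℕ} (hm : m ≠ 0) : piPart π m ∣ m := by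
  rw [Nat.dvd_iff_prime_pow_dvd_dvd]
  intro p k hp h
  rcases (pow_dvd_piPart_iff hm hp).mp h with rfl | h
  · simp
  · exact h.2

theorem piPart_singleton {p : ℕ} (hp : p.Prime) (m : ℕ) :
    piPart {p} m = p ^ m.factorization p := by
  classical
  rw [piPart, Finset.prod_filter]
  by_cases h : p ∈ m.primeFactors
  · rw [Finset.prod_eq_single p] <;> simp_all
  · rw [Finset.prod_eq_one]
    · rw [← Nat.support_factorization, Finsupp.notMem_support_iff] at h
      rw [h, pow_zero]
    · intro q hq
      rw [if_neg]
      rintro rfl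
      exact h hq

/-- An integer is divisible by `d` as soon as it is divisible by the prime powers dividing `d`. -/
theorem natCast_dvd_iff_prime_pow {d : ℕ} {z : ℤ} :
    (d : ℤ) ∣ z ↔ ∀ p k : ℕ, p.Prime → p ^ k ∣ d → (p : ℤ) ^ k ∣ z := by
  rw [Int.natCast_dvd, Nat.dvd_iff_prime_pow_dvd_dvd]
  simp only [← Int.natCast_dvd, Nat.cast_pow]

theorem res_zpowers {m q : ℕ} (h : q ∣ m) (u : (ZMod m)ˣ) :
    res q (Subgroup.zpowers u) = Subgroup.zpowers (ZMod.unitsMap h u) := by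
  rw [res, dif_pos h, MonoidHom.map_zpowers]

theorem val_unitsMap {m q : ℕ} (h : q ∣ m) {u : (ZMod m)ˣ} {t : ℕ} (hu : (u : ZMod m) = t) :
    ((ZMod.unitsMap h u : (ZMod q)ˣ) : ZMod q) = t := by
  rw [ZMod.unitsMap_val, hu, ZMod.cast_natCast h]

theorem unit_eq_one_iff {q : ℕ} {v : (ZMod q)ˣ} {t : ℕ} (hv : (v : ZMod q) = t) :
    v = 1 ↔ (q : ℤ) ∣ t - 1 := by
  rw [← Units.val_inj, hv, Units.val_one, ← ZMod.intCast_zmod_eq_zero_iff_dvd]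
  push_cast
  rw [sub_eq_zero]

theorem unit_eq_neg_one_iff {q : ℕ} {v : (ZMod q)ˣ} {t : ℕ} (hv : (v : ZMod q) = t) :
    v = -1 ↔ (q : ℤ) ∣ t + 1 := by
  rw [← Units.val_inj, hv, Units.val_neg, Units.val_one, ← ZMod.intCast_zmod_eq_zero_iff_dvd]
  push_cast
  rw [eq_neg_iff_add_eq_zero]

theorem mem_zpowers_neg_one {q : ℕ} {v : (ZMod q)ˣ} :
    v ∈ Subgroup.zpowers (-1 : (ZMod q)ˣ) ↔ v = 1 ∨ v = -1 := by
  constructor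
  · rintro ⟨k, rfl⟩
    rcases Int.even_or_odd k with h | h
    · left; simp [h.neg_one_zpow]
    · right; simp [h.neg_one_zpow]
  · rintro (rfl | rfl)
    · exact Subgroup.one_mem _
    · exact Subgroup.mem_zpowers _

/-! ### The integer `r` and the sign `ε` of a cyclic group of units -/

/-- The local condition at a prime `p` for `p ^ k` to divide the integer `r` of the group
generated by `t`: the class of `t` modulo `p ^ k` is trivial, or `-1` in case `p = 2`. -/
def TrivialAt (t p k : ℕ) : Prop :=
  (p : ℤ) ^ k ∣ t - 1 ∨ (p = 2 ∧ (p : ℤ) ^ k ∣ t + 1)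

theorem trivialAt_zero (t p : ℕ) : TrivialAt t p 0 := Or.inl (by simp)

theorem trivialAt_two {t k : ℕ} :
    TrivialAt t 2 k ↔ (2 : ℤ) ^ k ∣ t - 1 ∨ (2 : ℤ) ^ k ∣ t + 1 := by
  simp [TrivialAt]

theorem trivialAt_iff_of_ne_two {t p k : ℕ} (hp : p ≠ 2) :
    TrivialAt t p k ↔ (p : ℤ) ^ k ∣ t - 1 := by
  simp [TrivialAt, hp]

theorem TrivialAt.congr {t t' p k : ℕ} (h : TrivialAt t p k) (hk : (p : ℤ) ^ k ∣ t - t') :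
    TrivialAt t' p k := by
  rcases h with h | ⟨h2, h⟩
  · left
    have := dvd_sub h hk
    ring_nf at this ⊢
    exact this
  · right
    refine ⟨h2, ?_⟩
    have := dvd_sub h hk
    ring_nf at this ⊢
    exact this

section

variable {m : ℕ} {u : (ZMod m)ˣ} {t : ℕ}

theorem rInv_condition_iff (hm : m ≠ 0) (hu : (u : ZMod m) = t) {d : ℕ} (hd : d ∣ m) :
    (res (piPart {2}ᶜ d) (Subgroup.zpowers u) = ⊥ ∧
      res (piPart {2} d) (Subgroup.zpowers u) ≤ Subgroup.zpowers (-1)) ↔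
    ∀ p k : ℕ, p.Prime → p ^ k ∣ d → TrivialAt t p k := by
  have hd0 : d ≠ 0 := ne_zero_of_dvd_ne_zero hm hd
  have h1 := (piPart_dvd {2}ᶜ hd0).trans hd
  have h2 := (piPart_dvd {2} hd0).trans hd
  rw [res_zpowers h1, res_zpowers h2, Subgroup.zpowers_eq_bot, Subgroup.zpowers_le,
    mem_zpowers_neg_one, unit_eq_one_iff (val_unitsMap h1 hu), unit_eq_one_iff (val_unitsMap h2 hu),
    unit_eq_neg_one_iff (val_unitsMap h2 hu), natCast_dvd_iff_prime_pow,
    piPart_singleton Nat.prime_two]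
  push_cast
  constructor
  · rintro ⟨ha, hb⟩ p k hp hk
    rcases eq_or_ne p 2 with rfl | hp2
    · rw [trivialAt_two]
      have hk' := (Nat.prime_two.pow_dvd_iff_le_factorization hd0).mp hk
      exact hb.imp (pow_dvd_pow _ hk').trans (pow_dvd_pow _ hk').trans
    · exact Or.inl (ha p k hp ((pow_dvd_piPart_iff hd0 hp).mpr (Or.inr ⟨hp2, hk⟩)))
  · intro h
    refine ⟨fun p k hp hk => ?_, trivialAt_two.mp (h 2 _ Nat.prime_two (Nat.ordProj_dvd d 2))⟩
    rcases (pow_dvd_piPart_iff hd0 hp).mp hk with rfl | ⟨hp2, hk⟩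
    · simp
    · exact (trivialAt_iff_of_ne_two hp2).mp (h p k hp hk)

/-- The divisors of `m` satisfying the condition that defines `r` are exactly the divisors
of `r`. -/
theorem dvd_rInv_iff (hm : m ≠ 0) (hu : (u : ZMod m) = t) {d : ℕ} (hd : d ∣ m) :
    d ∣ rInv (Subgroup.zpowers u) ↔ ∀ p k : ℕ, p.Prime → p ^ k ∣ d → TrivialAt t p k := by
  classical
  set S := m.divisors.filter fun d => ∀ p k : ℕ, p.Prime → p ^ k ∣ d → TrivialAt t p k with hS
  have hr : rInv (Subgroup.zpowers u) = S.sup id := by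
    rw [rInv, hS]
    congr 1
    refine Finset.filter_congr fun d hd => ?_
    exact rInv_condition_iff hm hu (Nat.dvd_of_mem_divisors hd)
  have hne : S.Nonempty := by
    refine ⟨1, ?_⟩
    simp only [hS, Finset.mem_filter, Nat.mem_divisors, one_dvd, true_and, Nat.dvd_one]
    refine ⟨hm, fun p k hp h => ?_⟩
    rcases Nat.pow_eq_one.mp h with h | rfl
    · exact absurd h hp.one_lt.ne'
    · exact trivialAt_zero _ _
  obtain ⟨r, hrS, hr'⟩ := Finset.exists_mem_eq_sup S hne id
  rw [hr, hr', id]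
  have hrS' := hrS
  simp only [hS, Finset.mem_filter, Nat.mem_divisors] at hrS'
  obtain ⟨⟨hrm, -⟩, hrt⟩ := hrS'
  constructor
  · exact fun h p k hp hk => hrt p k hp (hk.trans h)
  · intro h
    have hr0 : r ≠ 0 := ne_zero_of_dvd_ne_zero hm hrm
    have hd0 : d ≠ 0 := ne_zero_of_dvd_ne_zero hm hd
    have hl : Nat.lcm r d ∈ S := by
      simp only [hS, Finset.mem_filter, Nat.mem_divisors]
      refine ⟨⟨Nat.lcm_dvd hrm hd, hm⟩, fun p k hp hk => ?_⟩
      rw [hp.pow_dvd_iff_le_factorization (Nat.lcm_ne_zero hr0 hd0),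
        Nat.factorization_lcm hr0 hd0, Finsupp.sup_apply, le_sup_iff] at hk
      rcases hk with hk | hk
      · exact hrt p k hp ((hp.pow_dvd_iff_le_factorization hr0).mpr hk)
      · exact h p k hp ((hp.pow_dvd_iff_le_factorization hd0).mpr hk)
    have hle : Nat.lcm r d ≤ r := by
      have := Finset.le_sup (f := id) hl
      rwa [hr'] at this
    have : Nat.lcm r d = r :=
      le_antisymm hle (Nat.le_of_dvd (Nat.pos_of_ne_zero (Nat.lcm_ne_zero hr0 hd0))
        (Nat.dvd_lcm_left r d))
    rw [← this]
    exact Nat.dvd_lcm_right r d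

theorem pow_dvd_rInv_iff (hm : m ≠ 0) (hu : (u : ZMod m) = t) {p k : ℕ} (hp : p.Prime)
    (hd : p ^ k ∣ m) : p ^ k ∣ rInv (Subgroup.zpowers u) ↔ TrivialAt t p k := by
  rw [dvd_rInv_iff hm hu hd]
  refine ⟨fun h => h p k hp dvd_rfl, fun h q l hq hl => ?_⟩
  rcases Nat.eq_zero_or_pos l with rfl | hl0
  · exact trivialAt_zero _ _
  · have hqp : q = p := (Nat.prime_dvd_prime_iff_eq hq hp).mp
      (hq.dvd_of_dvd_pow ((dvd_pow_self q hl0.ne').trans hl))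
    subst hqp
    have hlk := (Nat.pow_dvd_pow_iff_le_right hq.one_lt).mp hl
    refine h.imp (pow_dvd_pow _ hlk).trans (And.imp_right (pow_dvd_pow _ hlk).trans)

theorem rInv_dvd (hm : m ≠ 0) (T : Subgroup (ZMod m)ˣ) : rInv T ∣ m := by
  classical
  rw [rInv]
  rcases Finset.eq_empty_or_nonempty (m.divisors.filter fun d => res (piPart {2}ᶜ d) T = ⊥ ∧
    res (piPart {2} d) T ≤ Subgroup.zpowers (-1)) with h | h
  · exfalso
    have h1 : (1 : ℕ) ∈ (m.divisors.filter fun d => res (piPart {2}ᶜ d) T = ⊥ ∧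
        res (piPart {2} d) T ≤ Subgroup.zpowers (-1)) := by
      have e : ∀ q : ℕ, q = 1 → ∀ S S' : Subgroup (ZMod q)ˣ, S = S' := by
        rintro _ rfl S S'
        exact Subsingleton.elim _ _
      have e' : ∀ π : Set ℕ, piPart π 1 = 1 := fun π => by simp [piPart]
      simp only [Finset.mem_filter, Nat.mem_divisors, one_dvd, true_and]
      exact ⟨hm, e _ (e' _) _ _, (e _ (e' _) _ _).le⟩
    rw [h] at h1
    simp at h1
  · obtain ⟨r, hr, hr'⟩ := Finset.exists_mem_eq_sup _ h id
    rw [hr']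
    exact Nat.dvd_of_mem_divisors (Finset.mem_filter.mp hr).1

theorem rInv_ne_zero (hm : m ≠ 0) (T : Subgroup (ZMod m)ˣ) : rInv T ≠ 0 :=
  ne_zero_of_dvd_ne_zero hm (rInv_dvd hm T)

theorem prime_dvd_sub_one (hm : m ≠ 0) (hu : (u : ZMod m) = t) {p : ℕ} (hp : p.Prime)
    (hpr : p ∣ rInv (Subgroup.zpowers u)) : (p : ℤ) ∣ t - 1 := by
  have hpm : p ^ 1 ∣ m := (pow_one p).symm ▸ hpr.trans (rInv_dvd hm _)
  rcases (pow_dvd_rInv_iff hm hu hp hpm).mp ((pow_one p).symm ▸ hpr) with h | ⟨rfl, h⟩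
  · rwa [pow_one] at h
  · rw [pow_one] at h
    push_cast at h ⊢
    omega

theorem epsInv_eq_one_or (T : Subgroup (ZMod m)ˣ) : epsInv T = 1 ∨ epsInv T = -1 := by
  rw [epsInv]
  split_ifs <;> simp

theorem epsInv_eq_one_iff (hm : m ≠ 0) (hu : (u : ZMod m) = t) :
    epsInv (Subgroup.zpowers u) = 1 ↔
      (2 : ℤ) ^ (rInv (Subgroup.zpowers u)).factorization 2 ∣ t - 1 := by
  have h0 := rInv_ne_zero hm (Subgroup.zpowers u)
  have h := (piPart_dvd {2} h0).trans (rInv_dvd hm _)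
  have h2 : res (piPart {2} (rInv (Subgroup.zpowers u))) (Subgroup.zpowers u) = ⊥ ↔
      (2 : ℤ) ^ (rInv (Subgroup.zpowers u)).factorization 2 ∣ t - 1 := by
    rw [res_zpowers h, Subgroup.zpowers_eq_bot, unit_eq_one_iff (val_unitsMap h hu),
      piPart_singleton Nat.prime_two]
    push_cast
    rfl
  rw [epsInv, ← h2]
  split_ifs with h1 <;> simp_all

/-- The shape of a generator at a prime `p` dividing `r` where `ε ^ (p - 1) = 1`. -/
theorem positive_case (hm : m ≠ 0) (hu : (u : ZMod m) = t) {p : ℕ} (hp : p.Prime)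
    (hpr : p ∣ rInv (Subgroup.zpowers u)) (he : epsInv (Subgroup.zpowers u) ^ (p - 1) = 1) :
    1 ≤ (rInv (Subgroup.zpowers u)).factorization p ∧
    (rInv (Subgroup.zpowers u)).factorization p ≤ m.factorization p ∧
    (p : ℤ) ^ (rInv (Subgroup.zpowers u)).factorization p ∣ t - 1 ∧
    ((rInv (Subgroup.zpowers u)).factorization p < m.factorization p →
      ¬ (p : ℤ) ^ ((rInv (Subgroup.zpowers u)).factorization p + 1) ∣ t - 1 ∧
      (p = 2 → 2 ≤ (rInv (Subgroup.zpowers u)).factorization p)) := by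
  set r := rInv (Subgroup.zpowers u) with hr
  have h0 : r ≠ 0 := rInv_ne_zero hm _
  have hrm : r ∣ m := rInv_dvd hm _
  have hle := (Nat.factorization_le_iff_dvd h0 hm).mpr hrm p
  have key : ∀ k, k ≤ m.factorization p → (TrivialAt t p k ↔ k ≤ r.factorization p) := by
    intro k hk
    rw [← pow_dvd_rInv_iff hm hu hp ((hp.pow_dvd_iff_le_factorization hm).mpr hk), ← hr,
      hp.pow_dvd_iff_le_factorization h0]
  refine ⟨(hp.dvd_iff_one_le_factorization h0).mp hpr, hle, ?_, fun hlt => ⟨fun h => ?_, ?_⟩⟩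
  · have := (key _ hle).mpr le_rfl
    rcases eq_or_ne p 2 with rfl | hp2
    · norm_num at he
      exact (epsInv_eq_one_iff hm hu).mp he
    · exact (trivialAt_iff_of_ne_two hp2).mp this
  · have := (key _ hlt).mp (Or.inl h)
    omega
  · rintro rfl
    by_contra hlt2
    have h1 := (hp.dvd_iff_one_le_factorization h0).mp hpr
    have := (key 2 (by omega)).mp (trivialAt_two.mpr (by
      have : Nat.Coprime t m := (ZMod.isUnit_iff_coprime t m).mp (hu ▸ u.isUnit)
      have h2 : ¬ 2 ∣ t := fun h => by
        have := Nat.dvd_gcd h (hpr.trans hrm)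
        rw [Nat.Coprime] at *
        omega
      omega))
    omega

/-- The shape of a generator at the prime `2` when `ε = -1`. -/
theorem negative_case (hm : m ≠ 0) (hu : (u : ZMod m) = t)
    (he : epsInv (Subgroup.zpowers u) ≠ 1) :
    2 ≤ (rInv (Subgroup.zpowers u)).factorization 2 ∧
    (rInv (Subgroup.zpowers u)).factorization 2 ≤ m.factorization 2 ∧
    (2 : ℤ) ^ (rInv (Subgroup.zpowers u)).factorization 2 ∣ t + 1 ∧
    ((rInv (Subgroup.zpowers u)).factorization 2 < m.factorization 2 →
      ¬ (2 : ℤ) ^ ((rInv (Subgroup.zpowers u)).factorization 2 + 1) ∣ t + 1) := by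
  set r := rInv (Subgroup.zpowers u) with hr
  have h0 : r ≠ 0 := rInv_ne_zero hm _
  have hrm : r ∣ m := rInv_dvd hm _
  have hle := (Nat.factorization_le_iff_dvd h0 hm).mpr hrm 2
  have key : ∀ k, k ≤ m.factorization 2 → (TrivialAt t 2 k ↔ k ≤ r.factorization 2) := by
    intro k hk
    rw [← pow_dvd_rInv_iff hm hu Nat.prime_two
      ((Nat.prime_two.pow_dvd_iff_le_factorization hm).mpr hk), ← hr,
      Nat.prime_two.pow_dvd_iff_le_factorization h0]
  rw [Ne, epsInv_eq_one_iff hm hu, ← hr] at he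
  have h1 := (trivialAt_two.mp ((key _ hle).mpr le_rfl)).resolve_left he
  refine ⟨?_, hle, h1, fun hlt h => ?_⟩
  · by_contra hlt
    have : r.factorization 2 = 0 ∨ r.factorization 2 = 1 := by omega
    rcases this with h | h <;> rw [h] at he h1
    · simp at he
    · omega
  · have := (key _ hlt).mp (trivialAt_two.mpr (Or.inr h))
    omega

end

/-! ### The integer `o` and the modulus -/

/-- The order of the image of the Hall `π`-subgroup of a cyclic group has the same `p`-part, for
`p ∈ π`, as the order of the image of the whole group. -/
theorem factorization_card_map_hallPart {M M' : Type*} [CommGroup M] [CommGroup M'] [Finite M]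
    [Finite M'] (f : M →* M') (x : M) (π : Set ℕ) {p : ℕ} (hp : p.Prime) (hpπ : p ∈ π) :
    (Nat.card ((hallPart π (Subgroup.zpowers x)).map f)).factorization p =
      (orderOf (f x)).factorization p := by
  have hN : orderOf x ≠ 0 := (orderOf_pos x).ne'
  set k := piPart πᶜ (orderOf x) with hk
  have hkN : k ∣ orderOf x := piPart_dvd _ hN
  have hk0 : k ≠ 0 := piPart_ne_zero _ _
  have hpk : ¬ p ∣ k := by
    intro h
    rw [← pow_one p, hk, pow_dvd_piPart_iff hN hp] at h
    rcases h with h | h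
    · exact one_ne_zero h
    · exact h.1 hpπ
  have hxk : x ^ k ∈ hallPart π (Subgroup.zpowers x) := by
    refine ⟨Subgroup.pow_mem _ (Subgroup.mem_zpowers x) k, fun q hq hqd => ?_⟩
    by_contra hqπ
    rw [orderOf_pow_of_dvd hk0 hkN] at hqd
    have h1 : k * q ∣ orderOf x := by
      obtain ⟨c, hc⟩ := hqd
      refine ⟨c, ?_⟩
      rw [mul_assoc, ← hc, Nat.mul_div_cancel' hkN]
    have h2 : q ^ (k.factorization q + 1) ∣ k := by
      rw [hk, pow_dvd_piPart_iff hN hq, ← hk]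
      refine Or.inr ⟨hqπ, ?_⟩
      rw [pow_succ]
      exact (Nat.mul_dvd_mul_right (Nat.ordProj_dvd k q) q).trans h1
    rw [hq.pow_dvd_iff_le_factorization hk0] at h2
    omega
  have hle : (hallPart π (Subgroup.zpowers x)).map f ≤ Subgroup.zpowers (f x) := by
    rw [← MonoidHom.map_zpowers]
    exact Subgroup.map_mono fun y hy => hy.1
  have hcard0 : Nat.card ((hallPart π (Subgroup.zpowers x)).map f) ≠ 0 := Nat.card_pos.ne'
  have hO : orderOf (f x) ≠ 0 := (orderOf_pos _).ne'
  apply le_antisymm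
  · have h1 := Subgroup.card_dvd_of_le hle
    rw [Nat.card_zpowers] at h1
    exact (Nat.factorization_le_iff_dvd hcard0 hO).mpr h1 p
  · have h1 : orderOf (f x ^ k) ∣ Nat.card ((hallPart π (Subgroup.zpowers x)).map f) := by
      rw [← map_pow]
      exact Subgroup.orderOf_dvd_natCard _ (Subgroup.mem_map_of_mem f hxk)
    have h2 := (Nat.factorization_le_iff_dvd (orderOf_pos _).ne' hcard0).mpr h1 p
    rw [orderOf_pow] at h2
    refine le_trans (le_of_eq ?_) h2
    rw [Nat.factorization_div (Nat.gcd_dvd_left _ _), Finsupp.tsub_apply,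
      Nat.factorization_eq_zero_of_not_dvd (n := Nat.gcd (orderOf (f x)) k)
        fun h => hpk (h.trans (Nat.gcd_dvd_right _ _)), Nat.sub_zero]

section

variable {m : ℕ} {u : (ZMod m)ˣ} {t : ℕ}

theorem factorization_oInv [NeZero m] (u : (ZMod m)ˣ) {p : ℕ}
    (hp : p ∈ (rInv (Subgroup.zpowers u)).primeFactors) :
    (oInv (Subgroup.zpowers u)).factorization p =
      (orderOf (ZMod.unitsMap (piPart_dvd (nu (Subgroup.zpowers u) : Set ℕ) (NeZero.ne m))
        u)).factorization p := by
  have : NeZero (piPart (nu (Subgroup.zpowers u) : Set ℕ) m) := ⟨piPart_ne_zero _ _⟩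
  rw [oInv, res, dif_pos (piPart_dvd _ (NeZero.ne m)),
    factorization_card_map_hallPart _ _ _ (Nat.prime_of_mem_primeFactors hp)]
  simp [nu, hp]

/-- The exponent of `p` in the local modulus, in terms of the exponents of `p` in `m`, `n`, `s`,
`r` and `o`. -/
def locExp (p : ℕ) (ε : ℤ) (μ η σ ρ ω : ℕ) : ℕ :=
  if ε ^ (p - 1) = 1 then min μ (min (ω + ρ) (max ρ (max σ (ρ + σ + ω - η))))
  else if ω ≤ 1 ∨ μ ≤ ρ + 1 then ρ
  else if 2 ≤ ω ∧ ω < η ∧ ρ + 2 ≤ μ ∧ (σ ≠ η + ρ → σ + 1 = μ ∧ μ < η + ρ) then μ - 1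
  else μ

theorem locExp_le {p : ℕ} {ε : ℤ} {μ η σ ρ ω : ℕ} (h : ρ ≤ μ) : locExp p ε μ η σ ρ ω ≤ μ := by
  unfold locExp
  split_ifs <;> omega

theorem le_locExp {p : ℕ} {ε : ℤ} {μ η σ ρ ω : ℕ} (h : ρ ≤ μ) : ρ ≤ locExp p ε μ η σ ρ ω := by
  unfold locExp
  split_ifs <;> omega

/-- If the exponent of `p` for `ε ^ (p - 1) = 1` is below its two upper bounds, then it is the
maximum of the three other terms. -/
theorem le_of_locExp_lt {e μ η σ ρ ω : ℕ}
    (he : e = min μ (min (ω + ρ) (max ρ (max σ (ρ + σ + ω - η))))) (hμ : e < μ) (hω : e < ρ + ω) :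
    ρ ≤ e ∧ σ ≤ e ∧ ρ + σ + ω ≤ e + η ∧ σ < η := by
  have h : e = max ρ (max σ (ρ + σ + ω - η)) := by omega
  clear he
  omega

theorem localModulus_eq {p : ℕ} (hp : p.Prime) {ε : ℤ} {μ η σ ρ ω : ℕ} (hμ : 1 ≤ μ)
    (hε : ε ^ (p - 1) ≠ 1 → p = 2) :
    localModulus p ε (p ^ μ) (p ^ η) (p ^ σ) (p ^ ρ) (p ^ ω) = p ^ locExp p ε μ η σ ρ ω := by
  have hmono : StrictMono fun k : ℕ => p ^ k := pow_right_strictMono₀ hp.one_lt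
  unfold localModulus locExp
  by_cases h : ε ^ (p - 1) = 1
  · rw [if_pos h, if_pos h]
    have hq : max (p ^ ρ) (max (p ^ σ) (p ^ ρ * (p ^ σ * p ^ ω) / p ^ η)) =
        p ^ max ρ (max σ (ρ + σ + ω - η)) := by
      rw [hmono.monotone.map_max, hmono.monotone.map_max]
      rcases le_total η (ρ + σ + ω) with hle | hle
      · rw [← pow_add, ← pow_add, Nat.pow_div (by omega) hp.pos, ← add_assoc]
      · -- The truncated quotient is at most `1`, so that it does not affect the maximum.
        have h1 : p ^ ρ * (p ^ σ * p ^ ω) / p ^ η ≤ p ^ ρ := by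
          refine le_trans (Nat.div_le_of_le_mul ?_) (Nat.one_le_pow ρ _ hp.pos)
          rw [← pow_add, ← pow_add, ← add_assoc, mul_one]
          exact Nat.pow_le_pow_right hp.pos hle
        have h2 : p ^ (ρ + σ + ω - η) ≤ p ^ ρ := Nat.pow_le_pow_right hp.pos (by omega)
        rw [← max_assoc, ← max_assoc, max_eq_left (h1.trans (le_max_left _ _)),
          max_eq_left (h2.trans (le_max_left _ _))]
    rw [hq, hmono.monotone.map_min, hmono.monotone.map_min, pow_add]
  · have hp2 := hε h
    subst hp2
    rw [if_neg h, if_neg h]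
    have h1 : 2 ^ ω ≤ 2 ↔ ω ≤ 1 := by
      conv_lhs => rhs; rw [← pow_one 2]
      exact hmono.le_iff_le
    have h2 : 2 ^ μ ≤ 2 * 2 ^ ρ ↔ μ ≤ ρ + 1 := by
      rw [mul_comm, ← pow_succ]; exact hmono.le_iff_le
    have h3 : 4 ≤ 2 ^ ω ↔ 2 ≤ ω := by
      rw [show 4 = 2 ^ 2 from rfl]; exact hmono.le_iff_le
    have h4 : 4 * 2 ^ ρ ≤ 2 ^ μ ↔ ρ + 2 ≤ μ := by
      rw [show 4 = 2 ^ 2 from rfl, mul_comm, ← pow_add]; exact hmono.le_iff_le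
    have h5 : 2 ^ σ ≠ 2 ^ η * 2 ^ ρ ↔ σ ≠ η + ρ := by
      rw [← pow_add]; exact hmono.injective.ne_iff
    have h6 : 2 * 2 ^ σ = 2 ^ μ ↔ σ + 1 = μ := by
      rw [mul_comm, ← pow_succ]; exact hmono.injective.eq_iff
    have h7 : 2 ^ μ < 2 ^ η * 2 ^ ρ ↔ μ < η + ρ := by
      rw [← pow_add]; exact hmono.lt_iff_lt
    have h8 : 2 ^ ω < 2 ^ η ↔ ω < η := hmono.lt_iff_lt
    have h9 : 2 ^ μ / 2 = 2 ^ (μ - 1) := by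
      conv_lhs => rhs; rw [← pow_one 2]
      exact Nat.pow_div hμ two_pos
    rw [h9]
    simp only [h1, h2, h3, h4, h5, h6, h7, h8]
    split_ifs <;> rfl

/-- The exponent of `p` in `[T, n, s]`, for a prime `p` dividing `r`. -/
noncomputable def modExp (T : Subgroup (ZMod m)ˣ) (n s p : ℕ) : ℕ :=
  locExp p (epsInv T) (m.factorization p) (n.factorization p) (s.factorization p)
    ((rInv T).factorization p) ((oInv T).factorization p)

theorem eps_pow_eq_one {T : Subgroup (ZMod m)ˣ} {p : ℕ} (hp : p.Prime) (hp2 : p ≠ 2) :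
    epsInv T ^ (p - 1) = 1 := by
  have h : Even (p - 1) := (hp.even_sub_one hp2)
  rcases epsInv_eq_one_or T with h1 | h1 <;> simp [h1, h.neg_one_pow]

theorem modulus_eq (hm : m ≠ 0) (T : Subgroup (ZMod m)ˣ) (n s : ℕ) :
    modulus T n s = piPart (nu T : Set ℕ) m *
      ∏ p ∈ (rInv T).primeFactors, p ^ modExp T n s p := by
  rw [modulus]
  congr 1
  refine Finset.prod_congr rfl fun p hp => ?_
  have hp' := Nat.prime_of_mem_primeFactors hp
  simp only [piPart_singleton hp']
  refine localModulus_eq hp' ?_ fun h => ?_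
  · exact (hp'.dvd_iff_one_le_factorization hm).mp
      ((Nat.dvd_of_mem_primeFactors hp).trans (rInv_dvd hm T))
  · by_contra h2
    exact h (eps_pow_eq_one hp' h2)

theorem factorization_rInv_le (hm : m ≠ 0) (T : Subgroup (ZMod m)ˣ) (p : ℕ) :
    (rInv T).factorization p ≤ m.factorization p :=
  (Nat.factorization_le_iff_dvd (rInv_ne_zero hm T) hm).mpr (rInv_dvd hm T) p

theorem modExp_le (hm : m ≠ 0) (T : Subgroup (ZMod m)ˣ) (n s p : ℕ) :
    modExp T n s p ≤ m.factorization p :=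
  locExp_le (factorization_rInv_le hm T p)

theorem modulus_dvd_iff (hm : m ≠ 0) (T : Subgroup (ZMod m)ˣ) (n s : ℕ) {z : ℤ} :
    (modulus T n s : ℤ) ∣ z ↔ ((piPart (nu T : Set ℕ) m : ℕ) : ℤ) ∣ z ∧
      ∀ p ∈ (rInv T).primeFactors, (p : ℤ) ^ modExp T n s p ∣ z := by
  rw [modulus_eq hm]
  push_cast
  constructor
  · intro h
    refine ⟨(Dvd.intro _ rfl).trans h, fun p hp => ?_⟩
    exact ((Finset.dvd_prod_of_mem (fun p : ℕ => (p : ℤ) ^ modExp T n s p) hp).trans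
      (Dvd.intro_left _ rfl)).trans h
  · rintro ⟨h1, h2⟩
    refine IsCoprime.mul_dvd ?_ h1 (Finset.prod_dvd_of_coprime ?_ h2)
    · refine IsCoprime.prod_right fun p hp => ?_
      have hp' := Nat.prime_of_mem_primeFactors hp
      refine IsCoprime.pow_right (Nat.isCoprime_iff_coprime.mpr (Nat.Coprime.symm ?_))
      rw [hp'.coprime_iff_not_dvd]
      intro h
      rw [← pow_one p, pow_dvd_piPart_iff hm hp'] at h
      rcases h with h | h
      · exact one_ne_zero h
      · have := h.1
        simp only [nu, Finset.mem_coe, Finset.mem_sdiff] at this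
        exact this.2 hp
    · intro p hp q hq hpq
      exact IsCoprime.pow (Nat.isCoprime_iff_coprime.mpr ((Nat.coprime_primes
        (Nat.prime_of_mem_primeFactors hp) (Nat.prime_of_mem_primeFactors hq)).mpr hpq))

theorem modulus_dvd (hm : m ≠ 0) (T : Subgroup (ZMod m)ˣ) (n s : ℕ) : modulus T n s ∣ m := by
  rw [← Int.natCast_dvd_natCast, modulus_dvd_iff hm]
  refine ⟨Int.natCast_dvd_natCast.mpr (piPart_dvd _ hm), fun p _ => ?_⟩
  exact_mod_cast (pow_dvd_pow p (modExp_le hm T n s p)).trans (Nat.ordProj_dvd m p)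

theorem modulus_ne_zero (hm : m ≠ 0) (T : Subgroup (ZMod m)ˣ) (n s : ℕ) : modulus T n s ≠ 0 :=
  ne_zero_of_dvd_ne_zero hm (modulus_dvd hm T n s)

theorem pow_dvd_modulus (hm : m ≠ 0) (T : Subgroup (ZMod m)ˣ) (n s : ℕ) {p : ℕ}
    (hp : p ∈ (rInv T).primeFactors) : (p : ℤ) ^ modExp T n s p ∣ modulus T n s :=
  ((modulus_dvd_iff hm T n s).mp dvd_rfl).2 p hp

theorem piPart_nu_dvd_modulus (T : Subgroup (ZMod m)ˣ) (n s : ℕ) :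
    piPart (nu T : Set ℕ) m ∣ modulus T n s :=
  Dvd.intro _ rfl

theorem rInv_dvd_modulus (hm : m ≠ 0) (T : Subgroup (ZMod m)ˣ) (n s : ℕ) :
    rInv T ∣ modulus T n s := by
  rw [← Int.natCast_dvd_natCast, natCast_dvd_iff_prime_pow]
  intro p k hp hk
  rcases Nat.eq_zero_or_pos k with rfl | hk0
  · simp
  · have h0 := rInv_ne_zero hm T
    have hpm : p ∈ (rInv T).primeFactors :=
      Nat.mem_primeFactors.mpr ⟨hp, (dvd_pow_self p hk0.ne').trans hk, h0⟩
    refine (pow_dvd_pow _ ?_).trans (pow_dvd_modulus hm T n s hpm)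
    exact ((hp.pow_dvd_iff_le_factorization h0).mp hk).trans
      (le_locExp (factorization_rInv_le hm T p))

end

/-! ### Pairs of generators of a metacyclic factorization -/

theorem exists_coprime_modEq {d m k : ℕ} (hm : m ≠ 0) (hd : d ∣ m) (hk : k.Coprime d) :
    ∃ e : ℕ, e.Coprime m ∧ e ≡ k [MOD d] := by
  have : NeZero m := ⟨hm⟩
  obtain ⟨v, hv⟩ := ZMod.unitsMap_surjective hd (ZMod.unitOfCoprime k hk)
  refine ⟨(v : ZMod m).val, ZMod.val_coe_unit_coprime v, ?_⟩
  rw [← ZMod.natCast_eq_natCast_iff, ← ZMod.coe_unitOfCoprime k hk, ← hv, ZMod.unitsMap_val,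
    ZMod.natCast_val]

theorem exists_coprime_mul_modEq {m k : ℕ} (hm : m ≠ 0) :
    ∃ e : ℕ, e.Coprime m ∧ k ≡ Nat.gcd m k * e [MOD m] := by
  have hg : Nat.gcd m k ≠ 0 := fun h => hm (Nat.gcd_eq_zero_iff.mp h).1
  obtain ⟨e, he, hek⟩ := exists_coprime_modEq (d := m / Nat.gcd m k) (k := k / Nat.gcd m k) hm
    (Nat.div_dvd_of_dvd (Nat.gcd_dvd_left m k))
    (Nat.coprime_div_gcd_div_gcd (Nat.pos_of_ne_zero hg)).symm
  refine ⟨e, he, ?_⟩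
  have h := (hek.mul_left' (Nat.gcd m k)).symm
  rwa [Nat.mul_div_cancel' (Nat.gcd_dvd_right m k), Nat.mul_div_cancel' (Nat.gcd_dvd_left m k)] at h

theorem zpowers_pow_eq {G : Type*} [Group G] {a : G} {e : ℕ} (he : e.Coprime (orderOf a)) :
    Subgroup.zpowers (a ^ e) = Subgroup.zpowers a := by
  refine le_antisymm (Subgroup.zpowers_le.mpr (Subgroup.npow_mem_zpowers a e)) ?_
  obtain ⟨c, hc⟩ := exists_pow_eq_self_of_coprime (n := e) (x := a) he
  have h1 := Subgroup.npow_mem_zpowers (a ^ e) c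
  rw [hc] at h1
  exact Subgroup.zpowers_le.mpr h1

section

variable {G : Type*} [Group G] {a b : G} {t : ℕ}

theorem pow_mul_pow_of_conj (h : b * a * b⁻¹ = a ^ t) (i j : ℕ) :
    b ^ j * a ^ i = a ^ (i * t ^ j) * b ^ j := by
  induction j with
  | zero => simp
  | succ j ih =>
    have h1 : ∀ k : ℕ, b * a ^ k = a ^ (k * t) * b := fun k => by
      rw [mul_comm k, pow_mul, ← h, conj_pow, inv_mul_cancel_right]
    rw [pow_succ', mul_assoc, ih, ← mul_assoc, h1, pow_succ, mul_assoc, mul_assoc]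

/-- Powers of a product `a ^ z * b ^ w`, by means of a geometric sum. -/
theorem mul_pow_of_conj (h : b * a * b⁻¹ = a ^ t) (z w k : ℕ) :
    (a ^ z * b ^ w) ^ k = a ^ (z * ∑ i ∈ Finset.range k, (t ^ w) ^ i) * b ^ (w * k) := by
  induction k with
  | zero => simp
  | succ k ih =>
    rw [pow_succ', ih, geom_sum_succ, mul_assoc, ← mul_assoc (b ^ w), pow_mul_pow_of_conj h,
      mul_assoc, ← pow_add, ← mul_assoc, ← pow_add]
    congr 2 <;> ring

variable [Finite G]

theorem normal_of_conj (h : b * a * b⁻¹ ∈ Subgroup.zpowers a)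
    (hsup : Subgroup.zpowers a ⊔ Subgroup.zpowers b = ⊤) : (Subgroup.zpowers a).Normal := by
  rw [← Subgroup.normalizer_eq_top_iff, eq_top_iff, ← hsup, sup_le_iff]
  refine ⟨Subgroup.le_normalizer, ?_⟩
  rw [Subgroup.zpowers_le]
  refine Subgroup.mem_normalizer_fintype ?_
  rintro _ ⟨k, rfl⟩
  have : b * a ^ k * b⁻¹ = (b * a * b⁻¹) ^ k := (conj_zpow).symm
  simp only [SetLike.mem_coe]
  rw [this]
  exact Subgroup.zpow_mem _ h k

theorem exists_mul_eq_of_sup_eq_top [(Subgroup.zpowers a).Normal]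
    (hsup : Subgroup.zpowers a ⊔ Subgroup.zpowers b = ⊤) (g : G) :
    ∃ i j : ℕ, g = a ^ i * b ^ j := by
  have hg : g ∈ Subgroup.zpowers a ⊔ Subgroup.zpowers b := hsup ▸ Subgroup.mem_top g
  obtain ⟨x, hx, y, hy, rfl⟩ := Subgroup.mem_sup_of_normal_left.mp hg
  rw [← mem_powers_iff_mem_zpowers] at hx hy
  obtain ⟨i, rfl⟩ := hx
  obtain ⟨j, rfl⟩ := hy
  exact ⟨i, j, rfl⟩

theorem zpow_mem_zpowers_iff [(Subgroup.zpowers a).Normal]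
    (hsup : Subgroup.zpowers a ⊔ Subgroup.zpowers b = ⊤) (j : ℤ) :
    b ^ j ∈ Subgroup.zpowers a ↔ ((Subgroup.zpowers a).index : ℤ) ∣ j := by
  rw [← QuotientGroup.eq_one_iff, QuotientGroup.mk_zpow, ← orderOf_dvd_iff_zpow_eq_one,
    Subgroup.index, ← orderOf_eq_card_of_forall_mem_zpowers]
  intro x
  obtain ⟨g, rfl⟩ := QuotientGroup.mk_surjective x
  obtain ⟨i, j, rfl⟩ := exists_mul_eq_of_sup_eq_top hsup g
  have : ((a : G) : G ⧸ Subgroup.zpowers a) = 1 :=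
    (QuotientGroup.eq_one_iff a).mpr (Subgroup.mem_zpowers a)
  rw [QuotientGroup.mk_mul, QuotientGroup.mk_pow, QuotientGroup.mk_pow, this, one_pow, one_mul]
  exact Subgroup.npow_mem_zpowers _ _

theorem pow_mem_zpowers_iff [(Subgroup.zpowers a).Normal]
    (hsup : Subgroup.zpowers a ⊔ Subgroup.zpowers b = ⊤) (j : ℕ) :
    b ^ j ∈ Subgroup.zpowers a ↔ (Subgroup.zpowers a).index ∣ j := by
  rw [← zpow_natCast, zpow_mem_zpowers_iff hsup, Int.natCast_dvd_natCast]

end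

/-- Generators `a`, `b` of the two factors of a metacyclic factorization of `G` with parameters
`m = |⟨a⟩|`, `n = [G : ⟨a⟩]`, `s = [G : ⟨b⟩]`, where `b` acts on `⟨a⟩` as raising to the power `t`,
and normalized by `b ^ n = a ^ s`. -/
structure GenPair (G : Type*) [Group G] (a b : G) (m n s t : ℕ) : Prop where
  orderOf_left : orderOf a = m
  conj : b * a * b⁻¹ = a ^ t
  sup_eq : Subgroup.zpowers a ⊔ Subgroup.zpowers b = ⊤
  index_left : (Subgroup.zpowers a).index = n
  index_right : (Subgroup.zpowers b).index = s
  pow_eq : b ^ n = a ^ s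

/-- Every pair of generators of the factors of a metacyclic factorization is normalized by
replacing `a` by a suitable power. -/
theorem exists_genPair {G : Type*} [Group G] [Finite G] {a b : G} {t : ℕ}
    (h : b * a * b⁻¹ = a ^ t) (hsup : Subgroup.zpowers a ⊔ Subgroup.zpowers b = ⊤) :
    ∃ e : ℕ, Subgroup.zpowers (a ^ e) = Subgroup.zpowers a ∧
      GenPair G (a ^ e) b (orderOf a) (Subgroup.zpowers a).index (Subgroup.zpowers b).index t := by
  have : (Subgroup.zpowers a).Normal :=
    normal_of_conj (by rw [h]; exact Subgroup.npow_mem_zpowers a t) hsup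
  set n := (Subgroup.zpowers a).index with hn
  have hn0 : n ≠ 0 := Subgroup.index_ne_zero_of_finite
  have hbn : b ^ n ∈ Subgroup.zpowers a := (pow_mem_zpowers_iff hsup n).mpr dvd_rfl
  rw [← mem_powers_iff_mem_zpowers] at hbn
  obtain ⟨k, hk⟩ := hbn
  change a ^ k = b ^ n at hk
  have hm : orderOf a ≠ 0 := (orderOf_pos a).ne'
  obtain ⟨e, he, hek⟩ := exists_coprime_mul_modEq (k := k) hm
  have hz := zpowers_pow_eq he
  have hs : (Subgroup.zpowers b).index = Nat.gcd (orderOf a) k := by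
    have h1 : n ∣ orderOf b := by
      rw [hn, ← pow_mem_zpowers_iff hsup (orderOf b), pow_orderOf_eq_one]
      exact Subgroup.one_mem _
    have h2 := orderOf_pow_of_dvd hn0 h1
    rw [← hk, orderOf_pow] at h2
    have h3 := Subgroup.card_mul_index (Subgroup.zpowers a)
    have h4 := Subgroup.card_mul_index (Subgroup.zpowers b)
    rw [Nat.card_zpowers] at h3 h4
    rw [← hn] at h3
    have hg := Nat.gcd_dvd_left (orderOf a) k
    have h5 : orderOf b = n * (orderOf a / Nat.gcd (orderOf a) k) := by
      rw [h2, Nat.mul_div_cancel' h1]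
    have h6 : orderOf a = orderOf a / Nat.gcd (orderOf a) k * Nat.gcd (orderOf a) k :=
      (Nat.div_mul_cancel hg).symm
    have h7 : 0 < orderOf a / Nat.gcd (orderOf a) k :=
      Nat.div_pos (Nat.le_of_dvd (orderOf_pos a) hg) (Nat.gcd_pos_of_pos_left _ (orderOf_pos a))
    rw [← h3, h5] at h4
    generalize orderOf a / Nat.gcd (orderOf a) k = q at *
    rw [h6] at h4
    have : (n * q) * (Subgroup.zpowers b).index = (n * q) * Nat.gcd (orderOf a) k := by
      rw [h4]; ring
    exact Nat.eq_of_mul_eq_mul_left (Nat.mul_pos (Nat.pos_of_ne_zero hn0) h7) this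
  refine ⟨e, hz, Nat.Coprime.orderOf_pow he.symm, ?_, by rw [hz, hsup], by rw [hz], rfl, ?_⟩
  · rw [← conj_pow, h, ← pow_mul, ← pow_mul, mul_comm]
  · rw [hs, ← pow_mul, ← hk, pow_eq_pow_iff_modEq, mul_comm]
    exact hek

namespace GenPair

variable {G : Type*} [Group G] {a b : G} {m n s t : ℕ}

theorem card_eq (h : GenPair G a b m n s t) : Nat.card G = m * n := by
  rw [← Subgroup.card_mul_index (Subgroup.zpowers a), Nat.card_zpowers, h.orderOf_left,
    h.index_left]

theorem orderOf_right_mul (h : GenPair G a b m n s t) : orderOf b * s = m * n := by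
  rw [← h.card_eq, ← Subgroup.card_mul_index (Subgroup.zpowers b), Nat.card_zpowers,
    h.index_right]

theorem pow_modEq_one (h : GenPair G a b m n s t) : t ^ n ≡ 1 [MOD m] := by
  have h1 := pow_mul_pow_of_conj h.conj 1 n
  rw [h.pow_eq, ← pow_add, ← pow_add, pow_eq_pow_iff_modEq, h.orderOf_left, one_mul, add_comm] at h1
  exact (Nat.ModEq.add_right_cancel' s h1).symm

theorem mul_modEq (h : GenPair G a b m n s t) : s * t ≡ s [MOD m] := by
  have h1 := pow_mul_pow_of_conj h.conj s 1
  rw [← h.pow_eq, ← pow_add, add_comm, pow_add, h.pow_eq, pow_one, pow_one] at h1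
  rw [← h.orderOf_left, ← pow_eq_pow_iff_modEq]
  exact (mul_right_cancel h1).symm

theorem congr (h : GenPair G a b m n s t) {t' : ℕ} (ht : t ≡ t' [MOD m]) :
    GenPair G a b m n s t' where
  __ := h
  conj := by
    rw [h.conj, pow_eq_pow_iff_modEq, h.orderOf_left]
    exact ht

variable [Finite G]

theorem normal (h : GenPair G a b m n s t) : (Subgroup.zpowers a).Normal :=
  normal_of_conj (h.conj ▸ Subgroup.npow_mem_zpowers a t) h.sup_eq

theorem exists_eq (h : GenPair G a b m n s t) (g : G) : ∃ i j : ℕ, g = a ^ i * b ^ j :=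
  have := h.normal
  exists_mul_eq_of_sup_eq_top h.sup_eq g

theorem left_ne_zero (h : GenPair G a b m n s t) : m ≠ 0 := h.orderOf_left ▸ (orderOf_pos a).ne'

theorem index_ne_zero (h : GenPair G a b m n s t) : n ≠ 0 :=
  h.index_left ▸ Subgroup.index_ne_zero_of_finite

theorem pow_mem_iff (h : GenPair G a b m n s t) (j : ℕ) :
    b ^ j ∈ Subgroup.zpowers a ↔ n ∣ j := by
  have := h.normal
  rw [pow_mem_zpowers_iff h.sup_eq, h.index_left]

theorem dvd_of_pow_mul_pow_eq (h : GenPair G a b m n s t) {i j k l : ℕ}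
    (hij : a ^ i * b ^ j = a ^ k * b ^ l) : (n : ℤ) ∣ (j : ℤ) - l := by
  have := h.normal
  rw [← h.index_left, ← zpow_mem_zpowers_iff h.sup_eq, zpow_sub, zpow_natCast, zpow_natCast]
  have h1 : b ^ j * (b ^ l)⁻¹ = (a ^ i)⁻¹ * a ^ k := by
    rw [eq_inv_mul_iff_mul_eq, ← mul_assoc, hij, mul_inv_cancel_right]
  rw [h1]
  exact Subgroup.mul_mem _ (Subgroup.inv_mem _ (Subgroup.npow_mem_zpowers _ _))
    (Subgroup.npow_mem_zpowers _ _)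

/-- When two products `a ^ i * b ^ j` are equal, in terms of the parameters only. -/
theorem pow_mul_pow_eq_iff (h : GenPair G a b m n s t) {i j k l : ℕ} :
    a ^ i * b ^ j = a ^ k * b ^ l ↔
      ∃ c : ℤ, (j : ℤ) - l = n * c ∧ (m : ℤ) ∣ (i : ℤ) - k + s * c := by
  have key : ∀ c : ℤ, (j : ℤ) - l = n * c →
      (a ^ i * b ^ j = a ^ k * b ^ l ↔ (m : ℤ) ∣ (i : ℤ) - k + s * c) := by
    intro c hc
    have h1 : (b ^ (n * c) : G) = a ^ (s * c) := by
      rw [zpow_mul, zpow_mul, zpow_natCast, zpow_natCast, h.pow_eq]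
    have h2 : a ^ i * b ^ j = a ^ k * b ^ l ↔ (a ^ ((i : ℤ) - k + s * c) : G) = 1 := by
      rw [zpow_add, ← h1, ← hc, zpow_sub, zpow_sub]
      simp only [zpow_natCast]
      have hc' : (a ^ k)⁻¹ * a ^ i = a ^ i * (a ^ k)⁻¹ := by
        rw [← zpow_natCast, ← zpow_natCast, ← zpow_neg, ← zpow_add, ← zpow_add, add_comm]
      rw [← hc', ← mul_assoc, mul_inv_eq_one, mul_assoc, inv_mul_eq_iff_eq_mul]
    rw [h2, ← orderOf_dvd_iff_zpow_eq_one, h.orderOf_left]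
  constructor
  · intro hij
    obtain ⟨c, hc⟩ := h.dvd_of_pow_mul_pow_eq hij
    exact ⟨c, hc, (key c hc).mp hij⟩
  · rintro ⟨c, hc, hm⟩
    exact (key c hc).mpr hm

theorem coprime (h : GenPair G a b m n s t) : t.Coprime m := by
  have h1 : orderOf (a ^ t) = m := by
    rw [← h.conj, ← h.orderOf_left]
    exact orderOf_injective (MulAut.conj b).toMonoidHom (MulAut.conj b).injective a
  rw [orderOf_pow, h.orderOf_left] at h1
  have h2 := Nat.div_mul_cancel (Nat.gcd_dvd_left m t)
  rw [h1] at h2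
  have := Nat.pos_of_ne_zero h.left_ne_zero
  rw [Nat.Coprime, Nat.gcd_comm]
  nlinarith

theorem right_ne_zero (h : GenPair G a b m n s t) : s ≠ 0 :=
  h.index_right ▸ Subgroup.index_ne_zero_of_finite

theorem index_dvd_orderOf (h : GenPair G a b m n s t) : n ∣ orderOf b := by
  rw [← h.pow_mem_iff, pow_orderOf_eq_one]
  exact Subgroup.one_mem _

theorem right_dvd_left (h : GenPair G a b m n s t) : s ∣ m := by
  obtain ⟨c, hc⟩ := h.index_dvd_orderOf
  have h1 := h.orderOf_right_mul
  rw [hc, mul_assoc, mul_comm m] at h1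
  exact ⟨c, by rw [← Nat.eq_of_mul_eq_mul_left (Nat.pos_of_ne_zero h.index_ne_zero) h1, mul_comm]⟩

/-- The parameters determine the group. -/
theorem nonempty_mulEquiv (h : GenPair G a b m n s t) {H : Type*} [Group H] [Finite H] {a' b' : H}
    (h' : GenPair H a' b' m n s t) : Nonempty (G ≃* H) := by
  choose i j hij using h.exists_eq
  have key : ∀ g k l, g = a ^ k * b ^ l → a' ^ i g * b' ^ j g = a' ^ k * b' ^ l := by
    intro g k l hg
    rw [h'.pow_mul_pow_eq_iff, ← h.pow_mul_pow_eq_iff, ← hij, hg]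
  let f : G →* H := MonoidHom.mk' (fun g => a' ^ i g * b' ^ j g) fun g g' => by
    rw [key (g * g') (i g + i g' * t ^ j g) (j g + j g')]
    · rw [pow_add, pow_add, mul_assoc, ← mul_assoc (a' ^ (i g' * t ^ j g)),
        ← pow_mul_pow_of_conj h'.conj, mul_assoc, mul_assoc]
    · conv_lhs => rw [hij g, hij g']
      rw [pow_add, pow_add, mul_assoc, ← mul_assoc (b ^ j g), pow_mul_pow_of_conj h.conj, mul_assoc,
        mul_assoc]
  have hf : Function.Injective f := by
    intro g g' hgg
    change a' ^ i g * b' ^ j g = a' ^ i g' * b' ^ j g' at hgg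
    rw [h'.pow_mul_pow_eq_iff, ← h.pow_mul_pow_eq_iff, ← hij, ← hij] at hgg
    exact hgg
  exact ⟨MulEquiv.ofBijective f ((Nat.bijective_iff_injective_and_card f).mpr
    ⟨hf, by rw [h.card_eq, h'.card_eq]⟩)⟩

end GenPair

/-! ### Factorizations and their generators -/

theorem zpow_cast_eq_pow_iff {G : Type*} [Group G] {a : G} (v : ZMod (orderOf a)) (k : ℕ) :
    a ^ (v.cast : ℤ) = a ^ k ↔ v = k := by
  rw [← zpow_natCast a k, zpow_eq_zpow_iff_modEq, ← ZMod.intCast_eq_intCast_iff]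
  simp

/-- The subgroup `T_G(A)` is generated by the class of the exponent by which a generator of the
other factor acts on `A`. -/
theorem GenPair.actionSubgroup_eq {G : Type*} [Group G] [Finite G] {a b : G} {m n s t : ℕ}
    (h : GenPair G a b m n s t) {u : (ZMod (Nat.card (Subgroup.zpowers a)))ˣ}
    (hu : (u : ZMod (Nat.card (Subgroup.zpowers a))) = t) :
    actionSubgroup (Subgroup.zpowers a) = Subgroup.zpowers u := by
  have : NeZero (Nat.card (Subgroup.zpowers a)) := ⟨Nat.card_pos.ne'⟩
  have hcast : ∀ (v : ZMod (Nat.card (Subgroup.zpowers a))) (k : ℕ),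
      a ^ (v.cast : ℤ) = a ^ k ↔ v = k := by
    rw [Nat.card_zpowers]
    exact zpow_cast_eq_pow_iff
  have hconj : ∀ i j : ℕ, (a ^ i * b ^ j) * a * (a ^ i * b ^ j)⁻¹ = a ^ t ^ j := by
    intro i j
    have h1 := pow_mul_pow_of_conj h.conj 1 j
    rw [pow_one, one_mul] at h1
    rw [mul_inv_eq_iff_eq_mul, mul_assoc, h1, ← mul_assoc, ← mul_assoc, ← pow_add, ← pow_add,
      add_comm]
  ext v
  constructor
  · rintro ⟨g, hg⟩
    obtain ⟨i, j, rfl⟩ := h.exists_eq g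
    have h1 := hg a (Subgroup.mem_zpowers a)
    rw [hconj, eq_comm, hcast] at h1
    refine Subgroup.mem_zpowers_iff.mpr ⟨j, ?_⟩
    rw [zpow_natCast, ← Units.val_inj, h1, Units.val_pow_eq_pow_val, hu, Nat.cast_pow]
  · intro hv
    rw [← mem_powers_iff_mem_zpowers] at hv
    obtain ⟨j, rfl⟩ := hv
    refine ⟨b ^ j, fun x hx => ?_⟩
    obtain ⟨k, rfl⟩ := hx
    have h1 := hconj 0 j
    rw [pow_zero, one_mul] at h1
    change b ^ j * a ^ k * (b ^ j)⁻¹ = (a ^ k) ^ _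
    have h2 : a ^ (((u ^ j : (ZMod (Nat.card (Subgroup.zpowers a)))ˣ) :
        ZMod (Nat.card (Subgroup.zpowers a))).cast : ℤ) = a ^ t ^ j := by
      rw [hcast, Units.val_pow_eq_pow_val, hu, Nat.cast_pow]
    rw [← conj_zpow, h1, ← h2, ← zpow_mul, ← zpow_mul, mul_comm]

namespace Factorization

variable {G : Type*} [Group G]

theorem exists_genPair [Finite G] (F : Factorization G) : ∃ (a b : G) (t : ℕ),
    Subgroup.zpowers a = F.A ∧ Subgroup.zpowers b = F.B ∧
      GenPair G a b (Nat.card F.A) F.A.index F.B.index t := by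
  obtain ⟨a, ha⟩ := (Subgroup.isCyclic_iff_exists_zpowers_eq_top F.A).mp F.isCyclic_left
  obtain ⟨b, hb⟩ := (Subgroup.isCyclic_iff_exists_zpowers_eq_top F.B).mp F.isCyclic_right
  have hconj : b * a * b⁻¹ ∈ Subgroup.zpowers a := by
    have := F.normal.conj_mem a (ha ▸ Subgroup.mem_zpowers a) b
    rwa [← ha] at this
  rw [← mem_powers_iff_mem_zpowers] at hconj
  obtain ⟨t, ht⟩ := hconj
  have hsup : Subgroup.zpowers a ⊔ Subgroup.zpowers b = ⊤ := by
    rw [eq_top_iff, ha, hb]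
    intro g _
    obtain ⟨x, hx, y, hy, rfl⟩ := F.exists_mul_eq g
    exact Subgroup.mul_mem_sup hx hy
  obtain ⟨e, he, h⟩ := Metacyclic.exists_genPair ht.symm hsup
  refine ⟨a ^ e, b, t, he.trans ha, hb, ?_⟩
  rw [← ha, ← hb, Nat.card_zpowers]
  exact h

end Factorization

section

variable {G : Type*} [Group G] {a b : G} {m n s t : ℕ}

theorem GenPair.card_left (h : GenPair G a b m n s t) : Nat.card (Subgroup.zpowers a) = m := by
  rw [Nat.card_zpowers, h.orderOf_left]

variable [Finite G]

/-- The metacyclic factorization `G = ⟨a⟩⟨b⟩`. -/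
def GenPair.factorization (h : GenPair G a b m n s t) : Factorization G where
  A := Subgroup.zpowers a
  B := Subgroup.zpowers b
  normal := h.normal
  isCyclic_left := inferInstance
  isCyclic_right := inferInstance
  exists_mul_eq g := by
    obtain ⟨i, j, rfl⟩ := h.exists_eq g
    exact ⟨a ^ i, Subgroup.npow_mem_zpowers a i, b ^ j, Subgroup.npow_mem_zpowers b j, rfl⟩

theorem GenPair.weight_eq (h : GenPair G a b m n s t) {u : (ZMod m)ˣ} (hu : (u : ZMod m) = t)
    {F : Factorization G} (hA : F.A = Subgroup.zpowers a) (hB : F.B = Subgroup.zpowers b) :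
    F.weight = toLex (m, toLex (rInv (Subgroup.zpowers u), s)) := by
  obtain ⟨A, B, h1, h2, h3, h4⟩ := F
  simp only at hA hB
  subst hA hB
  have hm := h.card_left
  subst hm
  rw [Factorization.weight, h.actionSubgroup_eq hu, h.index_right]

theorem GenPair.invariant_eq (h : GenPair G a b m n s t) {u : (ZMod m)ˣ} (hu : (u : ZMod m) = t)
    {F : Factorization G} (hA : F.A = Subgroup.zpowers a) (hB : F.B = Subgroup.zpowers b) :
    F.invariant = (m, n, s, ⟨modulus (Subgroup.zpowers u) n s,
      res (modulus (Subgroup.zpowers u) n s) (Subgroup.zpowers u)⟩) := by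
  obtain ⟨A, B, h1, h2, h3, h4⟩ := F
  simp only at hA hB
  subst hA hB
  have hm := h.card_left
  subst hm
  rw [Factorization.invariant, h.actionSubgroup_eq hu, h.index_right, h.index_left]

theorem GenPair.exists_unit (h : GenPair G a b m n s t) : ∃ u : (ZMod m)ˣ, (u : ZMod m) = t :=
  ⟨ZMod.unitOfCoprime t h.coprime, ZMod.coe_unitOfCoprime t h.coprime⟩

end

/-! ### Powers modulo prime powers -/

theorem geom_sum_sub_dvd {d q : ℤ} (h : d ∣ q - 1) (k : ℕ) :
    d ∣ ∑ i ∈ Finset.range k, q ^ i - k := by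
  have : ∑ i ∈ Finset.range k, q ^ i - k = ∑ i ∈ Finset.range k, (q ^ i - 1) := by simp
  rw [this]
  refine Finset.dvd_sum fun i _ => h.trans ?_
  simpa using sub_dvd_pow_sub_pow q 1 i

theorem pow_sub_one_dvd {d q : ℤ} (h : d ∣ q - 1) (k : ℕ) : d ∣ q ^ k - 1 :=
  h.trans (by simpa using sub_dvd_pow_sub_pow q 1 k)

/-- The order of `q ^ w - 1` at a prime `p`, when `q` is close enough to `1`. -/
theorem pow_dvd_pow_sub_one_iff {p : ℕ} (hp : p.Prime) {q : ℤ} {ρ : ℕ} (hρ : 1 ≤ ρ)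
    (hρ2 : p = 2 → 2 ≤ ρ) (hq : (p : ℤ) ^ ρ ∣ q - 1) (hq' : ¬ (p : ℤ) ^ (ρ + 1) ∣ q - 1) (k w : ℕ) :
    (p : ℤ) ^ (ρ + k) ∣ q ^ w - 1 ↔ p ^ k ∣ w := by
  have hpq : (p : ℤ) ∣ q - 1 := (dvd_pow_self _ (by omega)).trans hq
  have hpq' : ¬ (p : ℤ) ∣ q := by
    intro h
    have h1 := dvd_sub h hpq
    rw [sub_sub_cancel] at h1
    exact (Nat.prime_iff_prime_int.mp hp).not_isUnit (isUnit_of_dvd_one h1)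
  have h1 : emultiplicity (p : ℤ) (q - 1) = ρ := emultiplicity_eq_coe.mpr ⟨hq, hq'⟩
  have h2 : emultiplicity (p : ℤ) (q ^ w - 1) = ρ + emultiplicity (p : ℤ) (w : ℤ) := by
    rcases hp.eq_two_or_odd' with rfl | hodd
    · have h4 : (4 : ℤ) ∣ q - 1 := by
        have := (pow_dvd_pow (2 : ℤ) (hρ2 rfl)).trans hq
        norm_num at this
        exact this
      have := Int.two_pow_sub_pow' w h4 (by exact_mod_cast hpq')
      rw [one_pow] at this
      push_cast at h1 ⊢
      rw [this, h1]
    · have := Int.emultiplicity_pow_sub_pow hp hodd hpq hpq' w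
      rw [one_pow, h1] at this
      rw [this, Int.natCast_emultiplicity]
  rw [pow_dvd_iff_le_emultiplicity, h2, Nat.cast_add,
    ENat.add_le_add_iff_left (ENat.natCast_ne_top ρ), ← pow_dvd_iff_le_emultiplicity]
  exact_mod_cast Iff.rfl

theorem pow_dvd_pow_sub_one {p : ℕ} {q : ℤ} {ρ k w : ℕ} (hρ : 1 ≤ ρ)
    (hq : (p : ℤ) ^ ρ ∣ q - 1) (hk : p ^ k ∣ w) : (p : ℤ) ^ (ρ + k) ∣ q ^ w - 1 := by
  obtain ⟨c, rfl⟩ := hk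
  rw [pow_mul]
  refine pow_sub_one_dvd ?_ c
  clear c
  induction k with
  | zero => simpa using hq
  | succ k ih =>
    have h1 : q ^ p ^ (k + 1) - 1 =
        (q ^ p ^ k - 1) * ∑ i ∈ Finset.range p, (q ^ p ^ k) ^ i := by
      rw [mul_geom_sum, ← pow_mul, pow_succ]
    rw [h1, ← add_assoc, pow_succ]
    refine mul_dvd_mul ih ?_
    have hpq : (p : ℤ) ∣ q ^ p ^ k - 1 := (dvd_pow_self _ (by omega)).trans ih
    simpa using dvd_add (geom_sum_sub_dvd hpq p) (dvd_refl (p : ℤ))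

theorem geom_sum_mul_index (q : ℤ) (k l : ℕ) : ∑ i ∈ Finset.range (k * l), q ^ i =
    (∑ i ∈ Finset.range k, q ^ i) * ∑ i ∈ Finset.range l, (q ^ k) ^ i := by
  induction l with
  | zero => simp
  | succ l ih =>
    rw [Nat.mul_succ, Finset.sum_range_add (fun i => q ^ i), ih,
      Finset.sum_range_succ (fun i => (q ^ k) ^ i), mul_add]
    congr 1
    rw [Finset.sum_mul]
    refine Finset.sum_congr rfl fun i _ => ?_
    rw [pow_add, pow_mul, mul_comm]

theorem pow_dvd_geom_sum {p : ℕ} {q : ℤ} (hpq : (p : ℤ) ∣ q - 1) {k w : ℕ} (hk : p ^ k ∣ w) :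
    (p : ℤ) ^ k ∣ ∑ i ∈ Finset.range w, q ^ i := by
  obtain ⟨c, rfl⟩ := hk
  induction k generalizing q with
  | zero => simp
  | succ k ih =>
    have h1 : ∑ i ∈ Finset.range (p ^ (k + 1) * c), q ^ i =
        (∑ i ∈ Finset.range p, q ^ i) * ∑ i ∈ Finset.range (p ^ k * c), (q ^ p) ^ i := by
      rw [pow_succ', mul_assoc, geom_sum_mul_index]
    rw [h1, pow_succ']
    refine mul_dvd_mul ?_ (ih (pow_sub_one_dvd hpq p))
    simpa using dvd_add (geom_sum_sub_dvd hpq p) (dvd_refl (p : ℤ))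

/-- A geometric sum of ratio `1 + 2 ^ k` modulo `2 ^ (k + 1)`. -/
theorem two_pow_dvd_geom_sum {q : ℤ} {k l : ℕ} (hk : 1 ≤ k) (hq : (2 : ℤ) ^ (k + 1) ∣ q - 1 - 2 ^ k)
    (hl : l % 4 = 2 ∨ l % 4 = 3) :
    (2 : ℤ) ^ (k + 1) ∣ ∑ i ∈ Finset.range l, q ^ i - l - 2 ^ k := by
  have h1 : ∀ i : ℕ, (2 : ℤ) ^ (k + 1) ∣ q ^ i - 1 - i * 2 ^ k := by
    intro i
    induction i with
    | zero => simp
    | succ i ih =>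
      have h2 : (2 : ℤ) ^ (k + 1) ∣ 2 ^ k * 2 ^ k := by
        rw [← pow_add]; exact pow_dvd_pow _ (by omega)
      have h3 := dvd_add (dvd_add (ih.mul_left q) (hq.mul_left (1 + i * 2 ^ k)))
        (h2.mul_left (i : ℤ))
      obtain ⟨c, hc⟩ := h3
      exact ⟨c, by push_cast; linear_combination hc⟩
  have h2 := Finset.dvd_sum fun i (_ : i ∈ Finset.range l) => h1 i
  rw [Finset.sum_sub_distrib, Finset.sum_sub_distrib, ← Finset.sum_mul] at h2
  have h3 : ∃ c : ℤ, ∑ i ∈ Finset.range l, (i : ℤ) = 2 * c + 1 := by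
    have h4 := Finset.sum_range_id_mul_two l
    have h5 : (∑ i ∈ Finset.range l, i) % 2 = 1 := by
      obtain ⟨d, rfl | rfl⟩ : ∃ d, l = 4 * d + 2 ∨ l = 4 * d + 3 := ⟨l / 4, by omega⟩
      · have : (4 * d + 2) * (4 * d + 2 - 1) = (8 * (d * d) + 6 * d + 1) * 2 := by
          rw [show 4 * d + 2 - 1 = 4 * d + 1 by omega]; ring
        rw [this] at h4
        omega
      · have : (4 * d + 3) * (4 * d + 3 - 1) = (8 * (d * d) + 10 * d + 3) * 2 := by
          rw [show 4 * d + 3 - 1 = 4 * d + 2 by omega]; ring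
        rw [this] at h4
        omega
    refine ⟨((∑ i ∈ Finset.range l, i) / 2 : ℕ), ?_⟩
    rw [← Nat.cast_sum]
    omega
  obtain ⟨c, hc⟩ := h3
  rw [hc] at h2
  obtain ⟨e, he⟩ := h2
  refine ⟨e + c, ?_⟩
  simp only [Finset.sum_const, Finset.card_range, nsmul_eq_mul, mul_one] at he
  linear_combination he

/-! ### Comparing the actions in two factorizations, one prime at a time -/

/-- If `n * c = z` and `p ^ k ∣ z`, then `c` is divisible by `p ^ k` up to the `p`-part of `n`. -/
theorem pow_sub_factorization_dvd {p n k : ℕ} (hp : p.Prime) (hn : n ≠ 0) {c z : ℤ}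
    (hc : z = n * c) (hk : (p : ℤ) ^ k ∣ z) : (p : ℤ) ^ (k - n.factorization p) ∣ c := by
  rcases le_total k (n.factorization p) with h | h
  · simp [Nat.sub_eq_zero_of_le h]
  · have hn' : (n : ℤ) = (p : ℤ) ^ n.factorization p * ((n / p ^ n.factorization p : ℕ) : ℤ) := by
      exact_mod_cast (Nat.ordProj_mul_ordCompl_eq_self n p).symm
    have hcop : IsCoprime ((p : ℤ) ^ (k - n.factorization p))
        ((n / p ^ n.factorization p : ℕ) : ℤ) :=
      IsCoprime.pow_left (Nat.isCoprime_iff_coprime.mpr (Nat.coprime_ordCompl hp hn))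
    refine hcop.dvd_of_dvd_mul_left ?_
    have hp0 : ((p : ℤ) ^ n.factorization p) ≠ 0 := pow_ne_zero _ (by exact_mod_cast hp.ne_zero)
    refine (mul_dvd_mul_iff_left hp0).mp ?_
    rw [← pow_add, Nat.add_sub_cancel' h, ← mul_assoc, ← hn', ← hc]
    exact hk

/-- The local comparison at a prime `p` with `ε ^ (p - 1) = 1`. -/
theorem local_comparison_pos {p n s : ℕ} (hp : p.Prime) (hn : n ≠ 0) {ρ ω e : ℕ} {t t₁ w y : ℕ}
    {x z c : ℤ} (hρ : 1 ≤ ρ) (ht : (p : ℤ) ^ ρ ∣ t - 1) (ht₁ : (p : ℤ) ^ ρ ∣ t₁ - 1)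
    (hw : p ^ ω ∣ w) (hz : ρ < e → ¬ (p : ℤ) ∣ z) (hc : (w : ℤ) * (1 - t₁) = n * c)
    (hE : (p : ℤ) ^ e ∣ x * (1 - ((t : ℤ) ^ w) ^ t₁) +
      z * ((t : ℤ) ^ y - ∑ i ∈ Finset.range t₁, ((t : ℤ) ^ w) ^ i) + s * c)
    (he : e ≤ ω + ρ)
    (he' : e ≤ max ρ (max (s.factorization p) (ρ + s.factorization p + ω - n.factorization p))) :
    (p : ℤ) ^ e ∣ t₁ - (t : ℤ) ^ y := by
  rcases le_or_gt e ρ with h | h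
  · have h1 := (pow_dvd_pow (p : ℤ) h).trans ht₁
    have h2 := pow_sub_one_dvd ((pow_dvd_pow (p : ℤ) h).trans ht) y
    simpa using dvd_sub h1 h2
  · have htw : (p : ℤ) ^ e ∣ (t : ℤ) ^ w - 1 :=
      (pow_dvd_pow _ (by omega)).trans (pow_dvd_pow_sub_one hρ ht hw)
    have hs : (p : ℤ) ^ s.factorization p ∣ s := by exact_mod_cast Nat.ordProj_dvd s p
    have hwt : (p : ℤ) ^ (ω + ρ) ∣ (w : ℤ) * (1 - t₁) := by
      rw [pow_add]
      exact mul_dvd_mul (by exact_mod_cast hw) (by rw [← dvd_neg, neg_sub]; exact ht₁)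
    have hc' := pow_sub_factorization_dvd hp hn hc hwt
    have hsc : (p : ℤ) ^ e ∣ s * c := by
      have h1 := mul_dvd_mul hs hc'
      rw [← pow_add] at h1
      rcases le_total e (s.factorization p) with h2 | h2
      · exact ((pow_dvd_pow _ h2).trans hs).mul_right c
      · exact (pow_dvd_pow _ (by omega)).trans h1
    have h1 := geom_sum_sub_dvd htw t₁
    have h2 := pow_sub_one_dvd htw t₁
    have h3 : (p : ℤ) ^ e ∣ z * (t₁ - (t : ℤ) ^ y) := by
      have := dvd_sub (dvd_sub hsc hE) (dvd_add (h2.mul_left x) (h1.mul_left z))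
      exact this.trans (dvd_of_eq (by ring))
    have hcop := (Nat.prime_iff_prime_int.mp hp).coprime_iff_not_dvd.mpr (hz h)
    exact hcop.pow_left.dvd_of_dvd_mul_left h3

theorem neg_pow_sub_one {t : ℤ} {w : ℕ} (hw : Even w) : (-t) ^ w - 1 = t ^ w - 1 := by
  rw [hw.neg_pow]

/-- Powers of an integer close to `-1`, modulo powers of `2`. -/
theorem two_pow_dvd_pow_sub_one {t : ℤ} {ρ k w : ℕ} (hρ : 1 ≤ ρ) (ht : (2 : ℤ) ^ ρ ∣ t + 1)
    (hw : Even w) (hk : 2 ^ k ∣ w) : (2 : ℤ) ^ (ρ + k) ∣ t ^ w - 1 := by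
  rw [← neg_pow_sub_one hw]
  refine pow_dvd_pow_sub_one (p := 2) hρ ?_ hk
  push_cast
  rw [← dvd_neg]
  exact ht.trans (dvd_of_eq (by ring))

theorem two_pow_dvd_pow_sub_one_iff {t : ℤ} {ρ : ℕ} (hρ : 2 ≤ ρ) (ht : (2 : ℤ) ^ ρ ∣ t + 1)
    (ht' : ¬ (2 : ℤ) ^ (ρ + 1) ∣ t + 1) {w : ℕ} (hw : Even w) (k : ℕ) :
    (2 : ℤ) ^ (ρ + k) ∣ t ^ w - 1 ↔ 2 ^ k ∣ w := by
  have e : -t - 1 = -(t + 1) := by ring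
  rw [← neg_pow_sub_one hw]
  refine pow_dvd_pow_sub_one_iff Nat.prime_two (by omega) (fun _ => hρ) ?_ ?_ k w
  · rw [e, dvd_neg]; exact_mod_cast ht
  · rw [e, dvd_neg]; exact_mod_cast ht'

theorem two_pow_dvd_pow_add_one {t : ℤ} {ρ y : ℕ} (ht : (2 : ℤ) ^ ρ ∣ t + 1) (hy : Odd y) :
    (2 : ℤ) ^ ρ ∣ t ^ y + 1 :=
  ht.trans (by simpa using hy.add_dvd_pow_add_pow t 1)

/-- If `2 ^ k` divides exactly `z`, then `z ≡ 2 ^ k` modulo `2 ^ (k + 1)`. -/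
theorem two_pow_dvd_sub {k : ℕ} {z : ℤ} (h : (2 : ℤ) ^ k ∣ z) (h' : ¬ (2 : ℤ) ^ (k + 1) ∣ z) :
    (2 : ℤ) ^ (k + 1) ∣ z - 2 ^ k := by
  obtain ⟨c, rfl⟩ := h
  rw [pow_succ, mul_dvd_mul_iff_left (by positivity)] at h'
  rw [pow_succ, ← mul_sub_one, mul_dvd_mul_iff_left (by positivity)]
  omega

/-- The local comparison at the prime `2` when `ε = -1`. In the case where the `2`-part of `s` is
half that of `m` and `μ = η + ρ`, the coordinate `x` has to be even, which is where the order of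
the generator of the second factor enters. -/
theorem local_comparison_neg {n s : ℕ} (hn : n ≠ 0) {μ ρ ω e : ℕ} {t t₁ w y : ℕ}
    {x z c : ℤ} (hρ : 2 ≤ ρ) (hρμ : ρ ≤ μ) (ht : (2 : ℤ) ^ ρ ∣ t + 1)
    (ht' : ρ < μ → ¬ (2 : ℤ) ^ (ρ + 1) ∣ t + 1)
    (ht₁ : (2 : ℤ) ^ ρ ∣ t₁ + 1) (hs0 : s ≠ 0)
    (hsμ : s.factorization 2 ≤ μ) (hst : (2 : ℤ) ^ μ ∣ s * (t - 1))
    (hn2 : Even n) (htn : (2 : ℤ) ^ μ ∣ (t : ℤ) ^ n - 1)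
    (hw : 2 ^ ω ∣ w) (hy : Odd y) (hz : 2 ∣ s → 2 ∣ w → ¬ (2 : ℤ) ∣ z)
    (hc : (w : ℤ) * (1 - t₁) = n * c)
    (hE : (2 : ℤ) ^ μ ∣ x * (1 - ((t : ℤ) ^ w) ^ t₁) +
      z * ((t : ℤ) ^ y - ∑ i ∈ Finset.range t₁, ((t : ℤ) ^ w) ^ i) + s * c)
    (hx : 2 ∣ w → s.factorization 2 + 1 = μ → μ = n.factorization 2 + ρ → ρ < μ → (2 : ℤ) ∣ x)
    (he : e = if ω ≤ 1 ∨ μ ≤ ρ + 1 then ρ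
      else if 2 ≤ ω ∧ ω < n.factorization 2 ∧ ρ + 2 ≤ μ ∧
        (s.factorization 2 ≠ n.factorization 2 + ρ →
          s.factorization 2 + 1 = μ ∧ μ < n.factorization 2 + ρ) then μ - 1
      else μ) :
    (2 : ℤ) ^ e ∣ t₁ - (t : ℤ) ^ y := by
  by_cases h1 : ω ≤ 1 ∨ μ ≤ ρ + 1
  · rw [if_pos h1] at he
    subst he
    have h2 := dvd_sub ht₁ (two_pow_dvd_pow_add_one ht hy)
    simpa using h2
  rw [if_neg h1] at he
  push Not at h1
  obtain ⟨hω, hμρ⟩ := h1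
  have h4 : (4 : ℤ) ∣ t + 1 := (pow_dvd_pow (2 : ℤ) hρ).trans ht
  have h4₁ : (4 : ℤ) ∣ t₁ + 1 := (pow_dvd_pow (2 : ℤ) hρ).trans ht₁
  have hw2 : Even w := even_iff_two_dvd.mpr ((dvd_pow_self 2 (by omega)).trans hw)
  have ht'' := ht' (by omega)
  set η := n.factorization 2 with hη
  set σ := s.factorization 2 with hσ
  have hsσ : (2 : ℤ) ^ σ ∣ s := by exact_mod_cast Nat.ordProj_dvd s 2
  have hsσ' : μ ≤ σ + 1 := by
    by_contra hlt
    have h5 := pow_sub_factorization_dvd Nat.prime_two hs0 (rfl : (s : ℤ) * (t - 1) = s * (t - 1))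
      (by exact_mod_cast hst)
    have h6 := (pow_dvd_pow ((2 : ℕ) : ℤ) (by omega : 2 ≤ μ - σ)).trans h5
    norm_num at h6
    omega
  have hμηρ : μ ≤ ρ + η := by
    by_contra hlt
    have h5 := (two_pow_dvd_pow_sub_one_iff hρ ht ht'' hn2 (η + 1)).mp
      ((pow_dvd_pow _ (by omega)).trans htn)
    rw [Nat.prime_two.pow_dvd_iff_le_factorization hn] at h5
    omega
  have hz2 : ¬ (2 : ℤ) ∣ z := by
    refine hz ?_ (even_iff_two_dvd.mp hw2)
    exact_mod_cast (dvd_pow_self (2 : ℤ) (by omega : σ ≠ 0)).trans hsσ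
  have hcop : ∀ k : ℕ, IsCoprime ((2 : ℤ) ^ k) z := fun k =>
    (Int.prime_two.coprime_iff_not_dvd.mpr hz2).pow_left
  -- As `1 - t₁` is twice an odd number, `w` is divisible by half the `2`-part of `n`.
  obtain ⟨v, hv⟩ : ∃ v : ℤ, (1 : ℤ) - t₁ = 2 * (2 * v + 1) := ⟨(1 - t₁ - 2) / 4, by omega⟩
  have hwc : (w : ℤ) * 2 * (2 * v + 1) = n * c := by rw [← hc, hv]; ring
  have hwη : (2 : ℤ) ^ η ∣ (w : ℤ) * 2 := by
    have h5 : IsCoprime ((2 : ℤ) ^ η) (2 * v + 1) :=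
      (Int.prime_two.coprime_iff_not_dvd.mpr (by omega)).pow_left
    refine h5.dvd_of_dvd_mul_right ?_
    rw [hwc]
    exact Dvd.dvd.mul_right (by exact_mod_cast Nat.ordProj_dvd n 2) c
  have hη1 : 1 ≤ η := (Nat.prime_two.dvd_iff_one_le_factorization hn).mp (even_iff_two_dvd.mp hn2)
  have hwη' : 2 ^ (η - 1) ∣ w := by
    have h5 : (2 : ℤ) ^ (η - 1) * 2 ∣ (w : ℤ) * 2 := by
      rw [← pow_succ, Nat.sub_add_cancel hη1]; exact hwη
    exact_mod_cast (mul_dvd_mul_iff_right (two_ne_zero)).mp h5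
  -- The conclusion when `t ^ w` is trivial modulo `2 ^ e` and the last term vanishes.
  have main : e ≤ μ → (2 : ℤ) ^ e ∣ (t : ℤ) ^ w - 1 → (2 : ℤ) ^ e ∣ s * c →
      (2 : ℤ) ^ e ∣ t₁ - (t : ℤ) ^ y := by
    intro heμ htw hsc
    have h5 := geom_sum_sub_dvd htw t₁
    have h6 := pow_sub_one_dvd htw t₁
    refine (hcop e).dvd_of_dvd_mul_left ?_
    have := dvd_sub (dvd_sub hsc ((pow_dvd_pow _ heμ).trans hE))
      (dvd_add (h6.mul_left x) (h5.mul_left z))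
    exact this.trans (dvd_of_eq (by ring))
  have htwη : ∀ k, 2 ^ k ∣ w → e ≤ ρ + k → (2 : ℤ) ^ e ∣ (t : ℤ) ^ w - 1 := fun k hk hek =>
    (pow_dvd_pow _ hek).trans (two_pow_dvd_pow_sub_one (by omega) ht hw2 hk)
  split_ifs at he with hcase
  · refine main (by omega) (htwη _ hwη' (by omega)) ?_
    exact ((pow_dvd_pow _ (by omega)).trans hsσ).mul_right c
  by_cases hwn : 2 ^ η ∣ w
  · refine main he.le (htwη _ hwn (by omega)) ?_
    have hc2 : (2 : ℤ) ∣ c := by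
      have h5 := pow_sub_factorization_dvd (k := η + 1) Nat.prime_two hn hc (by
        rw [hv, ← mul_assoc]
        refine Dvd.dvd.mul_right ?_ _
        rw [pow_succ]
        exact mul_dvd_mul (by exact_mod_cast hwn) (by norm_num))
      rw [← hη, Nat.add_sub_cancel_left, pow_one] at h5
      exact_mod_cast h5
    have := mul_dvd_mul hsσ hc2
    rw [← pow_succ] at this
    exact (pow_dvd_pow _ (by omega)).trans this
  · have hω' : ω < η := by
      by_contra hlt
      exact hwn ((pow_dvd_pow 2 (by omega)).trans hw)
    by_cases hσμ : σ = μ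
    · refine main he.le (htwη _ hwη' (by omega)) ?_
      exact ((pow_dvd_pow _ (by omega)).trans hsσ).mul_right c
    · have hμ' : μ = η + ρ := by omega
      have hσ' : σ + 1 = μ := by omega
      subst he
      have hx2 := hx (even_iff_two_dvd.mp hw2) hσ' hμ' (by omega)
      -- Here `t ^ w` and `1 + m / 2` agree, and so do `s * c` and `m / 2`, at the prime `2`.
      have h5 : (2 : ℤ) ^ (σ + 1) ∣ (t : ℤ) ^ w - 1 - 2 ^ σ := by
        refine two_pow_dvd_sub ?_ ?_
        · exact (pow_dvd_pow _ (by omega)).trans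
            (two_pow_dvd_pow_sub_one (by omega) ht hw2 hwη')
        · rw [show σ + 1 = ρ + η by omega, two_pow_dvd_pow_sub_one_iff hρ ht ht'' hw2]
          exact hwn
      have h6 := two_pow_dvd_geom_sum (by omega) h5 (l := t₁) (by omega)
      have hsc : (2 : ℤ) ^ (σ + 1) ∣ s * c - 2 ^ σ := by
        refine two_pow_dvd_sub (hsσ.mul_right c) fun h => ?_
        have hs' := pow_sub_factorization_dvd Nat.prime_two hs0 (rfl : (s : ℤ) * c = s * c)
          (by exact_mod_cast h)
        rw [← hσ, Nat.add_sub_cancel_left, pow_one] at hs'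
        have hcd : (2 : ℤ) ^ (η + 1) ∣ n * c := by
          rw [pow_succ]
          exact mul_dvd_mul (by exact_mod_cast Nat.ordProj_dvd n 2) (by exact_mod_cast hs')
        rw [← hwc] at hcd
        have h7 : IsCoprime ((2 : ℤ) ^ (η + 1)) (2 * v + 1) :=
          (Int.prime_two.coprime_iff_not_dvd.mpr (by omega)).pow_left
        have h8 := h7.dvd_of_dvd_mul_right hcd
        rw [pow_succ, mul_dvd_mul_iff_right (two_ne_zero)] at h8
        exact hwn (by exact_mod_cast h8)
      have h7 : (2 : ℤ) ^ (σ + 1) ∣ x * (((t : ℤ) ^ w) ^ t₁ - 1) := by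
        rw [mul_comm, pow_succ]
        refine mul_dvd_mul (pow_sub_one_dvd ?_ t₁) hx2
        have := (pow_dvd_pow (2 : ℤ) (Nat.le_succ σ)).trans h5
        simpa using dvd_add this (dvd_refl ((2 : ℤ) ^ σ))
      rw [← hσ'] at hE ⊢
      refine (hcop _).dvd_of_dvd_mul_left ?_
      -- Since `z` is odd, the two halves cancel.
      obtain ⟨z', hz'⟩ : ∃ z' : ℤ, z = 2 * z' + 1 := ⟨z / 2, by omega⟩
      have h9 : (2 : ℤ) ^ (σ + 1) ∣ (z - 1) * 2 ^ σ := by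
        rw [hz', pow_succ, mul_comm, add_sub_cancel_right]
        exact mul_dvd_mul (dvd_mul_right _ _) dvd_rfl
      have := dvd_sub (dvd_sub (dvd_sub hsc hE) (dvd_add h7 (h6.mul_left z))) h9
      exact this.trans (dvd_of_eq (by ring))

/-! ### Two factorizations of the same group -/

namespace GenPair

variable {G : Type*} [Group G] [Finite G] {a b a₁ b₁ : G} {m n s t t₁ x y z w : ℕ}

/-- The relation between `a₁` and `b₁`, in coordinates with respect to `a` and `b`. -/
theorem relation (h : GenPair G a b m n s t) (hc : b₁ * a₁ * b₁⁻¹ = a₁ ^ t₁)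
    (ha : a₁ = a ^ z * b ^ w) (hb : b₁ = a ^ x * b ^ y) :
    ∃ c : ℤ, (w : ℤ) * (1 - t₁) = n * c ∧ (m : ℤ) ∣ (x : ℤ) * (1 - ((t : ℤ) ^ w) ^ t₁) +
      z * ((t : ℤ) ^ y - ∑ i ∈ Finset.range t₁, ((t : ℤ) ^ w) ^ i) + s * c := by
  rw [mul_inv_eq_iff_eq_mul] at hc
  have h1 : b₁ * a₁ = a ^ (x + z * t ^ y) * b ^ (y + w) := by
    rw [ha, hb, mul_assoc, ← mul_assoc (b ^ y), pow_mul_pow_of_conj h.conj, mul_assoc, ← pow_add,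
      ← mul_assoc, ← pow_add]
  have h2 : a₁ ^ t₁ * b₁ =
      a ^ (z * ∑ i ∈ Finset.range t₁, (t ^ w) ^ i + x * t ^ (w * t₁)) * b ^ (w * t₁ + y) := by
    rw [ha, hb, mul_pow_of_conj h.conj, mul_assoc, ← mul_assoc (b ^ (w * t₁)),
      pow_mul_pow_of_conj h.conj, mul_assoc, ← pow_add, ← mul_assoc, ← pow_add]
  rw [h1, h2, h.pow_mul_pow_eq_iff] at hc
  obtain ⟨c, hc, hm⟩ := hc
  refine ⟨c, ?_, hm.trans (dvd_of_eq ?_)⟩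
  · push_cast at hc
    linear_combination hc
  · push_cast
    rw [pow_mul]
    ring

/-- The commutator of `b₁` and `a₁` lies in the subgroup generated by that of `b` and `a`. -/
theorem zpow_sub_one_mem (h : GenPair G a b m n s t) (hc : b₁ * a₁ * b₁⁻¹ = a₁ ^ t₁) :
    a₁ ^ ((t₁ : ℤ) - 1) ∈ Subgroup.zpowers (a ^ ((t : ℤ) - 1)) := by
  obtain ⟨z, w, ha⟩ := h.exists_eq a₁
  obtain ⟨x, y, hb⟩ := h.exists_eq b₁
  have h1 : b₁ * a₁ = a ^ (x + z * t ^ y) * b ^ (y + w) := by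
    rw [ha, hb, mul_assoc, ← mul_assoc (b ^ y), pow_mul_pow_of_conj h.conj, mul_assoc, ← pow_add,
      ← mul_assoc, ← pow_add]
  have h2 : a₁ * b₁ = a ^ (z + x * t ^ w) * b ^ (y + w) := by
    rw [ha, hb, mul_assoc, ← mul_assoc (b ^ w), pow_mul_pow_of_conj h.conj, mul_assoc, ← pow_add,
      ← mul_assoc, ← pow_add, add_comm w y]
  have h3 : a₁ ^ ((t₁ : ℤ) - 1) = b₁ * a₁ * (a₁ * b₁)⁻¹ := by
    rw [zpow_sub, zpow_natCast, zpow_one, ← hc]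
    group
  obtain ⟨k, hk⟩ : (t : ℤ) - 1 ∣ ((x + z * t ^ y : ℕ) : ℤ) - ((z + x * t ^ w : ℕ) : ℤ) := by
    have h4 := pow_sub_one_dvd (dvd_refl ((t : ℤ) - 1)) y
    have h5 := pow_sub_one_dvd (dvd_refl ((t : ℤ) - 1)) w
    refine (dvd_sub (h4.mul_left (z : ℤ)) (h5.mul_left (x : ℤ))).trans (dvd_of_eq ?_)
    push_cast
    ring
  refine ⟨k, ?_⟩
  change (a ^ ((t : ℤ) - 1)) ^ k = _
  rw [← zpow_mul, ← hk, h3, h1, h2, zpow_sub, zpow_natCast, zpow_natCast]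
  group

/-- The subgroup generated by `a₁ ^ (t₁ - 1)` is contained in that of `a ^ (t - 1)`, so that its
order divides the order of the latter. -/
theorem dvd_sub_one (h : GenPair G a b m n s t) (hc : b₁ * a₁ * b₁⁻¹ = a₁ ^ t₁)
    (ho : orderOf a₁ = m) {d : ℕ} (hd : d ∣ m) (ht : (d : ℤ) ∣ t - 1) : (d : ℤ) ∣ t₁ - 1 := by
  obtain ⟨k, hk⟩ := h.zpow_sub_one_mem hc
  obtain ⟨e, rfl⟩ := hd
  have he : (e : ℤ) ≠ 0 := by
    rintro h0
    exact h.left_ne_zero (by rw [Nat.cast_eq_zero.mp h0, mul_zero])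
  have h1 : a₁ ^ (((t₁ : ℤ) - 1) * e) = 1 := by
    change (a ^ ((t : ℤ) - 1)) ^ k = _ at hk
    rw [zpow_mul, ← hk, ← zpow_mul, ← zpow_mul, ← orderOf_dvd_iff_zpow_eq_one, h.orderOf_left]
    obtain ⟨f, hf⟩ := ht
    exact ⟨f * k, by rw [hf]; push_cast; ring⟩
  rw [← orderOf_dvd_iff_zpow_eq_one, ho, Nat.cast_mul] at h1
  exact (mul_dvd_mul_iff_right he).mp h1

/-- On the part of `⟨a₁⟩` contained in the derived subgroup, `b₁` acts as `b ^ y` and `a₁`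
trivially. -/
theorem dvd_of_isCoprime (h : GenPair G a b m n s t) (hc : b₁ * a₁ * b₁⁻¹ = a₁ ^ t₁)
    (ho : orderOf a₁ = m) (ha : a₁ = a ^ z * b ^ w) (hb : b₁ = a ^ x * b ^ y) {N : ℕ}
    (hN : N ∣ m) (hcop : IsCoprime (N : ℤ) (t₁ - 1)) :
    (N : ℤ) ∣ t₁ - (t : ℤ) ^ y ∧ (N : ℤ) ∣ (t : ℤ) ^ w - 1 := by
  obtain ⟨M, hM⟩ := hN
  obtain ⟨α, β, hαβ⟩ := hcop
  -- `a₁ ^ M` is a power of the commutator `a₁ ^ (t₁ - 1)`, hence of `a`.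
  have h1 : a₁ ^ M ∈ Subgroup.zpowers a := by
    have h2 : a₁ ^ M = (a₁ ^ ((t₁ : ℤ) - 1)) ^ (β * M) := by
      rw [← zpow_natCast, ← zpow_mul, zpow_eq_zpow_iff_modEq, ho, hM]
      refine Int.ModEq.symm (Int.modEq_iff_dvd.mpr ⟨α, ?_⟩)
      push_cast
      linear_combination -(M : ℤ) * hαβ
    rw [h2]
    refine Subgroup.zpow_mem _ ?_ _
    exact (Subgroup.zpowers_le.mpr (Subgroup.zpow_mem_zpowers a _)) (h.zpow_sub_one_mem hc)
  rw [← mem_powers_iff_mem_zpowers] at h1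
  obtain ⟨i, hi⟩ := h1
  change a ^ i = a₁ ^ M at hi
  have hM0 : M ≠ 0 := by
    rintro rfl
    exact h.left_ne_zero (by rw [hM, mul_zero])
  have hoN : orderOf (a ^ i) = N := by
    rw [hi, orderOf_pow_of_dvd hM0 (by rw [ho, hM]; exact dvd_mul_left _ _), ho, hM,
      Nat.mul_div_cancel _ (Nat.pos_of_ne_zero hM0)]
  have key : ∀ k l : ℕ, (a ^ i) ^ k = (a ^ i) ^ l → (N : ℤ) ∣ (k : ℤ) - l := by
    intro k l hkl
    rw [pow_eq_pow_iff_modEq, hoN] at hkl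
    exact (Nat.modEq_iff_dvd.mp hkl.symm)
  constructor
  · have h2 : b₁ * a ^ i = (a ^ i) ^ t₁ * b₁ := by
      rw [hi, ← pow_mul, mul_comm M, pow_mul, ← hc, conj_pow, inv_mul_cancel_right]
    have h3 : b₁ * a ^ i = (a ^ i) ^ (t ^ y) * b₁ := by
      rw [hb, mul_assoc, pow_mul_pow_of_conj h.conj, ← mul_assoc, ← mul_assoc, ← pow_mul, ← pow_add,
        ← pow_add, add_comm]
    exact_mod_cast key _ _ (mul_right_cancel (h2.symm.trans h3))
  · have h2 : a₁ * a ^ i = (a ^ i) ^ 1 * a₁ := by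
      rw [hi, pow_one, ← pow_succ', ← pow_succ]
    have h3 : a₁ * a ^ i = (a ^ i) ^ (t ^ w) * a₁ := by
      rw [ha, mul_assoc, pow_mul_pow_of_conj h.conj, ← mul_assoc, ← mul_assoc, ← pow_mul, ← pow_add,
        ← pow_add, add_comm]
    exact_mod_cast key _ _ (mul_right_cancel (h3.symm.trans h2))

/-- Every element is a product `a₁ ^ i * b₁ ^ j`, in coordinates with respect to `a` and `b`. -/
theorem exists_pow_eq (h : GenPair G a b m n s t) (hc : b₁ * a₁ * b₁⁻¹ = a₁ ^ t₁)
    (hsup : Subgroup.zpowers a₁ ⊔ Subgroup.zpowers b₁ = ⊤)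
    (ha : a₁ = a ^ z * b ^ w) (hb : b₁ = a ^ x * b ^ y) (g : G) :
    ∃ i j : ℕ, g = a ^ (z * (∑ k ∈ Finset.range i, (t ^ w) ^ k) +
      (x * ∑ k ∈ Finset.range j, (t ^ y) ^ k) * t ^ (w * i)) * b ^ (w * i + y * j) := by
  have : (Subgroup.zpowers a₁).Normal :=
    normal_of_conj (by rw [hc]; exact Subgroup.npow_mem_zpowers _ _) hsup
  obtain ⟨i, j, hij⟩ := exists_mul_eq_of_sup_eq_top hsup g
  refine ⟨i, j, ?_⟩
  rw [hij, ha, hb, mul_pow_of_conj h.conj, mul_pow_of_conj h.conj, mul_assoc,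
    ← mul_assoc (b ^ (w * i)), pow_mul_pow_of_conj h.conj, mul_assoc, ← pow_add, ← mul_assoc,
    ← pow_add]

/-- Modulo `⟨a⟩`, the group is cyclic of order `n` and generated by `b ^ w` and `b ^ y`. -/
theorem not_dvd_right (h : GenPair G a b m n s t) (hc : b₁ * a₁ * b₁⁻¹ = a₁ ^ t₁)
    (hsup : Subgroup.zpowers a₁ ⊔ Subgroup.zpowers b₁ = ⊤)
    (ha : a₁ = a ^ z * b ^ w) (hb : b₁ = a ^ x * b ^ y) {p : ℕ} (hp : p.Prime) (hpn : p ∣ n)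
    (hpw : p ∣ w) : ¬ p ∣ y := by
  intro hpy
  obtain ⟨i, j, hij⟩ := h.exists_pow_eq hc hsup ha hb b
  have h1 : a ^ 0 * b ^ 1 = b := by simp
  conv_lhs at hij => rw [← h1]
  obtain ⟨c, hc, -⟩ := h.pow_mul_pow_eq_iff.mp hij
  have h2 : (p : ℤ) ∣ ((w * i + y * j : ℕ) : ℤ) + n * c := by
    refine dvd_add (Int.natCast_dvd_natCast.mpr ?_) ((Int.natCast_dvd_natCast.mpr hpn).mul_right c)
    exact dvd_add (hpw.mul_right i) (hpy.mul_right j)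
  rw [← hc, add_sub_cancel, Nat.cast_one] at h2
  exact (Nat.prime_iff_prime_int.mp hp).not_isUnit (isUnit_of_dvd_one h2)

/-- Under these hypotheses the group has an abelian quotient of type `(p, p)`, generated by the
images of `a` and `b`, hence also by those of `a₁` and `b₁`. -/
theorem not_dvd_left (h : GenPair G a b m n s t) (hc : b₁ * a₁ * b₁⁻¹ = a₁ ^ t₁)
    (hsup : Subgroup.zpowers a₁ ⊔ Subgroup.zpowers b₁ = ⊤)
    (ha : a₁ = a ^ z * b ^ w) (hb : b₁ = a ^ x * b ^ y) {p : ℕ} (hp : p.Prime) (hpn : p ∣ n)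
    (hps : p ∣ s) (hpt : (p : ℤ) ∣ t - 1) (hpw : p ∣ w) : ¬ (p : ℤ) ∣ z := by
  intro hpz
  have hpy := h.not_dvd_right hc hsup ha hb hp hpn hpw
  obtain ⟨i, j, hij⟩ := h.exists_pow_eq hc hsup ha hb a
  have h1 : a ^ 1 * b ^ 0 = a := by simp
  conv_lhs at hij => rw [← h1]
  obtain ⟨c, hc, hm⟩ := h.pow_mul_pow_eq_iff.mp hij
  have hp' := Nat.prime_iff_prime_int.mp hp
  have hpj : (p : ℤ) ∣ j := by
    have h2 : (p : ℤ) ∣ y * j := by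
      have h3 := dvd_sub (dvd_neg.mpr ((Int.natCast_dvd_natCast.mpr hpn).mul_right c))
        ((Int.natCast_dvd_natCast.mpr hpw).mul_right (i : ℤ))
      rw [← hc] at h3
      refine h3.trans (dvd_of_eq ?_)
      push_cast
      ring
    exact (hp'.dvd_or_dvd h2).resolve_left fun h => hpy (Int.natCast_dvd_natCast.mp h)
  have h4 : (p : ℤ) ∣ ∑ k ∈ Finset.range j, ((t : ℤ) ^ y) ^ k := by
    simpa using dvd_add (geom_sum_sub_dvd (pow_sub_one_dvd hpt y) j) hpj
  have hpm : (p : ℤ) ∣ m := Int.natCast_dvd_natCast.mpr (hps.trans h.right_dvd_left)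
  have h5 := hpm.trans hm
  have h6 : (p : ℤ) ∣ 1 := by
    have h7 := dvd_add h5 (dvd_sub
      (dvd_add (hpz.mul_right (∑ k ∈ Finset.range i, ((t : ℤ) ^ w) ^ k))
        ((h4.mul_left (x : ℤ)).mul_right ((t : ℤ) ^ (w * i))))
      ((Int.natCast_dvd_natCast.mpr hps).mul_right c))
    refine h7.trans (dvd_of_eq ?_)
    push_cast
    ring
  exact hp'.not_isUnit (isUnit_of_dvd_one h6)

/-- In the case where the `2`-part of `s` is half that of `m` and the `2`-part of `m` is `2 ^ ρ`
times that of `n`, the order of `b₁ = a ^ x * b ^ y` would drop if `x` were odd: both summands of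
the exponent of `a` in `b₁ ^ n` would be exactly divisible by half of the `2`-part of `m`. -/
theorem two_dvd_of_orderOf (h : GenPair G a b m n s t) (hb : b₁ = a ^ x * b ^ y)
    (ho : orderOf b₁ * s = m * n) (hy : Odd y) {ρ : ℕ} (hρ : 2 ≤ ρ) (ht : (2 : ℤ) ^ ρ ∣ t + 1)
    (ht' : ¬ (2 : ℤ) ^ (ρ + 1) ∣ t + 1) (hn : Even n)
    (hs : s.factorization 2 + 1 = m.factorization 2)
    (hμ : m.factorization 2 = n.factorization 2 + ρ) : (2 : ℤ) ∣ x := by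
  by_contra hx
  set μ := m.factorization 2 with hμ'
  set σ := s.factorization 2 with hσ'
  have hm0 := h.left_ne_zero
  have hsσ : (2 : ℤ) ^ σ ∣ s := by exact_mod_cast Nat.ordProj_dvd s 2
  have hsσ' : ¬ (2 : ℤ) ^ (σ + 1) ∣ s := by
    exact_mod_cast Nat.pow_succ_factorization_not_dvd h.right_ne_zero Nat.prime_two
  have h4 : (4 : ℤ) ∣ t + 1 := (pow_dvd_pow (2 : ℤ) hρ).trans ht
  have h4y : (4 : ℤ) ∣ (t : ℤ) ^ y + 1 := two_pow_dvd_pow_add_one (ρ := 2) h4 hy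
  obtain ⟨y', hy'⟩ := hy
  -- The geometric sum `S` in `b₁ ^ n` is exactly divisible by half of the `2`-part of `m`.
  set S : ℤ := ∑ k ∈ Finset.range n, ((t : ℤ) ^ y) ^ k with hS
  have hyn : Even (y * n) := hn.mul_left y
  have hS' : S * ((t : ℤ) ^ y - 1) = (t : ℤ) ^ (y * n) - 1 := by
    rw [hS, geom_sum_mul, pow_mul]
  obtain ⟨v, hv⟩ : ∃ v : ℤ, (t : ℤ) ^ y - 1 = 2 * (2 * v + 1) :=
    ⟨((t : ℤ) ^ y - 1 - 2) / 4, by omega⟩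
  have hcop : ∀ k : ℕ, IsCoprime ((2 : ℤ) ^ k) (2 * v + 1) := fun k =>
    (Int.prime_two.coprime_iff_not_dvd.mpr (by omega)).pow_left
  have hpow : ∀ k : ℕ, (2 : ℤ) ^ k ∣ S ↔ (2 : ℤ) ^ (k + 1) ∣ (t : ℤ) ^ (y * n) - 1 := by
    intro k
    have h5 : (2 : ℤ) ^ (k + 1) ∣ S * 2 * (2 * v + 1) ↔ (2 : ℤ) ^ (k + 1) ∣ S * 2 :=
      ⟨(hcop (k + 1)).dvd_of_dvd_mul_right, fun h => h.mul_right _⟩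
    rw [← hS', hv, ← mul_assoc, h5, pow_succ, mul_dvd_mul_iff_right two_ne_zero]
  have hyη : ∀ k : ℕ, 2 ^ k ∣ y * n ↔ k ≤ n.factorization 2 := by
    intro k
    rw [(Nat.Coprime.pow_left k (Nat.coprime_two_left.mpr ⟨y', hy'⟩)).dvd_mul_left,
      Nat.prime_two.pow_dvd_iff_le_factorization h.index_ne_zero]
  have hS1 : (2 : ℤ) ^ σ ∣ S := by
    rw [hpow, show σ + 1 = ρ + n.factorization 2 by omega,
      two_pow_dvd_pow_sub_one_iff hρ ht ht' hyn, hyη]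
  have hS2 : ¬ (2 : ℤ) ^ (σ + 1) ∣ S := by
    rw [hpow, show σ + 1 + 1 = ρ + (n.factorization 2 + 1) by omega,
      two_pow_dvd_pow_sub_one_iff hρ ht ht' hyn, hyη]
    omega
  have hi : (2 : ℤ) ^ μ ∣ x * S + s * y := by
    obtain ⟨x', hx'⟩ : ∃ x' : ℤ, (x : ℤ) = 2 * x' + 1 := ⟨(x : ℤ) / 2, by omega⟩
    obtain ⟨e, he⟩ := two_pow_dvd_sub hS1 hS2
    obtain ⟨f, hf⟩ := two_pow_dvd_sub hsσ hsσ'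
    rw [← hs, hx']
    refine ⟨2 * x' * e + x' + e + f * y + y' + 1, ?_⟩
    rw [hy']
    push_cast
    rw [pow_succ] at he hf ⊢
    linear_combination (2 * x' + 1) * he + (2 * (y' : ℤ) + 1) * hf
  -- So `b₁ ^ (n * m')` is trivial, with `m'` the odd part of `m`.
  set m' := m / 2 ^ μ with hm'
  have hmm' : 2 ^ μ * m' = m := Nat.ordProj_mul_ordCompl_eq_self m 2
  have h1 : b₁ ^ (n * m') = 1 := by
    have h2 : b₁ ^ n = a ^ (x * (∑ k ∈ Finset.range n, (t ^ y) ^ k) + s * y) := by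
      rw [hb, mul_pow_of_conj h.conj, mul_comm y n, pow_mul b n, h.pow_eq, ← pow_mul, ← pow_add]
    rw [pow_mul, h2, ← pow_mul, ← orderOf_dvd_iff_pow_eq_one, h.orderOf_left, ← hmm']
    refine Nat.mul_dvd_mul_right ?_ m'
    have hi' : ((2 ^ μ : ℕ) : ℤ) ∣ ((x * (∑ k ∈ Finset.range n, (t ^ y) ^ k) + s * y : ℕ) : ℤ) := by
      push_cast
      exact hi
    exact Int.natCast_dvd_natCast.mp hi'
  have h2 : m * n ∣ n * m' * s := by
    rw [← ho]
    exact Nat.mul_dvd_mul_right (orderOf_dvd_of_pow_eq_one h1) s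
  have h3 : 2 ^ μ ∣ s := by
    have hn0 := Nat.pos_of_ne_zero h.index_ne_zero
    have hm0' : 0 < m' := Nat.pos_of_ne_zero fun h0 => hm0 (by rw [← hmm', h0, mul_zero])
    refine Nat.dvd_of_mul_dvd_mul_left (Nat.mul_pos hn0 hm0') ?_
    calc n * m' * 2 ^ μ = m * n := by rw [← hmm']; ring
      _ ∣ n * m' * s := h2
  rw [← hs] at h3
  exact hsσ' (by exact_mod_cast h3)

end GenPair

theorem orderOf_natCast_dvd_iff {N t w : ℕ} :
    orderOf (t : ZMod N) ∣ w ↔ (N : ℤ) ∣ (t : ℤ) ^ w - 1 := by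
  rw [orderOf_dvd_iff_pow_eq_one, ← ZMod.intCast_zmod_eq_zero_iff_dvd]
  push_cast
  rw [sub_eq_zero]

theorem factorization_oInv_natCast {m : ℕ} (hm : m ≠ 0) {u : (ZMod m)ˣ} {t : ℕ}
    (hu : (u : ZMod m) = t) {p : ℕ} (hp : p ∈ (rInv (Subgroup.zpowers u)).primeFactors) :
    (oInv (Subgroup.zpowers u)).factorization p =
      (orderOf (t : ZMod (piPart (nu (Subgroup.zpowers u) : Set ℕ) m))).factorization p := by
  have : NeZero m := ⟨hm⟩
  rw [factorization_oInv u hp, ← orderOf_units, val_unitsMap _ hu]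

theorem orderOf_natCast_ne_zero {m N t : ℕ} (hm : m ≠ 0) (hN : N ∣ m) {u : (ZMod m)ˣ}
    (hu : (u : ZMod m) = t) : orderOf (t : ZMod N) ≠ 0 := by
  have : NeZero N := ⟨ne_zero_of_dvd_ne_zero hm hN⟩
  rw [← val_unitsMap hN hu, orderOf_units]
  exact (orderOf_pos _).ne'

/-- The generator acts without fixed points at the primes of `ν`. -/
theorem isCoprime_piPart_nu {m : ℕ} (hm : m ≠ 0) {u : (ZMod m)ˣ} {t : ℕ} (hu : (u : ZMod m) = t) :
    IsCoprime ((piPart (nu (Subgroup.zpowers u) : Set ℕ) m : ℕ) : ℤ) (t - 1) := by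
  rw [Int.isCoprime_iff_gcd_eq_one]
  by_contra hne
  obtain ⟨p, hp, hpd⟩ := Nat.exists_prime_and_dvd hne
  have h1 : (p : ℤ) ∣ (piPart (nu (Subgroup.zpowers u) : Set ℕ) m : ℕ) :=
    (Int.natCast_dvd_natCast.mpr hpd).trans (Int.gcd_dvd_left _ _)
  have h2 : (p : ℤ) ∣ t - 1 := (Int.natCast_dvd_natCast.mpr hpd).trans (Int.gcd_dvd_right _ _)
  rw [Int.natCast_dvd_natCast, ← pow_one p, pow_dvd_piPart_iff hm hp] at h1
  obtain ⟨h1, h3⟩ := h1.resolve_left one_ne_zero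
  have h4 := (pow_dvd_rInv_iff hm hu hp h3).mpr (Or.inl (by simpa using h2))
  rw [pow_one] at h4
  simp only [nu, Finset.mem_coe, Finset.mem_sdiff] at h1
  exact h1.2 (Nat.mem_primeFactors.mpr ⟨hp, h4, rInv_ne_zero hm _⟩)

theorem epsInv_congr {m : ℕ} (hm : m ≠ 0) {u u' : (ZMod m)ˣ} {t t' : ℕ} (hu : (u : ZMod m) = t)
    (hu' : (u' : ZMod m) = t') (hr : rInv (Subgroup.zpowers u) = rInv (Subgroup.zpowers u'))
    (h : (2 : ℤ) ^ (rInv (Subgroup.zpowers u)).factorization 2 ∣ t - 1 ↔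
      (2 : ℤ) ^ (rInv (Subgroup.zpowers u)).factorization 2 ∣ t' - 1) :
    epsInv (Subgroup.zpowers u) = epsInv (Subgroup.zpowers u') := by
  have h1 := epsInv_eq_one_iff hm hu
  have h2 := epsInv_eq_one_iff hm hu'
  rw [← hr, ← h, ← h1] at h2
  rcases epsInv_eq_one_or (Subgroup.zpowers u) with h3 | h3 <;>
  rcases epsInv_eq_one_or (Subgroup.zpowers u') with h4 | h4 <;> simp_all

theorem nu_congr {m : ℕ} {T T' : Subgroup (ZMod m)ˣ} (hr : rInv T = rInv T') : nu T = nu T' := by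
  rw [nu, nu, hr]

namespace GenPair

variable {G : Type*} [Group G] {a b a₁ b₁ : G} {m n s t t₁ : ℕ}

theorem left_dvd_mul (h : GenPair G a b m n s t) : (m : ℤ) ∣ s * (t - 1) := by
  have := Nat.modEq_iff_dvd.mp h.mul_modEq.symm
  refine this.trans (dvd_of_eq ?_)
  push_cast
  ring

theorem left_dvd_pow (h : GenPair G a b m n s t) : (m : ℤ) ∣ (t : ℤ) ^ n - 1 := by
  have := Nat.modEq_iff_dvd.mp h.pow_modEq_one.symm
  exact_mod_cast this

theorem even_index (h : GenPair G a b m n s t) {k : ℕ} (hk : 2 ≤ k) (hkm : 2 ^ k ∣ m)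
    (ht : (2 : ℤ) ^ k ∣ t + 1) : Even n := by
  by_contra hn
  rw [Nat.not_even_iff_odd] at hn
  have h1 : (4 : ℤ) ∣ (t : ℤ) ^ n + 1 :=
    two_pow_dvd_pow_add_one (ρ := 2) ((pow_dvd_pow (2 : ℤ) hk).trans ht) hn
  have h2 : (4 : ℤ) ∣ (t : ℤ) ^ n - 1 := by
    refine Dvd.dvd.trans ?_ h.left_dvd_pow
    exact Int.natCast_dvd_natCast.mpr ((pow_dvd_pow 2 hk).trans hkm)
  omega

variable [Finite G] {u u₁ : (ZMod m)ˣ}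

/-- The sign is determined by the order of the derived subgroup. -/
theorem epsInv_eq (h : GenPair G a b m n s t) (h₁ : GenPair G a₁ b₁ m n s t₁)
    (hu : (u : ZMod m) = t) (hu₁ : (u₁ : ZMod m) = t₁)
    (hr : rInv (Subgroup.zpowers u) = rInv (Subgroup.zpowers u₁)) :
    epsInv (Subgroup.zpowers u) = epsInv (Subgroup.zpowers u₁) := by
  have hm := h.left_ne_zero
  have hd : 2 ^ (rInv (Subgroup.zpowers u)).factorization 2 ∣ m :=
    (Nat.ordProj_dvd _ 2).trans (rInv_dvd hm _)
  refine epsInv_congr hm hu hu₁ hr ⟨fun h2 => ?_, fun h2 => ?_⟩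
  · exact_mod_cast h.dvd_sub_one h₁.conj h₁.orderOf_left hd (by exact_mod_cast h2)
  · exact_mod_cast h₁.dvd_sub_one h.conj h.orderOf_left hd (by exact_mod_cast h2)

/-- A second generator of the group may be chosen so that its exponent with respect to `b` is odd,
at the price of changing the subgroup it generates. -/
theorem exists_odd (h : GenPair G a b m n s t) (h₁ : GenPair G a₁ b₁ m n s t₁) {z w : ℕ}
    (ha : a₁ = a ^ z * b ^ w) : ∃ (b₂ : G) (x y : ℕ), b₂ * a₁ * b₂⁻¹ = a₁ ^ t₁ ∧
      Subgroup.zpowers a₁ ⊔ Subgroup.zpowers b₂ = ⊤ ∧ b₂ = a ^ x * b ^ y ∧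
      (2 ∣ w → orderOf b₂ * s = m * n) ∧ (Even n → Odd y) := by
  obtain ⟨x, y, hb⟩ := h.exists_eq b₁
  by_cases hy : Even n → Odd y
  · exact ⟨b₁, x, y, h₁.conj, h₁.sup_eq, hb, fun _ => h₁.orderOf_right_mul, hy⟩
  push Not at hy
  obtain ⟨hn, hy⟩ := hy
  rw [Nat.not_odd_iff_even] at hy
  have hw : Odd w := by
    rw [← Nat.not_even_iff_odd, even_iff_two_dvd]
    intro hw
    exact h.not_dvd_right h₁.conj h₁.sup_eq ha hb Nat.prime_two (even_iff_two_dvd.mp hn) hw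
      (even_iff_two_dvd.mp hy)
  refine ⟨b₁ * a₁, x + z * t ^ y, y + w, ?_, ?_, ?_, fun h2 => ?_, fun _ => hy.add_odd hw⟩
  · rw [← h₁.conj]
    group
  · rw [eq_top_iff, ← h₁.sup_eq, sup_le_iff]
    refine ⟨le_sup_left, ?_⟩
    rw [Subgroup.zpowers_le]
    have h2 : b₁ * a₁ * a₁⁻¹ ∈ Subgroup.zpowers a₁ ⊔ Subgroup.zpowers (b₁ * a₁) :=
      Subgroup.mul_mem _ (Subgroup.mem_sup_right (Subgroup.mem_zpowers _))
        (Subgroup.inv_mem _ (Subgroup.mem_sup_left (Subgroup.mem_zpowers _)))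
    rwa [mul_inv_cancel_right] at h2
  · rw [ha, hb, mul_assoc, ← mul_assoc (b ^ y), pow_mul_pow_of_conj h.conj, mul_assoc, ← pow_add,
      ← mul_assoc, ← pow_add]
  · exact absurd (even_iff_two_dvd.mpr h2) (Nat.not_even_iff_odd.mpr hw)

/-- Two factorizations of a group with the same parameters `m`, `n`, `s` and `r`: modulo
`[T, n, s]`, the action of the second one is a power of that of the first one. -/
theorem exists_modulus_dvd (h : GenPair G a b m n s t) (h₁ : GenPair G a₁ b₁ m n s t₁)
    (hu : (u : ZMod m) = t) (hu₁ : (u₁ : ZMod m) = t₁)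
    (hr : rInv (Subgroup.zpowers u) = rInv (Subgroup.zpowers u₁)) :
    ∃ y : ℕ, (modulus (Subgroup.zpowers u) n s : ℤ) ∣ t₁ - (t : ℤ) ^ y := by
  have hm := h.left_ne_zero
  have hε := h.epsInv_eq h₁ hu hu₁ hr
  obtain ⟨z, w, ha⟩ := h.exists_eq a₁
  obtain ⟨b₂, x, y, hc, hsup, hb, ho, hy⟩ := h.exists_odd h₁ ha
  refine ⟨y, ?_⟩
  obtain ⟨c, hc1, hc2⟩ := h.relation hc ha hb
  have hNm : piPart (nu (Subgroup.zpowers u) : Set ℕ) m ∣ m := piPart_dvd _ hm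
  have hcop : IsCoprime ((piPart (nu (Subgroup.zpowers u) : Set ℕ) m : ℕ) : ℤ) (t₁ - 1) := by
    rw [nu_congr hr]
    exact isCoprime_piPart_nu hm hu₁
  obtain ⟨hN1, hN2⟩ := h.dvd_of_isCoprime hc h₁.orderOf_left ha hb hNm hcop
  rw [modulus_dvd_iff hm]
  refine ⟨hN1, fun p hp => ?_⟩
  have hp' := Nat.prime_of_mem_primeFactors hp
  have hpr := Nat.dvd_of_mem_primeFactors hp
  have hO := factorization_oInv_natCast hm hu hp
  set O := orderOf (t : ZMod (piPart (nu (Subgroup.zpowers u) : Set ℕ) m)) with hOdef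
  have hOw : O ∣ w := orderOf_natCast_dvd_iff.mpr hN2
  have hOn : O ∣ n :=
    orderOf_natCast_dvd_iff.mpr ((Int.natCast_dvd_natCast.mpr hNm).trans h.left_dvd_pow)
  have hω : p ^ (oInv (Subgroup.zpowers u)).factorization p ∣ O := hO ▸ Nat.ordProj_dvd O p
  have hμ : (p : ℤ) ^ m.factorization p ∣ m := by exact_mod_cast Nat.ordProj_dvd m p
  by_cases hεp : epsInv (Subgroup.zpowers u) ^ (p - 1) = 1
  · obtain ⟨h1, h2, h3, h4⟩ := positive_case hm hu hp' hpr hεp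
    obtain ⟨-, -, h3', -⟩ := positive_case hm hu₁ hp' (hr ▸ hpr) (hε ▸ hεp)
    rw [← hr] at h3'
    have he := modExp_le hm (Subgroup.zpowers u) n s p
    have he' : modExp (Subgroup.zpowers u) n s p = _ := if_pos hεp
    refine local_comparison_pos hp' h.index_ne_zero h1 h3 h3' (hω.trans hOw) (fun hlt => ?_) hc1
      (((pow_dvd_pow _ he).trans hμ).trans hc2) (by omega) (by omega)
    have hω1 : 1 ≤ (oInv (Subgroup.zpowers u)).factorization p := by omega
    have hpO : p ∣ O := (dvd_pow_self p (by omega)).trans hω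
    have hps : p ∣ s := by
      by_contra hps
      have h5 : (p : ℤ) ^ m.factorization p ∣ t - 1 := by
        refine IsCoprime.dvd_of_dvd_mul_left ?_ (hμ.trans h.left_dvd_mul)
        exact IsCoprime.pow_left
          (Nat.isCoprime_iff_coprime.mpr ((Nat.Prime.coprime_iff_not_dvd hp').mpr hps))
      exact (h4 (by omega)).1 ((pow_dvd_pow _ (by omega)).trans h5)
    exact h.not_dvd_left hc hsup ha hb hp' (hpO.trans hOn) hps
      ((dvd_pow_self _ (by omega)).trans h3) (hpO.trans hOw)
  · obtain rfl : p = 2 := by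
      by_contra hp2
      exact hεp (eps_pow_eq_one hp' hp2)
    have hε1 : epsInv (Subgroup.zpowers u) ≠ 1 := fun h => hεp (by rw [h, one_pow])
    obtain ⟨h1, h2, h3, h4⟩ := negative_case hm hu hε1
    obtain ⟨-, -, h3', -⟩ := negative_case hm hu₁ (hε ▸ hε1)
    rw [← hr] at h3'
    have he' : modExp (Subgroup.zpowers u) n s 2 = _ := if_neg hεp
    push_cast at hμ
    have hρm : 2 ^ (rInv (Subgroup.zpowers u)).factorization 2 ∣ m :=
      (Nat.prime_two.pow_dvd_iff_le_factorization hm).mpr h2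
    have hn2 := h.even_index h1 hρm h3
    have ht2 : (2 : ℤ) ∣ t - 1 := by
      have := (dvd_pow_self (2 : ℤ) (by omega)).trans h3
      omega
    refine local_comparison_neg h.index_ne_zero h1 h2 h3 h4 h3' h.right_ne_zero
      ((Nat.factorization_le_iff_dvd h.right_ne_zero hm).mpr h.right_dvd_left 2)
      (hμ.trans h.left_dvd_mul) hn2 (hμ.trans h.left_dvd_pow) (hω.trans hOw) (hy hn2)
      (fun hs hw => ?_) hc1 (hμ.trans hc2) (fun hw hs hμ' hlt => ?_) he'
    · exact h.not_dvd_left hc hsup ha hb Nat.prime_two (even_iff_two_dvd.mp hn2) hs ht2 hw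
    · exact h.two_dvd_of_orderOf hb (ho hw) (hy hn2) h1 h3 (h4 hlt) hn2 hs hμ'

theorem orderOf_natCast_eq {N : ℕ} {y y₁ : ℕ} (h : (N : ℤ) ∣ t₁ - (t : ℤ) ^ y)
    (h₁ : (N : ℤ) ∣ t - (t₁ : ℤ) ^ y₁) : orderOf (t : ZMod N) = orderOf (t₁ : ZMod N) := by
  have key : ∀ {t t₁ y : ℕ}, (N : ℤ) ∣ t₁ - (t : ℤ) ^ y →
      orderOf (t₁ : ZMod N) ∣ orderOf (t : ZMod N) := by
    intro t t₁ y h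
    rw [← ZMod.intCast_zmod_eq_zero_iff_dvd] at h
    push_cast at h
    rw [sub_eq_zero.mp h]
    exact orderOf_pow_dvd y
  exact Nat.dvd_antisymm (key h₁) (key h)

theorem modExp_congr (hm : m ≠ 0) (hu : (u : ZMod m) = t) (hu₁ : (u₁ : ZMod m) = t₁)
    (hr : rInv (Subgroup.zpowers u) = rInv (Subgroup.zpowers u₁))
    (hε : epsInv (Subgroup.zpowers u) = epsInv (Subgroup.zpowers u₁))
    (ho : orderOf (t : ZMod (piPart (nu (Subgroup.zpowers u) : Set ℕ) m)) =
      orderOf (t₁ : ZMod (piPart (nu (Subgroup.zpowers u) : Set ℕ) m))) (n s : ℕ) {p : ℕ}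
    (hp : p ∈ (rInv (Subgroup.zpowers u)).primeFactors) :
    modExp (Subgroup.zpowers u) n s p = modExp (Subgroup.zpowers u₁) n s p := by
  have h1 := factorization_oInv_natCast hm hu hp
  have h2 := factorization_oInv_natCast hm hu₁ (hr ▸ hp)
  rw [ho, nu_congr hr, ← h2] at h1
  rw [modExp, modExp, hε, hr, h1]

theorem modulus_congr (hm : m ≠ 0) (hu : (u : ZMod m) = t) (hu₁ : (u₁ : ZMod m) = t₁)
    (hr : rInv (Subgroup.zpowers u) = rInv (Subgroup.zpowers u₁))
    (hε : epsInv (Subgroup.zpowers u) = epsInv (Subgroup.zpowers u₁))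
    (ho : orderOf (t : ZMod (piPart (nu (Subgroup.zpowers u) : Set ℕ) m)) =
      orderOf (t₁ : ZMod (piPart (nu (Subgroup.zpowers u) : Set ℕ) m))) (n s : ℕ) :
    modulus (Subgroup.zpowers u) n s = modulus (Subgroup.zpowers u₁) n s := by
  rw [modulus_eq hm, modulus_eq hm, nu_congr hr, ← hr]
  congr 1
  exact Finset.prod_congr rfl fun p hp => by rw [modExp_congr hm hu hu₁ hr hε ho n s hp]

theorem res_le (hu : (u : ZMod m) = t) (hu₁ : (u₁ : ZMod m) = t₁) {q y : ℕ}
    (hq : q ∣ m) (h : (q : ℤ) ∣ t₁ - (t : ℤ) ^ y) :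
    res q (Subgroup.zpowers u₁) ≤ res q (Subgroup.zpowers u) := by
  rw [res_zpowers hq, res_zpowers hq, Subgroup.zpowers_le]
  refine Subgroup.mem_zpowers_iff.mpr ⟨y, ?_⟩
  rw [zpow_natCast, ← Units.val_inj, Units.val_pow_eq_pow_val, val_unitsMap hq hu,
    val_unitsMap hq hu₁]
  rw [← ZMod.intCast_zmod_eq_zero_iff_dvd] at h
  push_cast at h
  exact (sub_eq_zero.mp h).symm

/-- The modulus and the group `Δ` are the same for two factorizations of a group with the same
parameters `m`, `n`, `s` and `r`. -/
theorem modulus_eq_and_res_eq (h : GenPair G a b m n s t) (h₁ : GenPair G a₁ b₁ m n s t₁)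
    (hu : (u : ZMod m) = t) (hu₁ : (u₁ : ZMod m) = t₁)
    (hr : rInv (Subgroup.zpowers u) = rInv (Subgroup.zpowers u₁)) :
    modulus (Subgroup.zpowers u) n s = modulus (Subgroup.zpowers u₁) n s ∧
      res (modulus (Subgroup.zpowers u) n s) (Subgroup.zpowers u) =
        res (modulus (Subgroup.zpowers u) n s) (Subgroup.zpowers u₁) := by
  have hm := h.left_ne_zero
  obtain ⟨y, hy⟩ := h.exists_modulus_dvd h₁ hu hu₁ hr
  obtain ⟨y₁, hy₁⟩ := h₁.exists_modulus_dvd h hu₁ hu hr.symm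
  have hN := Int.natCast_dvd_natCast.mpr (piPart_nu_dvd_modulus (Subgroup.zpowers u) n s)
  have hN₁ := Int.natCast_dvd_natCast.mpr (piPart_nu_dvd_modulus (Subgroup.zpowers u₁) n s)
  rw [← nu_congr hr] at hN₁
  have hM := modulus_congr hm hu hu₁ hr (h.epsInv_eq h₁ hu hu₁ hr)
    (orderOf_natCast_eq (hN.trans hy) (hN₁.trans hy₁)) n s
  have hq := modulus_dvd hm (Subgroup.zpowers u) n s
  rw [← hM] at hy₁
  exact ⟨hM, le_antisymm (res_le hu₁ hu hq hy₁) (res_le hu hu₁ hq hy)⟩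

end GenPair

/-! ### Solving congruences for a change of generators -/

theorem exists_nat_dvd_mul_sub {A M c : ℤ} (hM : M ≠ 0) (h : IsCoprime A M) :
    ∃ l : ℕ, M ∣ A * l - c := by
  obtain ⟨α, β, hαβ⟩ := h
  have hl : 0 ≤ (α * c) % M := Int.emod_nonneg _ hM
  obtain ⟨l, hl'⟩ := Int.eq_ofNat_of_zero_le hl
  refine ⟨l, ?_⟩
  have h1 := Int.emod_add_mul_ediv (α * c) M
  rw [hl'] at h1
  exact ⟨-β * c - A * ((α * c) / M), by linear_combination c * hαβ + A * h1⟩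

/-- The powers of an integer exactly congruent to `1` modulo `p ^ ρ` represent all classes
that are trivial modulo `p ^ ρ`. -/
theorem exists_pow_sub_dvd {p : ℕ} (hp : p.Prime) {q v : ℤ} {ρ : ℕ} (hρ : 1 ≤ ρ)
    (hρ2 : p = 2 → 2 ≤ ρ) (hq : (p : ℤ) ^ ρ ∣ q - 1) (hq' : ¬ (p : ℤ) ^ (ρ + 1) ∣ q - 1)
    (hv : (p : ℤ) ^ ρ ∣ v - 1) (i : ℕ) : ∃ j : ℕ, (p : ℤ) ^ (ρ + i) ∣ v - q ^ j := by
  have hp' := Nat.prime_iff_prime_int.mp hp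
  induction i with
  | zero => exact ⟨0, by simpa using hv⟩
  | succ i ih =>
    obtain ⟨j, c, hc⟩ := ih
    obtain ⟨d, hd⟩ := (pow_dvd_pow_sub_one_iff hp hρ hρ2 hq hq' i (p ^ i)).mpr dvd_rfl
    have hd' : ¬ (p : ℤ) ∣ d := by
      intro h
      have h1 : (p : ℤ) ^ (ρ + (i + 1)) ∣ q ^ p ^ i - 1 := by
        rw [hd, ← add_assoc, pow_succ]
        exact mul_dvd_mul dvd_rfl h
      rw [pow_dvd_pow_sub_one_iff hp hρ hρ2 hq hq', Nat.pow_dvd_pow_iff_le_right hp.one_lt] at h1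
      omega
    have hqp : ¬ (p : ℤ) ∣ q := by
      intro h
      have h1 := dvd_sub h ((dvd_pow_self (p : ℤ) (by omega)).trans hq)
      rw [sub_sub_cancel] at h1
      exact hp'.not_isUnit (isUnit_of_dvd_one h1)
    have hcop : IsCoprime (q ^ j * d) (p : ℤ) := by
      refine (hp'.coprime_iff_not_dvd.mpr fun h => ?_).symm
      rcases hp'.dvd_or_dvd h with h | h
      · exact hqp (hp'.dvd_of_dvd_pow h)
      · exact hd' h
    obtain ⟨l, e, hl⟩ := exists_nat_dvd_mul_sub (c := c) hp'.ne_zero hcop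
    refine ⟨j + p ^ i * l, ?_⟩
    -- `q ^ (p ^ i * l) - 1` is `l * (q ^ (p ^ i) - 1)` to first order.
    obtain ⟨f, hf⟩ : (p : ℤ) ^ (ρ + i + 1) ∣ q ^ (p ^ i * l) - 1 - l * (q ^ p ^ i - 1) := by
      have h1 : q ^ (p ^ i * l) - 1 - l * (q ^ p ^ i - 1) =
          (q ^ p ^ i - 1) * (∑ k ∈ Finset.range l, (q ^ p ^ i) ^ k - l) := by
        rw [pow_mul]
        generalize q ^ p ^ i = X
        linear_combination -mul_geom_sum X l
      rw [h1, pow_succ]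
      have h2 : (p : ℤ) ∣ q ^ p ^ i - 1 := by
        rw [hd]
        exact (dvd_pow_self (p : ℤ) (by omega)).mul_right d
      exact mul_dvd_mul (Dvd.intro _ hd.symm) (geom_sum_sub_dvd h2 l)
    refine ⟨-e - q ^ j * f, ?_⟩
    rw [hd] at hf
    rw [← add_assoc, pow_succ (p : ℤ) (ρ + i)] at *
    rw [pow_add q]
    linear_combination hc - q ^ j * hf - (p : ℤ) ^ (ρ + i) * hl

/-- If `p ∣ t - 1`, the order of `t` modulo a power of `p` is a power of `p`. -/
theorem pow_dvd_pow_factorization_sub_one {p : ℕ} (hp : p.Prime) {t n l : ℕ} (hn : n ≠ 0)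
    (ht : (p : ℤ) ∣ t - 1) (htn : (p : ℤ) ^ l ∣ (t : ℤ) ^ n - 1) :
    (p : ℤ) ^ l ∣ (t : ℤ) ^ p ^ n.factorization p - 1 := by
  have h1 : ∀ w, orderOf (t : ZMod (p ^ l)) ∣ w ↔ (p : ℤ) ^ l ∣ (t : ℤ) ^ w - 1 := by
    intro w
    rw [orderOf_natCast_dvd_iff]
    push_cast
    rfl
  rw [← h1] at htn ⊢
  have h2 : orderOf (t : ZMod (p ^ l)) ∣ p ^ l := by
    rw [h1]
    have h3 := pow_dvd_pow_sub_one (ρ := 1) (k := l) (w := p ^ l) le_rfl (by simpa using ht) dvd_rfl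
    exact (pow_dvd_pow _ (by omega)).trans h3
  obtain ⟨i, -, hi⟩ := (Nat.dvd_prime_pow hp).mp h2
  rw [hi] at htn ⊢
  exact pow_dvd_pow p ((hp.pow_dvd_iff_le_factorization hn).mp htn)

theorem dvd_of_ordProj_of_ordCompl {p n : ℕ} (hp : p.Prime) (hn : n ≠ 0) {z : ℤ}
    (h1 : (p : ℤ) ^ n.factorization p ∣ z) (h2 : ((n / p ^ n.factorization p : ℕ) : ℤ) ∣ z) :
    (n : ℤ) ∣ z := by
  have hn' : (n : ℤ) = (p : ℤ) ^ n.factorization p * ((n / p ^ n.factorization p : ℕ) : ℤ) := by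
    exact_mod_cast (Nat.ordProj_mul_ordCompl_eq_self n p).symm
  rw [hn']
  refine IsCoprime.mul_dvd ?_ h1 h2
  exact IsCoprime.pow_left (Nat.isCoprime_iff_coprime.mpr (Nat.coprime_ordCompl hp hn))

/-- The geometric sum to first order at a prime `p`. -/
theorem pow_succ_dvd_geom_sum_sub {p : ℕ} (hp : p.Prime) {q : ℤ} {k l : ℕ} (hk : 1 ≤ k)
    (hq : (p : ℤ) ^ k ∣ q - 1) (hl : (p : ℤ) ∣ l - 1) (hl2 : p = 2 → (4 : ℤ) ∣ l - 1) :
    (p : ℤ) ^ (k + 1) ∣ ∑ i ∈ Finset.range l, q ^ i - l := by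
  have h1 : ∑ i ∈ Finset.range l, q ^ i - l =
      (q - 1) * ∑ i ∈ Finset.range l, (∑ j ∈ Finset.range i, q ^ j) := by
    have : ∑ i ∈ Finset.range l, q ^ i - l = ∑ i ∈ Finset.range l, (q ^ i - 1) := by simp
    rw [this, Finset.mul_sum]
    exact Finset.sum_congr rfl fun i _ => (mul_geom_sum q i).symm
  rw [h1, pow_succ]
  refine mul_dvd_mul hq ?_
  have hpq : (p : ℤ) ∣ q - 1 := (dvd_pow_self _ (by omega)).trans hq
  have h2 := Finset.dvd_sum fun i (_ : i ∈ Finset.range l) => geom_sum_sub_dvd hpq i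
  rw [Finset.sum_sub_distrib] at h2
  have h3 : (p : ℤ) ∣ ∑ i ∈ Finset.range l, (i : ℤ) := by
    have h4 := Finset.sum_range_id_mul_two l
    rcases Nat.eq_zero_or_pos l with rfl | hl0
    · simp
    have h5 : (∑ i ∈ Finset.range l, (i : ℤ)) * 2 = l * (l - 1) := by
      have := congrArg (Nat.cast : ℕ → ℤ) h4
      push_cast [Nat.cast_sub hl0] at this
      exact this
    rcases eq_or_ne p 2 with rfl | hp2
    · have h6 := (hl2 rfl).mul_left (l : ℤ)
      rw [← h5] at h6
      push_cast
      omega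
    · have h6 := hl.mul_left (l : ℤ)
      rw [← h5] at h6
      refine (Nat.prime_iff_prime_int.mp hp).dvd_or_dvd h6 |>.resolve_right fun h => hp2 ?_
      exact (Nat.prime_dvd_prime_iff_eq hp Nat.prime_two).mp (by exact_mod_cast h)
  simpa using dvd_add h2 h3

/-- Two integers with the same order at `p` differ by a unit modulo powers of `p`. -/
theorem exists_unit_dvd_mul_sub {p : ℕ} (hp : p.Prime) {A C : ℤ} {δ : ℕ} (hA : (p : ℤ) ^ δ ∣ A)
    (hA' : ¬ (p : ℤ) ^ (δ + 1) ∣ A) (hC : (p : ℤ) ^ δ ∣ C) (hC' : ¬ (p : ℤ) ^ (δ + 1) ∣ C) {μ : ℕ}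
    (hμ : δ < μ) : ∃ z : ℕ, ¬ p ∣ z ∧ (p : ℤ) ^ μ ∣ A * z - C := by
  have hp' := Nat.prime_iff_prime_int.mp hp
  have hp0 : (p : ℤ) ^ δ ≠ 0 := pow_ne_zero _ hp'.ne_zero
  obtain ⟨A', rfl⟩ := hA
  obtain ⟨C', rfl⟩ := hC
  rw [pow_succ, mul_dvd_mul_iff_left hp0] at hA' hC'
  obtain ⟨z, hz⟩ := exists_nat_dvd_mul_sub (c := C') (pow_ne_zero (μ - δ) hp'.ne_zero)
    (IsCoprime.pow_right (n := μ - δ) (hp'.coprime_iff_not_dvd.mpr hA').symm)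
  refine ⟨z, fun h => hC' ?_, ?_⟩
  · have h1 := (dvd_pow_self (p : ℤ) (by omega)).trans hz
    have h2 := dvd_sub ((Int.natCast_dvd_natCast.mpr h).mul_left A') h1
    simpa using h2
  · have h1 := mul_dvd_mul (dvd_refl ((p : ℤ) ^ δ)) hz
    rw [← pow_add, Nat.add_sub_cancel' hμ.le] at h1
    exact h1.trans (dvd_of_eq (by ring))

/-! ### Changing the generators of a factorization -/

theorem dvd_ordCompl_of_coprime {p d n : ℕ} (hd : d ∣ n) (h : d.Coprime p) :
    d ∣ n / p ^ n.factorization p := by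
  refine Nat.Coprime.dvd_of_dvd_mul_left (h.pow_right (n.factorization p)) ?_
  rw [Nat.ordProj_mul_ordCompl_eq_self]
  exact hd

namespace GenPair

variable {G : Type*} [Group G] {a b : G} {m n s t : ℕ}

/-- Replacing the generators `a` and `b` of the two factors by their `y`-th powers. -/
theorem pow (h : GenPair G a b m n s t) {y : ℕ} (hy : y.Coprime (n * m)) :
    GenPair G (a ^ y) (b ^ y) m n s (t ^ y) := by
  have hm : y.Coprime (orderOf a) := by
    rw [h.orderOf_left]
    exact hy.coprime_dvd_right (Nat.dvd_mul_left m n)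
  have ha := zpowers_pow_eq hm
  have hb : Subgroup.zpowers (b ^ y) = Subgroup.zpowers b := by
    refine zpowers_pow_eq (hy.coprime_dvd_right ?_)
    rw [mul_comm, ← h.orderOf_right_mul]
    exact Nat.dvd_mul_right _ _
  refine ⟨?_, ?_, by rw [ha, hb, h.sup_eq], by rw [ha, h.index_left], by rw [hb, h.index_right], ?_⟩
  · rw [← h.orderOf_left]
    exact hm.symm.orderOf_pow
  · rw [pow_mul_pow_of_conj h.conj, mul_inv_cancel_right, pow_mul]
  · rw [← pow_mul, mul_comm, pow_mul, h.pow_eq, ← pow_mul, ← pow_mul, mul_comm]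

variable [Finite G]

/-- Replacing the first factor `⟨a⟩` by `⟨a ^ z * b ^ w⟩`. The order of the new factor divides `m`,
so that it is `m` as soon as `m` is minimal. -/
theorem exists_change_left (h : GenPair G a b m n s t)
    (hmin : ∀ {a' b' : G} {m' n' s' t' : ℕ}, GenPair G a' b' m' n' s' t' → m ≤ m')
    {z w t₁ : ℕ} (hz : z.Coprime m) {c : ℤ} (hc : (w : ℤ) * (1 - t₁) = n * c)
    (hE : (m : ℤ) ∣ z * (t - ∑ i ∈ Finset.range t₁, ((t : ℤ) ^ w) ^ i) + s * c)
    (hS : (m : ℤ) ∣ ∑ i ∈ Finset.range m, ((t : ℤ) ^ w) ^ i) (hws : n ∣ w * s) :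
    ∃ a' : G, GenPair G a' b m n s t₁ := by
  set a₁ := a ^ z * b ^ w with ha₁
  have hconj : b * a₁ * b⁻¹ = a₁ ^ t₁ := by
    have h1 : b * a₁ = a ^ (z * t) * b ^ (w + 1) := by
      have := pow_mul_pow_of_conj h.conj z 1
      rw [pow_one, pow_one] at this
      rw [ha₁, ← mul_assoc, this, mul_assoc, ← pow_succ']
    rw [mul_inv_eq_iff_eq_mul, h1, ha₁, mul_pow_of_conj h.conj, mul_assoc, ← pow_succ,
      h.pow_mul_pow_eq_iff]
    refine ⟨c, ?_, hE.trans (dvd_of_eq ?_)⟩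
    · push_cast
      linear_combination hc
    · push_cast
      ring
  have hsup : Subgroup.zpowers a₁ ⊔ Subgroup.zpowers b = ⊤ := by
    rw [eq_top_iff, ← h.sup_eq, sup_le_iff]
    refine ⟨?_, le_sup_right⟩
    rw [← zpowers_pow_eq (a := a) (e := z) (h.orderOf_left ▸ hz), Subgroup.zpowers_le]
    have h1 : a₁ * (b ^ w)⁻¹ ∈ Subgroup.zpowers a₁ ⊔ Subgroup.zpowers b :=
      Subgroup.mul_mem _ (Subgroup.mem_sup_left (Subgroup.mem_zpowers _)) (Subgroup.inv_mem _
        (Subgroup.mem_sup_right (Subgroup.npow_mem_zpowers _ _)))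
    rwa [ha₁, mul_inv_cancel_right] at h1
  have hpow : a₁ ^ m = 1 := by
    obtain ⟨e, he⟩ := hws
    obtain ⟨f, hf⟩ := h.right_dvd_left
    have h1 : b ^ (w * m) = 1 := by
      rw [hf, ← mul_assoc, he, mul_assoc, pow_mul, h.pow_eq, ← pow_mul,
        ← orderOf_dvd_iff_pow_eq_one, h.orderOf_left, hf]
      exact Nat.mul_dvd_mul_left s (dvd_mul_left f e)
    have h2 : m ∣ z * ∑ i ∈ Finset.range m, (t ^ w) ^ i := by
      refine Dvd.dvd.mul_left ?_ z
      rw [← Int.natCast_dvd_natCast]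
      push_cast
      exact hS
    rw [ha₁, mul_pow_of_conj h.conj, h1, mul_one, ← orderOf_dvd_iff_pow_eq_one, h.orderOf_left]
    exact h2
  obtain ⟨e, he, h'⟩ := exists_genPair hconj hsup
  have hm : orderOf a₁ = m :=
    le_antisymm (Nat.le_of_dvd (Nat.pos_of_ne_zero h.left_ne_zero) (orderOf_dvd_of_pow_eq_one hpow))
      (hmin h')
  have hn : (Subgroup.zpowers a₁).index = n := by
    have h1 := h'.card_eq
    rw [h.card_eq, hm] at h1
    exact (Nat.eq_of_mul_eq_mul_left (Nat.pos_of_ne_zero h.left_ne_zero) h1).symm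
  rw [hm, hn, h.index_right] at h'
  exact ⟨_, h'⟩

variable {u : (ZMod m)ˣ}

/-- For a prime `p ∣ r`: a power `b ^ w` acts trivially on the `p'`-part of `⟨a⟩` as soon as `w`
is divisible by the `p`-part of `o` and by the `p'`-part of `n`. -/
theorem ordCompl_dvd_pow_sub_one (h : GenPair G a b m n s t) (hu : (u : ZMod m) = t) {p : ℕ}
    (hp : p ∈ (rInv (Subgroup.zpowers u)).primeFactors) {w : ℕ}
    (hw : p ^ (oInv (Subgroup.zpowers u)).factorization p ∣ w)
    (hw' : n / p ^ n.factorization p ∣ w) :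
    ((m / p ^ m.factorization p : ℕ) : ℤ) ∣ (t : ℤ) ^ w - 1 := by
  have hm := h.left_ne_zero
  have hn := h.index_ne_zero
  have hp' := Nat.prime_of_mem_primeFactors hp
  rw [natCast_dvd_iff_prime_pow]
  intro q l hq hql
  rcases Nat.eq_zero_or_pos l with rfl | hl
  · simp
  have hqlm : q ^ l ∣ m := hql.trans (Nat.ordCompl_dvd m p)
  have hqm : q ∣ m := (dvd_pow_self q hl.ne').trans hqlm
  have hqp : q ≠ p := by
    rintro rfl
    exact Nat.not_dvd_ordCompl hp' hm ((dvd_pow_self q hl.ne').trans hql)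
  by_cases hqr : q ∣ rInv (Subgroup.zpowers u)
  · have hqt := prime_dvd_sub_one hm hu hq hqr
    have h1 := pow_dvd_pow_factorization_sub_one (l := l) hq hn hqt
      (Dvd.dvd.trans (by exact_mod_cast hqlm) h.left_dvd_pow)
    have h2 : q ^ n.factorization q ∣ w := by
      refine Dvd.dvd.trans ?_ hw'
      exact dvd_ordCompl_of_coprime (Nat.ordProj_dvd n q)
        (Nat.Coprime.pow_left _ ((Nat.coprime_primes hq hp').mpr hqp))
    obtain ⟨k, rfl⟩ := h2
    rw [pow_mul]
    exact pow_sub_one_dvd h1 k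
  · have hqN : (q : ℤ) ^ l ∣ (piPart (nu (Subgroup.zpowers u) : Set ℕ) m : ℕ) := by
      have : q ^ l ∣ piPart (nu (Subgroup.zpowers u) : Set ℕ) m := by
        rw [pow_dvd_piPart_iff hm hq]
        refine Or.inr ⟨?_, hqlm⟩
        rw [nu, Finset.mem_coe, Finset.mem_sdiff]
        exact ⟨Nat.mem_primeFactors.mpr ⟨hq, hqm, hm⟩, fun h => hqr (Nat.dvd_of_mem_primeFactors h)⟩
      exact_mod_cast this
    refine hqN.trans (orderOf_natCast_dvd_iff.mp ?_)
    have hNm : piPart (nu (Subgroup.zpowers u) : Set ℕ) m ∣ m := piPart_dvd _ hm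
    have hO := factorization_oInv_natCast hm hu hp
    have hO0 := orderOf_natCast_ne_zero hm hNm hu
    have hOn : orderOf (t : ZMod (piPart (nu (Subgroup.zpowers u) : Set ℕ) m)) ∣ n :=
      orderOf_natCast_dvd_iff.mpr ((Int.natCast_dvd_natCast.mpr hNm).trans h.left_dvd_pow)
    rw [← Int.natCast_dvd_natCast]
    refine dvd_of_ordProj_of_ordCompl hp' hO0 ?_ ?_
    · rw [← hO]
      exact_mod_cast hw
    · refine Int.natCast_dvd_natCast.mpr (Dvd.dvd.trans ?_ hw')
      exact dvd_ordCompl_of_coprime ((Nat.ordCompl_dvd _ p).trans hOn)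
        (Nat.coprime_ordCompl hp' hO0).symm

/-- A change of the action at a prime `p ∣ r` to that of `b ^ k`, where `k` is trivial modulo the
`p`-part of `o`: then `b` is replaced by `b ^ y`, with `y ≡ k` at `p` and `y ≡ 1` elsewhere. -/
theorem exists_change_right (h : GenPair G a b m n s t) (hu : (u : ZMod m) = t) {p : ℕ}
    (hp : p ∈ (rInv (Subgroup.zpowers u)).primeFactors) {t₁ k : ℕ}
    (ht' : ((m / p ^ m.factorization p : ℕ) : ℤ) ∣ t₁ - t) (hk : ¬ p ∣ k)
    (hkω : p ^ (oInv (Subgroup.zpowers u)).factorization p ∣ k - 1)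
    (hkt : (p : ℤ) ^ m.factorization p ∣ t₁ - (t : ℤ) ^ k) :
    ∃ a' b' : G, GenPair G a' b' m n s t₁ := by
  have hm := h.left_ne_zero
  have hn := h.index_ne_zero
  have hnm : n * m ≠ 0 := mul_ne_zero hn hm
  have hp' := Nat.prime_of_mem_primeFactors hp
  have hpr := Nat.dvd_of_mem_primeFactors hp
  have hpm : p ∣ m := hpr.trans (rInv_dvd hm _)
  have hk0 : 1 ≤ k := Nat.one_le_iff_ne_zero.mpr fun h0 => hk (h0 ▸ dvd_zero p)
  have hcop : Nat.Coprime (p ^ (n * m).factorization p) (n * m / p ^ (n * m).factorization p) :=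
    Nat.Coprime.pow_left _ (Nat.coprime_ordCompl hp' hnm)
  obtain ⟨y, hy1, hy2⟩ := Nat.chineseRemainder hcop k 1
  have hfac : (n * m).factorization p = n.factorization p + m.factorization p := by
    rw [Nat.factorization_mul hn hm, Finsupp.add_apply]
  have hm1 : 1 ≤ m.factorization p := (hp'.dvd_iff_one_le_factorization hm).mp hpm
  have hyp : ¬ p ∣ y := by
    intro hpy
    have h1 : y ≡ k [MOD p] := hy1.of_dvd (dvd_pow_self p (by omega))
    exact hk ((h1.dvd_iff dvd_rfl).mp hpy)
  have hyc : y.Coprime (n * m) := by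
    rw [← Nat.ordProj_mul_ordCompl_eq_self (n * m) p]
    refine Nat.Coprime.mul_right (Nat.Coprime.pow_right _ ?_) ?_
    · exact ((Nat.Prime.coprime_iff_not_dvd hp').mpr hyp).symm
    · have := hy2.gcd_eq
      rw [Nat.gcd_one_left] at this
      exact this
  have hy0 : 1 ≤ y := Nat.one_le_iff_ne_zero.mpr fun h0 => hyp (h0 ▸ dvd_zero p)
  refine ⟨_, _, (h.pow hyc).congr ?_⟩
  rw [Nat.modEq_iff_dvd, Nat.cast_pow]
  have hpt := prime_dvd_sub_one hm hu hp' hpr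
  have hpm' : (p : ℤ) ^ m.factorization p ∣ m := by exact_mod_cast Nat.ordProj_dvd m p
  -- Exponents only matter modulo any period of `t` modulo `N`.
  have hord : ∀ N w : ℕ, (N : ℤ) ∣ (t : ℤ) ^ w - 1 → ∀ i j : ℕ, i ≡ j [MOD w] →
      (N : ℤ) ∣ (t : ℤ) ^ i - (t : ℤ) ^ j := by
    intro N w hw i j hij
    rw [← ZMod.intCast_zmod_eq_zero_iff_dvd] at hw ⊢
    push_cast at hw ⊢
    rw [sub_eq_zero] at hw ⊢
    exact pow_eq_pow_of_modEq hij hw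
  refine dvd_of_ordProj_of_ordCompl hp' hm ?_ ?_
  · have h1 := pow_dvd_pow_factorization_sub_one hp' hn hpt (hpm'.trans h.left_dvd_pow)
    have h2 := hord (p ^ m.factorization p) _ (by exact_mod_cast h1) k y
      (hy1.symm.of_dvd (pow_dvd_pow p (by omega)))
    push_cast at h2
    simpa using dvd_add hkt h2
  · have h1 := h.ordCompl_dvd_pow_sub_one hu hp (w := y - 1) ?_ ?_
    · have h2 : (t : ℤ) ^ y - t = t * ((t : ℤ) ^ (y - 1) - 1) := by
        rw [mul_sub, ← pow_succ', Nat.sub_add_cancel hy0, mul_one]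
      have h3 := dvd_sub ht' (h1.mul_left (t : ℤ))
      rw [← h2] at h3
      exact h3.trans (dvd_of_eq (by ring))
    · have hω : (oInv (Subgroup.zpowers u)).factorization p ≤ n.factorization p := by
        have hNm : piPart (nu (Subgroup.zpowers u) : Set ℕ) m ∣ m := piPart_dvd _ hm
        rw [factorization_oInv_natCast hm hu hp]
        refine (Nat.factorization_le_iff_dvd (orderOf_natCast_ne_zero hm hNm hu) hn).mpr ?_ p
        exact orderOf_natCast_dvd_iff.mpr ((Int.natCast_dvd_natCast.mpr hNm).trans h.left_dvd_pow)
      rw [← Nat.modEq_iff_dvd' hk0] at hkω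
      rw [← Nat.modEq_iff_dvd' hy0]
      exact hkω.trans (hy1.symm.of_dvd (pow_dvd_pow p (by omega)))
    · rw [← Nat.modEq_iff_dvd' hy0]
      exact hy2.symm.of_dvd (dvd_ordCompl_of_coprime
        ((Nat.ordCompl_dvd _ p).trans (Nat.dvd_mul_right n m)) (Nat.coprime_ordCompl hp' hn).symm)

end GenPair

/-! ### Changing the action at one prime -/

namespace GenPair

variable {G : Type*} [Group G] [Finite G] {a b : G} {m n s t : ℕ} {u : (ZMod m)ˣ}

/-- A change of the action at a prime `p ∣ r` by replacing `a` by a product `a ^ z * b ^ w`, where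
`z` is `1` modulo the `p'`-part of `m` and `b ^ w` is trivial on the `p'`-part of `⟨a⟩`. The
hypotheses only concern `p`-parts. -/
theorem exists_change_left_at (h : GenPair G a b m n s t)
    (hmin : ∀ {a' b' : G} {m' n' s' t' : ℕ}, GenPair G a' b' m' n' s' t' → m ≤ m')
    (hu : (u : ZMod m) = t) {p : ℕ} (hp : p ∈ (rInv (Subgroup.zpowers u)).primeFactors)
    {t₁ α z w : ℕ} (ht' : ((m / p ^ m.factorization p : ℕ) : ℤ) ∣ t₁ - t)
    (hα : (oInv (Subgroup.zpowers u)).factorization p ≤ α)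
    (hw : w = p ^ α * (n / p ^ n.factorization p * (m / p ^ m.factorization p))) (hz : ¬ p ∣ z)
    {c : ℤ} (hc : (p : ℤ) ^ α * (m / p ^ m.factorization p : ℕ) * (1 - t₁) =
      (p : ℤ) ^ n.factorization p * c)
    (hE : (p : ℤ) ^ m.factorization p ∣
      z * (t - ∑ i ∈ Finset.range t₁, ((t : ℤ) ^ w) ^ i) + s * c)
    (hws : n.factorization p ≤ α + s.factorization p) :
    ∃ a' b' : G, GenPair G a' b' m n s t₁ := by
  have hm := h.left_ne_zero
  have hn := h.index_ne_zero
  have hp' := Nat.prime_of_mem_primeFactors hp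
  have hpr := Nat.dvd_of_mem_primeFactors hp
  have hpm : p ∣ m := hpr.trans (rInv_dvd hm _)
  have hm1 : 1 ≤ m.factorization p := (hp'.dvd_iff_one_le_factorization hm).mp hpm
  set M := m / p ^ m.factorization p with hM
  set N := n / p ^ n.factorization p with hN
  have hmM : p ^ m.factorization p * M = m := Nat.ordProj_mul_ordCompl_eq_self m p
  have hnN : p ^ n.factorization p * N = n := Nat.ordProj_mul_ordCompl_eq_self n p
  have hpM : Nat.Coprime p M := Nat.coprime_ordCompl hp' hm
  have hcw : (w : ℤ) * (1 - t₁) = n * c := by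
    have h1 : (n : ℤ) = (p : ℤ) ^ n.factorization p * N := by exact_mod_cast hnN.symm
    rw [h1, hw]
    push_cast
    linear_combination (N : ℤ) * hc
  -- The exponent `z` only matters at `p`; elsewhere it is taken to be `1`.
  obtain ⟨z', hz1, hz2⟩ := Nat.chineseRemainder (Nat.Coprime.pow_left (m.factorization p) hpM) z 1
  have hzm : z'.Coprime m := by
    rw [← hmM]
    refine Nat.Coprime.mul_right (Nat.Coprime.pow_right _ (Nat.Coprime.symm ?_)) ?_
    · rw [hp'.coprime_iff_not_dvd, (hz1.of_dvd (dvd_pow_self p (by omega))).dvd_iff dvd_rfl]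
      exact hz
    · have := hz2.gcd_eq
      rw [Nat.gcd_one_left] at this
      exact this
  have htw : (M : ℤ) ∣ (t : ℤ) ^ w - 1 := h.ordCompl_dvd_pow_sub_one hu hp
    ((pow_dvd_pow p hα).trans (hw ▸ Nat.dvd_mul_right _ _))
    (hw ▸ (Nat.dvd_mul_right _ _).trans (Nat.dvd_mul_left _ _))
  have hpt := pow_sub_one_dvd (prime_dvd_sub_one hm hu hp' hpr) w
  have key : ∃ a' : G, GenPair G a' b m n s t₁ := by
    refine h.exists_change_left hmin hzm hcw ?_ ?_ ?_
    · refine dvd_of_ordProj_of_ordCompl hp' hm ?_ ?_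
      · have h1 : (p : ℤ) ^ m.factorization p ∣ (z' : ℤ) - z := by
          have := Nat.modEq_iff_dvd.mp hz1.symm
          exact_mod_cast this
        have h2 := dvd_add hE (h1.mul_right (t - ∑ i ∈ Finset.range t₁, ((t : ℤ) ^ w) ^ i))
        exact h2.trans (dvd_of_eq (by ring))
      · have hMc : (M : ℤ) ∣ c := by
          refine IsCoprime.dvd_of_dvd_mul_left (IsCoprime.pow_right (n := n.factorization p)
            (Nat.isCoprime_iff_coprime.mpr hpM.symm)) ?_
          rw [← hc]
          exact (Dvd.intro_left _ rfl : (M : ℤ) ∣ (p : ℤ) ^ α * M).mul_right _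
        have h1 := geom_sum_sub_dvd htw t₁
        have h2 := dvd_sub (hMc.mul_left (s : ℤ)) ((dvd_add h1 ht').mul_left (z' : ℤ))
        exact h2.trans (dvd_of_eq (by ring))
    · refine dvd_of_ordProj_of_ordCompl hp' hm (pow_dvd_geom_sum hpt (Nat.ordProj_dvd m p)) ?_
      have hMm : (M : ℤ) ∣ m := Int.natCast_dvd_natCast.mpr (Nat.ordCompl_dvd m p)
      exact (dvd_add (geom_sum_sub_dvd htw m) hMm).trans (dvd_of_eq (by ring))
    · rw [hw]
      have h1 : p ^ n.factorization p ∣ p ^ α * s := by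
        refine (pow_dvd_pow p hws).trans ?_
        rw [pow_add]
        exact Nat.mul_dvd_mul_left _ (Nat.ordProj_dvd s p)
      have h2 : p ^ α * (N * M) * s = p ^ α * s * N * M := by ring
      rw [h2, ← hnN]
      exact (Nat.mul_dvd_mul_right h1 N).mul_right M
  obtain ⟨a', h'⟩ := key
  exact ⟨a', b, h'⟩

/-- The arithmetic behind a change of the first factor at a prime `p ∣ r` with `ε ^ (p - 1) = 1`.
Here `δ` is the order of `t₁ - t` at `p`, and both terms of the sum in the last clause are exactly
divisible by `p ^ δ`. -/
theorem exists_change_data {p : ℕ} (hp' : p.Prime) {t t₁ s M w ρ δ μ η σ α : ℕ} (h1 : 1 ≤ ρ)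
    (h5 : p = 2 → 2 ≤ ρ) (h3 : (p : ℤ) ^ ρ ∣ t - 1) (ht₁ : (p : ℤ) ^ ρ ∣ t₁ - 1)
    (hex' : ¬ (p : ℤ) ^ (ρ + 1) ∣ t₁ - 1) (hρδ : ρ ≤ δ) (hσδ : σ ≤ δ) (hδμ : δ < μ)
    (hδ : (p : ℤ) ^ δ ∣ t₁ - t) (hδ' : ¬ (p : ℤ) ^ (δ + 1) ∣ t₁ - t) (hsσ : p ^ σ ∣ s)
    (hsσ' : ¬ p ^ (σ + 1) ∣ s) (hpM : ¬ p ∣ M) (hα : α + ρ = η + (δ - σ)) (hδα : δ ≤ ρ + α)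
    (hw : p ^ α ∣ w) :
    ∃ (z : ℕ) (c : ℤ), ¬ p ∣ z ∧
      (p : ℤ) ^ α * M * (1 - t₁) = (p : ℤ) ^ η * c ∧
      (p : ℤ) ^ μ ∣ z * (t - ∑ i ∈ Finset.range t₁, ((t : ℤ) ^ w) ^ i) + s * c := by
  have hpZ := Nat.prime_iff_prime_int.mp hp'
  obtain ⟨k, hk⟩ := ht₁
  have hk' : ¬ (p : ℤ) ∣ k := by
    intro h
    rw [hk, pow_succ, mul_dvd_mul_iff_left (pow_ne_zero _ hpZ.ne_zero)] at hex'
    exact hex' h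
  have hc : (p : ℤ) ^ α * (M : ℕ) * (1 - t₁) = (p : ℤ) ^ η * (-(p : ℤ) ^ (δ - σ) * M * k) := by
    have h6 : (1 : ℤ) - t₁ = -((p : ℤ) ^ ρ * k) := by rw [← hk]; ring
    have h7 : (p : ℤ) ^ α * (p : ℤ) ^ ρ = (p : ℤ) ^ η * (p : ℤ) ^ (δ - σ) := by
      rw [← pow_add, ← pow_add, hα]
    rw [h6]
    linear_combination (-(M : ℤ) * k) * h7
  have htw : (p : ℤ) ^ δ ∣ (t : ℤ) ^ w - 1 :=
    (pow_dvd_pow _ (by omega)).trans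
      (pow_dvd_pow_sub_one h1 h3 (hw))
  have hS : (p : ℤ) ^ (δ + 1) ∣ ∑ i ∈ Finset.range t₁, ((t : ℤ) ^ w) ^ i - t₁ := by
    refine pow_succ_dvd_geom_sum_sub hp' (by omega) htw ?_ ?_
    · rw [hk]
      exact (dvd_pow_self (p : ℤ) (by omega)).mul_right k
    · rintro rfl
      rw [hk]
      exact Dvd.dvd.mul_right ((pow_dvd_pow (2 : ℤ) (h5 rfl))) k
  have hA : (p : ℤ) ^ δ ∣ ∑ i ∈ Finset.range t₁, ((t : ℤ) ^ w) ^ i - t := by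
    have h6 := dvd_add ((pow_dvd_pow (p : ℤ) (Nat.le_succ δ)).trans hS) hδ
    simpa using h6
  have hA' : ¬ (p : ℤ) ^ (δ + 1) ∣ ∑ i ∈ Finset.range t₁, ((t : ℤ) ^ w) ^ i - t := by
    intro h6
    exact hδ' (by simpa using dvd_sub h6 hS)
  obtain ⟨s', rfl⟩ := hsσ
  have hsp : ¬ p ∣ s' := fun h => hsσ' (by
    rw [pow_succ]
    exact Nat.mul_dvd_mul_left _ h)
  have hsc : ((p ^ σ * s' : ℕ) : ℤ) * (-(p : ℤ) ^ (δ - σ) * M * k) =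
      (p : ℤ) ^ δ * (-(s' : ℤ) * M * k) := by
    have h6 : (p : ℤ) ^ δ = (p : ℤ) ^ σ * (p : ℤ) ^ (δ - σ) := by
      rw [← pow_add]
      congr 1
      omega
    push_cast
    rw [h6]
    ring
  have hC' : ¬ (p : ℤ) ^ (δ + 1) ∣ ((p ^ σ * s' : ℕ) : ℤ) * (-(p : ℤ) ^ (δ - σ) * M * k) := by
    rw [hsc, pow_succ, mul_dvd_mul_iff_left (pow_ne_zero _ hpZ.ne_zero)]
    intro h6
    rcases hpZ.dvd_or_dvd h6 with h6 | h6
    · rcases hpZ.dvd_or_dvd h6 with h6 | h6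
      · rw [dvd_neg, Int.natCast_dvd_natCast] at h6
        exact hsp h6
      · rw [Int.natCast_dvd_natCast] at h6
        exact hpM h6
    · exact hk' h6
  obtain ⟨z, hz, hz'⟩ := exists_unit_dvd_mul_sub hp' hA hA' (hsc ▸ Dvd.intro _ rfl) hC' hδμ
  refine ⟨z, _, hz, hc, ?_⟩
  rw [← dvd_neg]
  exact hz'.trans (dvd_of_eq (by ring))

/-- The change of the action at a prime `p ∣ r` with `ε ^ (p - 1) = 1`: a change of `b` if `t₁` and
`t` agree modulo `p ^ (ρ + ω)`, and a change of `a` otherwise. -/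
theorem exists_change_at_pos (h : GenPair G a b m n s t)
    (hmin : ∀ {a' b' : G} {m' n' s' t' : ℕ}, GenPair G a' b' m' n' s' t' → m ≤ m')
    (hu : (u : ZMod m) = t) {p : ℕ} (hp : p ∈ (rInv (Subgroup.zpowers u)).primeFactors)
    (hε : epsInv (Subgroup.zpowers u) ^ (p - 1) = 1)
    {t₁ : ℕ} (ht' : ((m / p ^ m.factorization p : ℕ) : ℤ) ∣ t₁ - t)
    (hmod : (p : ℤ) ^ modExp (Subgroup.zpowers u) n s p ∣ t₁ - t)
    (hex : (rInv (Subgroup.zpowers u)).factorization p < m.factorization p →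
      ¬ TrivialAt t₁ p ((rInv (Subgroup.zpowers u)).factorization p + 1)) :
    ∃ a' b' : G, GenPair G a' b' m n s t₁ := by
  have hm := h.left_ne_zero
  have hn := h.index_ne_zero
  have hs := h.right_ne_zero
  have hp' := Nat.prime_of_mem_primeFactors hp
  have hpZ := Nat.prime_iff_prime_int.mp hp'
  have hpr := Nat.dvd_of_mem_primeFactors hp
  by_cases hμ : (p : ℤ) ^ m.factorization p ∣ t₁ - t
  · refine ⟨a, b, h.congr (Nat.modEq_iff_dvd.mpr ?_)⟩
    exact dvd_of_ordProj_of_ordCompl hp' hm hμ ht'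
  obtain ⟨h1, h2, h3, h4⟩ := positive_case hm hu hp' hpr hε
  have he : modExp (Subgroup.zpowers u) n s p = _ := if_pos hε
  have heμ : modExp (Subgroup.zpowers u) n s p < m.factorization p := by
    by_contra hle
    exact hμ ((pow_dvd_pow _ (not_lt.mp hle)).trans hmod)
  set ρ := (rInv (Subgroup.zpowers u)).factorization p with hρ
  set ω := (oInv (Subgroup.zpowers u)).factorization p with hω
  set μ := m.factorization p with hμ'
  set η := n.factorization p with hη
  set σ := s.factorization p with hσ
  clear_value ρ ω μ η σ
  have hρμ : ρ < μ := by omega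
  obtain ⟨h4, h5⟩ := h4 hρμ
  have hex' : ¬ (p : ℤ) ^ (ρ + 1) ∣ t₁ - 1 := fun h => hex hρμ (Or.inl h)
  have ht₁ : (p : ℤ) ^ ρ ∣ t₁ - 1 := by
    have := dvd_add ((pow_dvd_pow (p : ℤ) (by omega)).trans hmod) h3
    simpa using this
  by_cases hωρ : (p : ℤ) ^ (ρ + ω) ∣ t₁ - t
  · -- `t₁` is a power of `t` at `p`, with an exponent that is trivial modulo `p ^ ω`.
    obtain ⟨k, hk⟩ := exists_pow_sub_dvd hp' h1 h5 h3 h4 ht₁ (μ - ρ)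
    rw [Nat.add_sub_cancel' h2] at hk
    have hpk : ¬ p ∣ k := by
      intro h
      rw [← pow_one p, ← pow_dvd_pow_sub_one_iff hp' h1 h5 h3 h4] at h
      have := dvd_add ((pow_dvd_pow (p : ℤ) (by omega : ρ + 1 ≤ μ)).trans hk) h
      exact hex' (by simpa using this)
    have hk0 : 1 ≤ k := Nat.one_le_iff_ne_zero.mpr fun h0 => hpk (h0 ▸ dvd_zero p)
    refine h.exists_change_right hu hp (hμ' ▸ ht') hpk ?_ (hμ' ▸ hk)
    rw [← hω, ← pow_dvd_pow_sub_one_iff hp' h1 h5 h3 h4]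
    have hlt : ρ + ω ≤ μ := by
      by_contra hlt
      exact hμ ((pow_dvd_pow _ (by omega)).trans hωρ)
    have h6 : (p : ℤ) ^ (ρ + ω) ∣ t * ((t : ℤ) ^ (k - 1) - 1) := by
      have h7 := dvd_sub hωρ ((pow_dvd_pow (p : ℤ) hlt).trans hk)
      rw [mul_sub, ← pow_succ', Nat.sub_add_cancel hk0, mul_one]
      exact h7.trans (dvd_of_eq (by ring))
    refine IsCoprime.dvd_of_dvd_mul_left (IsCoprime.pow_left ?_) h6
    refine hpZ.coprime_iff_not_dvd.mpr fun h7 => ?_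
    have h8 := dvd_sub h7 ((dvd_pow_self (p : ℤ) (by omega)).trans h3)
    rw [sub_sub_cancel] at h8
    exact hpZ.not_isUnit (isUnit_of_dvd_one h8)
  · have heω : modExp (Subgroup.zpowers u) n s p < ρ + ω := by
      by_contra hle
      exact hωρ ((pow_dvd_pow _ (not_lt.mp hle)).trans hmod)
    -- The order `δ` of `t₁ - t` at `p`.
    have hne : (t₁ : ℤ) - t ≠ 0 := fun h0 => hμ (h0 ▸ dvd_zero _)
    obtain ⟨δ, hδ, hδ'⟩ : ∃ δ, (p : ℤ) ^ δ ∣ (t₁ : ℤ) - t ∧ ¬ (p : ℤ) ^ (δ + 1) ∣ (t₁ : ℤ) - t := by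
      have hfin : FiniteMultiplicity (p : ℤ) (t₁ - t) :=
        Int.finiteMultiplicity_iff.mpr ⟨by simpa using hp'.ne_one, hne⟩
      exact ⟨multiplicity (p : ℤ) (t₁ - t), pow_multiplicity_dvd _ _,
        hfin.not_pow_dvd_of_multiplicity_lt (Nat.lt_succ_self _)⟩
    have hδμ : δ < μ := by
      by_contra hle
      exact hμ ((pow_dvd_pow _ (not_lt.mp hle)).trans hδ)
    have heδ : modExp (Subgroup.zpowers u) n s p ≤ δ := by
      by_contra hlt
      exact hδ' ((pow_dvd_pow _ (not_le.mp hlt)).trans hmod)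
    obtain ⟨M, hM⟩ : ∃ M, M = m / p ^ μ := ⟨_, rfl⟩
    have hpM : ¬ p ∣ M := by
      rw [hM, hμ']
      exact Nat.not_dvd_ordCompl hp' hm
    -- With this `α`, the number `s * (w * (1 - t₁) / n)` has order `δ` at `p`, as does `t₁ - t`.
    obtain ⟨α, hα⟩ : ∃ α, α = η - σ + (δ - ρ) := ⟨_, rfl⟩
    obtain ⟨w, hw⟩ : ∃ w, w = p ^ α * (n / p ^ η * M) := ⟨_, rfl⟩
    obtain ⟨hρδ, hσδ, hωδ, hση⟩ : ρ ≤ δ ∧ σ ≤ δ ∧ ρ + σ + ω ≤ δ + η ∧ σ < η := by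
      obtain ⟨i1, i2, i3, i4⟩ := le_of_locExp_lt he heμ heω
      exact ⟨i1.trans heδ, i2.trans heδ, i3.trans (Nat.add_le_add_right heδ _), i4⟩
    clear he heμ heω heδ
    have hα1 : α + ρ = η + (δ - σ) := by omega
    have hα2 : δ ≤ ρ + α := by omega
    have hα3 : ω ≤ α := by omega
    have hα4 : η ≤ α + σ := by omega
    have hsσ : p ^ σ ∣ s := hσ ▸ Nat.ordProj_dvd s p
    have hsσ' : ¬ p ^ (σ + 1) ∣ s := hσ ▸ Nat.pow_succ_factorization_not_dvd hs hp'
    obtain ⟨z, c, hz, hc, hE⟩ := exists_change_data hp' h1 h5 h3 ht₁ hex' hρδ hσδ hδμ hδ hδ' hsσ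
      hsσ' hpM hα1 hα2 (hw ▸ Nat.dvd_mul_right (p ^ α) _)
    subst hμ' hη hσ hω hM
    exact h.exists_change_left_at hmin hu hp ht' hα3 hw hz hc hE hα4

/-- The change of the action at the prime `2` when `ε = -1`. If `a` has to be changed, then `t₁`
and `t` differ by half the `2`-part of `m`, and `b ^ w` is taken with `w` half of `n` at the prime
`2`. -/
theorem exists_change_at_neg (h : GenPair G a b m n s t)
    (hmin : ∀ {a' b' : G} {m' n' s' t' : ℕ}, GenPair G a' b' m' n' s' t' → m ≤ m')
    (hu : (u : ZMod m) = t) (hp : 2 ∈ (rInv (Subgroup.zpowers u)).primeFactors)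
    (hε : epsInv (Subgroup.zpowers u) ≠ 1)
    {t₁ : ℕ} (ht' : ((m / 2 ^ m.factorization 2 : ℕ) : ℤ) ∣ t₁ - t)
    (hmod : (2 : ℤ) ^ modExp (Subgroup.zpowers u) n s 2 ∣ t₁ - t)
    (hex : (rInv (Subgroup.zpowers u)).factorization 2 < m.factorization 2 →
      ¬ TrivialAt t₁ 2 ((rInv (Subgroup.zpowers u)).factorization 2 + 1)) :
    ∃ a' b' : G, GenPair G a' b' m n s t₁ := by
  have hm := h.left_ne_zero
  have hn := h.index_ne_zero
  have hs := h.right_ne_zero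
  have hp' := Nat.prime_two
  by_cases hμ : (2 : ℤ) ^ m.factorization 2 ∣ t₁ - t
  · refine ⟨a, b, h.congr (Nat.modEq_iff_dvd.mpr ?_)⟩
    exact dvd_of_ordProj_of_ordCompl hp' hm (by exact_mod_cast hμ) ht'
  obtain ⟨h1, h2, h3, h4⟩ := negative_case hm hu hε
  have hε' : ¬ epsInv (Subgroup.zpowers u) ^ (2 - 1) = 1 := by simpa using hε
  have he : modExp (Subgroup.zpowers u) n s 2 = _ := if_neg hε'
  have heμ : modExp (Subgroup.zpowers u) n s 2 < m.factorization 2 := by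
    by_contra hle
    exact hμ ((pow_dvd_pow _ (not_lt.mp hle)).trans hmod)
  have hρe : (rInv (Subgroup.zpowers u)).factorization 2 ≤ modExp (Subgroup.zpowers u) n s 2 :=
    le_locExp h2
  set ρ := (rInv (Subgroup.zpowers u)).factorization 2 with hρ
  set ω := (oInv (Subgroup.zpowers u)).factorization 2 with hω
  set μ := m.factorization 2 with hμ'
  set η := n.factorization 2 with hη
  set σ := s.factorization 2 with hσ
  clear_value ρ ω μ η σ
  have hρμ : ρ < μ := by omega
  have h4 := h4 hρμ
  have hex' : ¬ (2 : ℤ) ^ (ρ + 1) ∣ t₁ + 1 := fun h => hex hρμ (trivialAt_two.mpr (Or.inr h))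
  have ht₁ : (2 : ℤ) ^ ρ ∣ t₁ + 1 := by
    have := dvd_add ((pow_dvd_pow (2 : ℤ) hρe).trans hmod) h3
    exact this.trans (dvd_of_eq (by ring))
  have hμm : (2 : ℤ) ^ μ ∣ m := by
    rw [hμ']
    exact_mod_cast Nat.ordProj_dvd m 2
  have h44 : (4 : ℤ) ∣ t₁ + 1 := (pow_dvd_pow (2 : ℤ) h1).trans ht₁
  have hn2 := h.even_index h1 ((pow_dvd_pow 2 h2).trans (hμ' ▸ Nat.ordProj_dvd m 2)) h3
  by_cases hcase : ω ≤ 1 ∨ μ ≤ ρ + 1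
  · rw [if_pos hcase] at he
    have hρμ2 : ¬ μ ≤ ρ + 1 := by
      intro hle
      -- Both `t + 1` and `t₁ + 1` are exactly divisible by `2 ^ ρ`.
      have h5 := dvd_sub (two_pow_dvd_sub ht₁ hex') (two_pow_dvd_sub h3 h4)
      exact hμ ((pow_dvd_pow _ hle).trans (h5.trans (dvd_of_eq (by ring))))
    have hω1 : ω ≤ 1 := hcase.resolve_right hρμ2
    -- `t₁` is an odd power of `t`, since `-t₁` is a power of `-t`.
    have e1 : ∀ v : ℤ, -v - 1 = -(v + 1) := fun v => by ring
    obtain ⟨k, hk⟩ := exists_pow_sub_dvd (p := 2) (q := -t) (v := -t₁) (ρ := ρ) hp' (by omega)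
      (fun _ => h1) (by rw [e1, dvd_neg]; exact_mod_cast h3)
      (by rw [e1, dvd_neg]; exact_mod_cast h4) (by rw [e1, dvd_neg]; exact_mod_cast ht₁) (μ - ρ)
    rw [Nat.add_sub_cancel' h2] at hk
    have hkodd : Odd k := by
      rw [← Nat.not_even_iff_odd]
      intro hk2
      have h5 := two_pow_dvd_pow_sub_one (k := 1) (by omega) h3 hk2
        (by simpa using even_iff_two_dvd.mp hk2)
      rw [hk2.neg_pow] at hk
      have h6 := dvd_add ((pow_dvd_pow (2 : ℤ) (by omega : ρ + 1 ≤ μ)).trans hk) h5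
      refine hex' ?_
      rw [← dvd_neg]
      exact h6.trans (dvd_of_eq (by ring))
    rw [hkodd.neg_pow] at hk
    subst hμ'
    refine h.exists_change_right hu hp ht' (k := k) ?_ ?_ ?_
    · rw [← even_iff_two_dvd, Nat.not_even_iff_odd]
      exact hkodd
    · rw [← hω]
      refine (pow_dvd_pow 2 hω1).trans ?_
      rw [pow_one, ← even_iff_two_dvd]
      exact Nat.Odd.sub_odd hkodd odd_one
    · rw [← dvd_neg]
      refine Dvd.dvd.trans ?_ (dvd_of_eq (by ring : -(t₁ : ℤ) - -(t : ℤ) ^ k = _))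
      exact_mod_cast hk
  · rw [if_neg hcase] at he
    split_ifs at he with hcase2
    swap
    · omega
    obtain ⟨hω2, hωη, hρμ2, hσμ⟩ := hcase2
    have hσle : σ ≤ μ := by
      rw [hσ, hμ']
      exact (Nat.factorization_le_iff_dvd hs hm).mpr h.right_dvd_left 2
    have hμηρ : μ ≤ ρ + η := by
      by_contra hlt
      have h5 := (two_pow_dvd_pow_sub_one_iff h1 h3 h4 hn2 (η + 1)).mp
        ((pow_dvd_pow _ (by omega)).trans (hμm.trans h.left_dvd_pow))
      rw [Nat.prime_two.pow_dvd_iff_le_factorization hn, ← hη] at h5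
      omega
    have hsσ : (2 : ℤ) ^ σ ∣ s := by
      rw [hσ]
      exact_mod_cast Nat.ordProj_dvd s 2
    have hsσ' : ¬ (2 : ℤ) ^ (σ + 1) ∣ s := by
      rw [hσ]
      exact_mod_cast Nat.pow_succ_factorization_not_dvd hs Nat.prime_two
    obtain ⟨M, hM⟩ : ∃ M, M = m / 2 ^ μ := ⟨_, rfl⟩
    obtain ⟨N, hN⟩ : ∃ N, N = n / 2 ^ η := ⟨_, rfl⟩
    obtain ⟨w, hw⟩ : ∃ w, w = 2 ^ (η - 1) * (N * M) := ⟨_, rfl⟩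
    have hMo' : ¬ 2 ∣ M := by
      rw [hM, hμ']
      exact Nat.not_dvd_ordCompl hp' hm
    have hNo : ¬ 2 ∣ N := by
      rw [hN, hη]
      exact Nat.not_dvd_ordCompl hp' hn
    have hMo : ¬ (2 : ℤ) ∣ M := by exact_mod_cast hMo'
    obtain ⟨v, hv⟩ : ∃ v : ℤ, (1 : ℤ) - t₁ = 2 * (2 * v + 1) := ⟨(1 - t₁ - 2) / 4, by omega⟩
    have hc : ((2 : ℕ) : ℤ) ^ (η - 1) * (M : ℕ) * (1 - t₁) =
        ((2 : ℕ) : ℤ) ^ η * (M * (2 * v + 1)) := by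
      have h5 : (2 : ℤ) ^ η = 2 ^ (η - 1) * 2 := by
        rw [← pow_succ]
        congr 1
        omega
      push_cast
      rw [hv, h5]
      ring
    have hw2 : Even w := by
      rw [hw]
      exact (even_two.pow_of_ne_zero (by omega)).mul_right _
    have hwη : 2 ^ (η - 1) ∣ w := hw ▸ Nat.dvd_mul_right _ _
    have hwη' : ¬ 2 ^ η ∣ w := by
      have h5 : 2 ^ η = 2 ^ (η - 1) * 2 := by
        rw [← pow_succ]
        congr 1
        omega
      rw [h5, hw, Nat.mul_dvd_mul_iff_left (by positivity)]
      intro h6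
      rcases hp'.dvd_or_dvd h6 with h6 | h6
      · exact hNo h6
      · exact hMo' h6
    have hD : (2 : ℤ) ^ μ ∣ t₁ - t - 2 ^ (μ - 1) := by
      have h5 := two_pow_dvd_sub (k := μ - 1) (z := t₁ - t)
        ((pow_dvd_pow _ (by omega)).trans hmod) (by rwa [Nat.sub_add_cancel (by omega)])
      rwa [Nat.sub_add_cancel (by omega)] at h5
    have hα1 : ω ≤ η - 1 := by omega
    have hα2 : η ≤ η - 1 + σ := by omega
    suffices hE : (2 : ℤ) ^ μ ∣ (1 : ℕ) * (t - ∑ i ∈ Finset.range t₁, ((t : ℤ) ^ w) ^ i) +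
        s * (M * (2 * v + 1)) by
      clear * - h hmin hu hp ht' hw hc hE hα1 hα2 hM hN hσ hω hμ' hη
      subst hμ' hη hσ hω hM hN
      exact h.exists_change_left_at hmin hu hp ht' hα1 hw (by omega) hc hE hα2
    rw [Nat.cast_one, one_mul]
    by_cases hσ1 : σ = η + ρ
    · -- Here `t ^ w` is `1 + m / 2` at the prime `2`.
      have h5 : (2 : ℤ) ^ (μ - 1 + 1) ∣ (t : ℤ) ^ w - 1 - 2 ^ (μ - 1) := by
        refine two_pow_dvd_sub ?_ ?_
        · exact (pow_dvd_pow _ (by omega)).trans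
            (two_pow_dvd_pow_sub_one (by omega) h3 hw2 hwη)
        · rw [show μ - 1 + 1 = ρ + η by omega, two_pow_dvd_pow_sub_one_iff h1 h3 h4 hw2]
          exact hwη'
      have h6 := two_pow_dvd_geom_sum (by omega) h5 (l := t₁) (by omega)
      rw [Nat.sub_add_cancel (by omega)] at h6
      have h7 : (2 : ℤ) ^ μ ∣ s * (M * (2 * v + 1)) :=
        ((pow_dvd_pow (2 : ℤ) (by omega)).trans hsσ).mul_right _
      have h8 : (2 : ℤ) ^ μ ∣ 2 ^ (μ - 1) * 2 := by
        rw [← pow_succ, Nat.sub_add_cancel (by omega)]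
      have h9 := dvd_sub (dvd_sub (dvd_sub h7 h6) hD) h8
      exact h9.trans (dvd_of_eq (by ring))
    · obtain ⟨hσμ1, hμlt⟩ := hσμ hσ1
      -- Here `t ^ w` is trivial and `s * c` is `m / 2` at the prime `2`.
      have h5 : (2 : ℤ) ^ μ ∣ (t : ℤ) ^ w - 1 :=
        (pow_dvd_pow _ (by omega)).trans (two_pow_dvd_pow_sub_one (by omega) h3 hw2 hwη)
      have h6 := geom_sum_sub_dvd h5 t₁
      have h7 : (2 : ℤ) ^ (σ + 1) ∣ s * (M * (2 * v + 1)) - 2 ^ σ := by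
        refine two_pow_dvd_sub (hsσ.mul_right _) fun h7 => hsσ' ?_
        refine IsCoprime.dvd_of_dvd_mul_right (IsCoprime.pow_left ?_) h7
        refine Int.prime_two.coprime_iff_not_dvd.mpr fun h8 => ?_
        rcases Int.prime_two.dvd_or_dvd h8 with h8 | h8
        · exact hMo h8
        · omega
      rw [hσμ1] at h7
      have h8 : σ = μ - 1 := by omega
      rw [h8] at h7
      exact (dvd_sub (dvd_sub h7 h6) hD).trans (dvd_of_eq (by ring))

end GenPair

/-! ### Completeness -/

section

variable {m n s t t' : ℕ} {u u' : (ZMod m)ˣ}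

/-- The invariant `r` only depends on the action modulo `r`. -/
theorem rInv_dvd_rInv (hm : m ≠ 0) (hu : (u : ZMod m) = t) (hu' : (u' : ZMod m) = t')
    (h : (rInv (Subgroup.zpowers u) : ℤ) ∣ t - t') :
    rInv (Subgroup.zpowers u) ∣ rInv (Subgroup.zpowers u') := by
  rw [dvd_rInv_iff hm hu' (rInv_dvd hm _)]
  intro p k hp hk
  refine ((pow_dvd_rInv_iff hm hu hp (hk.trans (rInv_dvd hm _))).mp hk).congr ?_
  exact (natCast_dvd_iff_prime_pow.mp h) p k hp hk

/-- The exponents of the modulus only depend on the action modulo the modulus. -/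
theorem modExp_eq_of_modulus_dvd (hm : m ≠ 0) (hu : (u : ZMod m) = t) (hu' : (u' : ZMod m) = t')
    (hr : rInv (Subgroup.zpowers u) = rInv (Subgroup.zpowers u'))
    (h : (modulus (Subgroup.zpowers u) n s : ℤ) ∣ t' - t) {p : ℕ}
    (hp : p ∈ (rInv (Subgroup.zpowers u)).primeFactors) :
    modExp (Subgroup.zpowers u) n s p = modExp (Subgroup.zpowers u') n s p := by
  refine GenPair.modExp_congr hm hu hu' hr (epsInv_congr hm hu hu' hr ?_) ?_ n s hp
  · have h1 : (2 : ℤ) ^ (rInv (Subgroup.zpowers u)).factorization 2 ∣ t' - t := by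
      refine Dvd.dvd.trans ?_ h
      exact_mod_cast (Nat.ordProj_dvd _ 2).trans (rInv_dvd_modulus hm (Subgroup.zpowers u) n s)
    rw [← dvd_add_right h1, sub_add_sub_cancel]
  · have h1 : (piPart (nu (Subgroup.zpowers u) : Set ℕ) m : ℤ) ∣ t' - t :=
      (Int.natCast_dvd_natCast.mpr (piPart_nu_dvd_modulus _ n s)).trans h
    exact GenPair.orderOf_natCast_eq (y := 1) (y₁ := 1) (by rwa [pow_one])
      (by rw [pow_one, ← dvd_neg, neg_sub]; exact h1)

end

namespace GenPair

variable {G : Type*} [Group G] [Finite G] {a b : G} {m n s t : ℕ} {u : (ZMod m)ˣ}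

/-- At a prime `p ∣ r`, the action of `b` may be replaced by any other one with the same invariants
which agrees with it modulo `[T, n, s]` and away from `p`. -/
theorem exists_change_at (h : GenPair G a b m n s t)
    (hmin : ∀ {a' b' : G} {m' n' s' t' : ℕ}, GenPair G a' b' m' n' s' t' → m ≤ m')
    (hu : (u : ZMod m) = t) {p : ℕ} (hp : p ∈ (rInv (Subgroup.zpowers u)).primeFactors)
    {t₁ : ℕ} (ht' : ((m / p ^ m.factorization p : ℕ) : ℤ) ∣ t₁ - t)
    (hmod : (p : ℤ) ^ modExp (Subgroup.zpowers u) n s p ∣ t₁ - t)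
    (hex : (rInv (Subgroup.zpowers u)).factorization p < m.factorization p →
      ¬ TrivialAt t₁ p ((rInv (Subgroup.zpowers u)).factorization p + 1)) :
    ∃ a' b' : G, GenPair G a' b' m n s t₁ := by
  by_cases hε : epsInv (Subgroup.zpowers u) ^ (p - 1) = 1
  · exact h.exists_change_at_pos hmin hu hp hε ht' hmod hex
  · obtain rfl : p = 2 := by
      by_contra hp2
      exact hε (eps_pow_eq_one (Nat.prime_of_mem_primeFactors hp) hp2)
    exact h.exists_change_at_neg hmin hu hp (by simpa using hε) ht' hmod hex

/-- The change of the action at all primes of a set `S` of primes dividing `r`, leaving the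
invariants unchanged. -/
theorem exists_change_on (h : GenPair G a b m n s t)
    (hmin : ∀ {a' b' : G} {m' n' s' t' : ℕ}, GenPair G a' b' m' n' s' t' → m ≤ m')
    (hu : (u : ZMod m) = t) {t' : ℕ} {u' : (ZMod m)ˣ} (hu' : (u' : ZMod m) = t')
    (hr : rInv (Subgroup.zpowers u') = rInv (Subgroup.zpowers u))
    (hmod : (modulus (Subgroup.zpowers u') n s : ℤ) ∣ t - t') (S : Finset ℕ)
    (hS : S ⊆ (rInv (Subgroup.zpowers u')).primeFactors) :
    ∃ (a₁ b₁ : G) (t₁ : ℕ) (u₁ : (ZMod m)ˣ), GenPair G a₁ b₁ m n s t₁ ∧ (u₁ : ZMod m) = t₁ ∧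
      rInv (Subgroup.zpowers u') = rInv (Subgroup.zpowers u₁) ∧
      (modulus (Subgroup.zpowers u') n s : ℤ) ∣ t₁ - t' ∧
      ∀ p ∈ S, (p : ℤ) ^ m.factorization p ∣ t₁ - t' := by
  have hm := h.left_ne_zero
  induction S using Finset.induction_on with
  | empty => exact ⟨a, b, t, u, h, hu, hr, hmod, by simp⟩
  | insert p S hpS ih =>
    rw [Finset.insert_subset_iff] at hS
    obtain ⟨hp, hS⟩ := hS
    obtain ⟨a₁, b₁, t₁, u₁, h₁, hu₁, hr₁, hmod₁, hS₁⟩ := ih hS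
    have hp' := Nat.prime_of_mem_primeFactors hp
    obtain ⟨t₂, ht₂, ht₂'⟩ := Nat.chineseRemainder
      (Nat.Coprime.pow_left (m.factorization p) (Nat.coprime_ordCompl hp' hm)) t' t₁
    have hd : (p : ℤ) ^ m.factorization p ∣ t₂ - t' := by
      exact_mod_cast Nat.modEq_iff_dvd.mp ht₂.symm
    have hd' : ((m / p ^ m.factorization p : ℕ) : ℤ) ∣ t₂ - t₁ := Nat.modEq_iff_dvd.mp ht₂'.symm
    -- Modulo a prime power divisor of `m`, the number `t₂` agrees with `t'` or with `t₁`.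
    have hcop : ∀ {q k : ℕ}, q.Prime → q ^ k ∣ m → q ≠ p → (q : ℤ) ^ k ∣ t₂ - t₁ := by
      intro q k hq hk hqp
      refine Dvd.dvd.trans ?_ hd'
      exact_mod_cast dvd_ordCompl_of_coprime hk
        (Nat.Coprime.pow_left k ((Nat.coprime_primes hq hp').mpr hqp))
    have hpow : ∀ {k : ℕ}, p ^ k ∣ m → (p : ℤ) ^ k ∣ t₂ - t' := fun hk =>
      (pow_dvd_pow _ ((hp'.pow_dvd_iff_le_factorization hm).mp hk)).trans hd
    have hmod₂ : (modulus (Subgroup.zpowers u') n s : ℤ) ∣ t₂ - t' := by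
      rw [natCast_dvd_iff_prime_pow]
      intro q k hq hk
      have hkm := hk.trans (modulus_dvd hm _ n s)
      rcases eq_or_ne q p with rfl | hqp
      · exact hpow hkm
      · have h1 := dvd_add (hcop hq hkm hqp) (natCast_dvd_iff_prime_pow.mp hmod₁ q k hq hk)
        rwa [sub_add_sub_cancel] at h1
    have hmod' : (modulus (Subgroup.zpowers u') n s : ℤ) ∣ t₁ - t₂ := by
      have h1 := dvd_sub hmod₁ hmod₂
      rwa [sub_sub_sub_cancel_right] at h1
    obtain ⟨a₂, b₂, h₂⟩ : ∃ a₂ b₂ : G, GenPair G a₂ b₂ m n s t₂ := by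
      refine h₁.exists_change_at hmin hu₁ (hr₁ ▸ hp) hd' ?_ fun hlt htr => ?_
      · rw [← modExp_eq_of_modulus_dvd hm hu' hu₁ hr₁ hmod₁ hp, ← dvd_neg, neg_sub]
        exact (pow_dvd_modulus hm _ n s hp).trans hmod'
      · rw [← hr₁] at hlt htr
        have hdm : p ^ ((rInv (Subgroup.zpowers u')).factorization p + 1) ∣ m :=
          (hp'.pow_dvd_iff_le_factorization hm).mpr hlt
        have h1 := (pow_dvd_rInv_iff hm hu' hp' hdm).mpr (htr.congr (hpow hdm))
        exact Nat.pow_succ_factorization_not_dvd (rInv_ne_zero hm _) hp' h1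
    obtain ⟨u₂, hu₂⟩ := h₂.exists_unit
    refine ⟨a₂, b₂, t₂, u₂, h₂, hu₂, Nat.dvd_antisymm ?_ ?_, hmod₂, ?_⟩
    · refine rInv_dvd_rInv hm hu' hu₂ ?_
      rw [← dvd_neg, neg_sub]
      exact (Int.natCast_dvd_natCast.mpr (rInv_dvd_modulus hm _ n s)).trans hmod₂
    · rw [Nat.dvd_iff_prime_pow_dvd_dvd]
      intro q k hq hk
      have hkm := hk.trans (rInv_dvd hm _)
      have htr := (pow_dvd_rInv_iff hm hu₂ hq hkm).mp hk
      rcases eq_or_ne q p with rfl | hqp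
      · exact (pow_dvd_rInv_iff hm hu' hq hkm).mpr (htr.congr (hpow hkm))
      · rw [hr₁]
        exact (pow_dvd_rInv_iff hm hu₁ hq hkm).mpr (htr.congr (hcop hq hkm hqp))
    · intro q hq
      rcases eq_or_ne q p with rfl | hqp
      · exact hd
      · have hqS := Finset.mem_of_mem_insert_of_ne hq hqp
        have h1 := dvd_add (hcop (Nat.prime_of_mem_primeFactors (hS hqS)) (Nat.ordProj_dvd m q) hqp)
          (hS₁ q hqS)
        rwa [sub_add_sub_cancel] at h1

/-- The action of `b` may be replaced by any other one with the same invariant `r` which agrees with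
it modulo `[T, n, s]`. -/
theorem exists_change (h : GenPair G a b m n s t)
    (hmin : ∀ {a' b' : G} {m' n' s' t' : ℕ}, GenPair G a' b' m' n' s' t' → m ≤ m')
    (hu : (u : ZMod m) = t) {t' : ℕ} {u' : (ZMod m)ˣ} (hu' : (u' : ZMod m) = t')
    (hr : rInv (Subgroup.zpowers u') = rInv (Subgroup.zpowers u))
    (hmod : (modulus (Subgroup.zpowers u') n s : ℤ) ∣ t - t') :
    ∃ a₁ b₁ : G, GenPair G a₁ b₁ m n s t' := by
  have hm := h.left_ne_zero
  obtain ⟨a₁, b₁, t₁, u₁, h₁, hu₁, -, hmod₁, hS⟩ :=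
    h.exists_change_on hmin hu hu' hr hmod _ subset_rfl
  refine ⟨a₁, b₁, h₁.congr (Nat.ModEq.symm (Nat.modEq_iff_dvd.mpr ?_))⟩
  rw [natCast_dvd_iff_prime_pow]
  intro p k hp hk
  rcases Nat.eq_zero_or_pos k with rfl | hk0
  · simp
  by_cases hpr : p ∈ (rInv (Subgroup.zpowers u')).primeFactors
  · exact (pow_dvd_pow _ ((hp.pow_dvd_iff_le_factorization hm).mp hk)).trans (hS p hpr)
  · refine natCast_dvd_iff_prime_pow.mp hmod₁ p k hp
      (Dvd.dvd.trans ?_ (piPart_nu_dvd_modulus _ n s))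
    refine (pow_dvd_piPart_iff hm hp).mpr (Or.inr ⟨?_, hk⟩)
    simp only [nu, Finset.mem_coe, Finset.mem_sdiff]
    exact ⟨Nat.mem_primeFactors.mpr ⟨hp, (dvd_pow_self p hk0.ne').trans hk, hm⟩, hpr⟩

/-- Two groups with the same `m`, `n`, `s` and `Δ` are isomorphic, if `m` is minimal for one of
them. -/
theorem nonempty_mulEquiv_of_res_eq {H : Type*} [Group H] [Finite H] {a' b' : H} {t' : ℕ}
    {u' : (ZMod m)ˣ} (h : GenPair G a b m n s t) (h' : GenPair H a' b' m n s t')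
    (hmin : ∀ {a' b' : G} {m' n' s' t' : ℕ}, GenPair G a' b' m' n' s' t' → m ≤ m')
    (hu : (u : ZMod m) = t) (hu' : (u' : ZMod m) = t')
    (hM : modulus (Subgroup.zpowers u) n s = modulus (Subgroup.zpowers u') n s)
    (hres : res (modulus (Subgroup.zpowers u) n s) (Subgroup.zpowers u) =
      res (modulus (Subgroup.zpowers u) n s) (Subgroup.zpowers u')) :
    Nonempty (G ≃* H) := by
  have hm := h.left_ne_zero
  have hn := h.index_ne_zero
  have : NeZero m := ⟨hm⟩
  have hq := modulus_dvd hm (Subgroup.zpowers u) n s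
  have : NeZero (modulus (Subgroup.zpowers u) n s) := ⟨modulus_ne_zero hm _ n s⟩
  rw [res_zpowers hq, res_zpowers hq] at hres
  -- A generator of the second group is replaced by a power that agrees with `t` modulo `[T, n, s]`.
  obtain ⟨e, he, het⟩ : ∃ e : ℕ, e.Coprime (n * m) ∧
      ZMod.unitsMap hq u = ZMod.unitsMap hq u' ^ e := by
    have h1 : ZMod.unitsMap hq u ∈ Subgroup.zpowers (ZMod.unitsMap hq u') :=
      hres ▸ Subgroup.mem_zpowers _
    rw [← mem_powers_iff_mem_zpowers] at h1
    obtain ⟨y, hy⟩ := h1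
    have hy' : y.Coprime (orderOf (ZMod.unitsMap hq u')) := by
      rw [Nat.Coprime, ← mem_zpowers_pow_iff]
      simp only at hy
      rw [hy, hres]
      exact Subgroup.mem_zpowers _
    obtain ⟨e, he, hey⟩ := exists_coprime_modEq (m := n * m * orderOf (ZMod.unitsMap hq u'))
      (mul_ne_zero (mul_ne_zero hn hm) (orderOf_pos _).ne') (Dvd.intro_left _ rfl) hy'
    exact ⟨e, he.coprime_dvd_right (Dvd.intro _ rfl), by
      rw [← hy]; exact (pow_eq_pow_iff_modEq.mpr hey).symm⟩
  have hue : ((u' ^ e : (ZMod m)ˣ) : ZMod m) = (t' ^ e : ℕ) := by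
    rw [Units.val_pow_eq_pow_val, hu', Nat.cast_pow]
  have hT : Subgroup.zpowers (u' ^ e) = Subgroup.zpowers u' := by
    refine zpowers_pow_eq (he.coprime_dvd_right ?_)
    refine (orderOf_dvd_of_pow_eq_one (n := n) ?_).mul_right m
    rw [unit_eq_one_iff (t := t' ^ n) (by rw [Units.val_pow_eq_pow_val, hu', Nat.cast_pow])]
    exact_mod_cast h'.left_dvd_pow
  have hmod : (modulus (Subgroup.zpowers u) n s : ℤ) ∣ t - (t' ^ e : ℕ) := by
    have h1 := congrArg (fun v : (ZMod (modulus (Subgroup.zpowers u) n s))ˣ =>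
      (v : ZMod (modulus (Subgroup.zpowers u) n s))) het
    simp only [Units.val_pow_eq_pow_val] at h1
    rw [val_unitsMap hq hu, val_unitsMap hq hu', ← sub_eq_zero] at h1
    rw [← ZMod.intCast_zmod_eq_zero_iff_dvd]
    push_cast
    exact h1
  have hM' : modulus (Subgroup.zpowers u) n s = modulus (Subgroup.zpowers (u' ^ e)) n s := by
    rw [hT, hM]
  have hr : rInv (Subgroup.zpowers (u' ^ e)) = rInv (Subgroup.zpowers u) := by
    refine Nat.dvd_antisymm (rInv_dvd_rInv hm hue hu ?_) (rInv_dvd_rInv hm hu hue ?_)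
    · rw [← dvd_neg, neg_sub]
      refine Dvd.dvd.trans ?_ hmod
      rw [hM']
      exact Int.natCast_dvd_natCast.mpr (rInv_dvd_modulus hm _ n s)
    · exact (Int.natCast_dvd_natCast.mpr (rInv_dvd_modulus hm _ n s)).trans hmod
  obtain ⟨a₁, b₁, h₁⟩ := h.exists_change hmin hu hue hr (hM' ▸ hmod)
  exact h₁.nonempty_mulEquiv (h'.pow he)

end GenPair

/-! ### Minimal factorizations -/

theorem IsMetacyclic.exists_factorization {G : Type*} [Group G] (h : IsMetacyclic G) :
    Nonempty (Factorization G) := by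
  obtain ⟨A, hA, hcA, hcQ⟩ := h
  obtain ⟨q, hq⟩ := hcQ.exists_generator
  obtain ⟨b, rfl⟩ := QuotientGroup.mk_surjective q
  refine ⟨⟨A, Subgroup.zpowers b, hA, hcA, inferInstance, fun g => ?_⟩⟩
  obtain ⟨k, hk⟩ := hq (g : G ⧸ A)
  refine ⟨g * (b ^ k)⁻¹, ?_, b ^ k, Subgroup.zpow_mem_zpowers b k, inv_mul_cancel_right _ _⟩
  rw [← QuotientGroup.eq_one_iff, QuotientGroup.mk_mul, QuotientGroup.mk_inv, mul_inv_eq_one]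
  exact hk.symm

theorem IsMetacyclic.exists_isMinimal {G : Type*} [Group G] (h : IsMetacyclic G) :
    ∃ F : Factorization G, F.IsMinimal := by
  have := h.exists_factorization
  refine ⟨Function.argmin (Factorization.weight (G := G)), fun F => ?_⟩
  exact not_lt.mp (Function.not_lt_argmin _ F)

/-- Generators of a factorization, with the weight and the invariant in terms of them. -/
theorem Factorization.exists_genPair_weight {G : Type*} [Group G] [Finite G]
    (F : Factorization G) : ∃ (m n s t : ℕ) (u : (ZMod m)ˣ) (a b : G), GenPair G a b m n s t ∧
      (u : ZMod m) = t ∧ F.weight = toLex (m, toLex (rInv (Subgroup.zpowers u), s)) ∧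
      F.invariant = (m, n, s, ⟨modulus (Subgroup.zpowers u) n s,
        res (modulus (Subgroup.zpowers u) n s) (Subgroup.zpowers u)⟩) := by
  obtain ⟨a, b, t, hA, hB, h⟩ := F.exists_genPair
  obtain ⟨u, hu⟩ := h.exists_unit
  exact ⟨_, _, _, t, u, a, b, h, hu, h.weight_eq hu hA.symm hB.symm,
    h.invariant_eq hu hA.symm hB.symm⟩

theorem GenPair.exists_weight {G : Type*} [Group G] [Finite G] {a b : G} {m n s t : ℕ}
    (h : GenPair G a b m n s t) {u : (ZMod m)ˣ} (hu : (u : ZMod m) = t) :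
    ∃ F : Factorization G, F.weight = toLex (m, toLex (rInv (Subgroup.zpowers u), s)) ∧
      F.invariant = (m, n, s, ⟨modulus (Subgroup.zpowers u) n s,
        res (modulus (Subgroup.zpowers u) n s) (Subgroup.zpowers u)⟩) :=
  ⟨h.factorization, h.weight_eq hu rfl rfl, h.invariant_eq hu rfl rfl⟩

theorem GenPair.map {G H : Type*} [Group G] [Group H] (e : G ≃* H) {a b : G} {m n s t : ℕ}
    (h : GenPair G a b m n s t) : GenPair H (e a) (e b) m n s t where
  orderOf_left := by rw [MulEquiv.orderOf_eq, h.orderOf_left]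
  conj := by rw [← map_inv, ← map_mul, ← map_mul, h.conj, map_pow]
  sup_eq := by
    have h1 := congrArg (Subgroup.map e.toMonoidHom) h.sup_eq
    rw [Subgroup.map_sup, MonoidHom.map_zpowers, MonoidHom.map_zpowers,
      Subgroup.map_top_of_surjective _ e.surjective] at h1
    exact h1
  index_left := by
    have h1 := Subgroup.index_map_equiv (Subgroup.zpowers a) e
    rw [MonoidHom.map_zpowers] at h1
    exact h1.trans h.index_left
  index_right := by
    have h1 := Subgroup.index_map_equiv (Subgroup.zpowers b) e
    rw [MonoidHom.map_zpowers] at h1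
    exact h1.trans h.index_right
  pow_eq := by rw [← map_pow, ← map_pow, h.pow_eq]

theorem Factorization.IsMinimal.le {G : Type*} [Group G] [Finite G] {F : Factorization G}
    (hF : F.IsMinimal) {m : ℕ} {x : ℕ ×ₗ ℕ} (hw : F.weight = toLex (m, x)) {a b : G}
    {m' n' s' t' : ℕ} (h : GenPair G a b m' n' s' t') : m ≤ m' := by
  obtain ⟨u, hu⟩ := h.exists_unit
  obtain ⟨F', hw', -⟩ := h.exists_weight hu
  have h1 := hF F'
  rw [hw, hw', Prod.Lex.toLex_le_toLex] at h1
  rcases h1 with h1 | h1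
  · exact h1.le
  · exact h1.1.le

/-- The invariant is the same for all factorizations of the same weight. -/
theorem Factorization.invariant_eq_of_weight_eq {G : Type*} [Group G] [Finite G]
    {F F' : Factorization G} (hw : F.weight = F'.weight) : F.invariant = F'.invariant := by
  obtain ⟨m, n, s, t, u, a, b, h, hu, hF, hi⟩ := F.exists_genPair_weight
  obtain ⟨m', n', s', t', u', a', b', h', hu', hF', hi'⟩ := F'.exists_genPair_weight
  rw [hF, hF', toLex_inj, Prod.mk.injEq, toLex_inj, Prod.mk.injEq] at hw
  obtain ⟨rfl, hr, rfl⟩ := hw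
  obtain rfl : n = n' := by
    have h1 := h.card_eq.symm.trans h'.card_eq
    exact Nat.eq_of_mul_eq_mul_left (Nat.pos_of_ne_zero h.left_ne_zero) h1
  obtain ⟨hM, hres⟩ := h.modulus_eq_and_res_eq h' hu hu' hr
  rw [hi, hi', hres, hM]

theorem Factorization.IsMinimal.invariant_eq_MCINV {G : Type*} [Group G] [Finite G]
    {F : Factorization G} (hF : F.IsMinimal) : F.invariant = MCINV G := by
  have h : ∃ F : Factorization G, F.IsMinimal := ⟨F, hF⟩
  rw [MCINV, dif_pos h]
  exact Factorization.invariant_eq_of_weight_eq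
    (le_antisymm (hF _) (h.choose_spec F))

theorem Factorization.exists_map {G H : Type*} [Group G] [Finite G] [Group H] [Finite H]
    (e : G ≃* H) (F : Factorization G) :
    ∃ F' : Factorization H, F'.weight = F.weight ∧ F'.invariant = F.invariant := by
  obtain ⟨m, n, s, t, u, a, b, h, hu, hF, hi⟩ := F.exists_genPair_weight
  rw [hF, hi]
  exact (h.map e).exists_weight hu

theorem MCINV_congr {G H : Type*} [Group G] [Finite G] [Group H] [Finite H]
    (hG : IsMetacyclic G) (e : G ≃* H) : MCINV G = MCINV H := by
  obtain ⟨F, hF⟩ := hG.exists_isMinimal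
  obtain ⟨F', hw, hi⟩ := F.exists_map e
  have hF' : F'.IsMinimal := by
    intro F''
    obtain ⟨F₃, hw₃, -⟩ := F''.exists_map e.symm
    rw [hw, ← hw₃]
    exact hF F₃
  rw [← hF.invariant_eq_MCINV, ← hF'.invariant_eq_MCINV, hi]

theorem nonempty_mulEquiv_of_MCINV_eq {G H : Type*} [Group G] [Finite G] [Group H] [Finite H]
    (hG : IsMetacyclic G) (hH : IsMetacyclic H) (hGH : MCINV G = MCINV H) :
    Nonempty (G ≃* H) := by
  obtain ⟨F, hF⟩ := hG.exists_isMinimal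
  obtain ⟨F', hF'⟩ := hH.exists_isMinimal
  rw [← hF.invariant_eq_MCINV, ← hF'.invariant_eq_MCINV] at hGH
  obtain ⟨m, n, s, t, u, a, b, h, hu, hw, hi⟩ := F.exists_genPair_weight
  obtain ⟨m', n', s', t', u', a', b', h', hu', hw', hi'⟩ := F'.exists_genPair_weight
  rw [hi, hi', Prod.mk.injEq, Prod.mk.injEq, Prod.mk.injEq] at hGH
  obtain ⟨rfl, rfl, rfl, hΔ⟩ := hGH
  obtain ⟨hM, hres⟩ := Sigma.mk.inj_iff.mp hΔ
  refine h.nonempty_mulEquiv_of_res_eq h' (fun h₁ => hF.le hw h₁) hu hu' hM ?_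
  rw [← hM] at hres
  exact eq_of_heq hres

theorem isCyclic_res {m q : ℕ} (hq : q ∣ m) (u : (ZMod m)ˣ) :
    IsCyclic (res q (Subgroup.zpowers u)) := by
  rw [res_zpowers hq]
  infer_instance

end Metacyclic

theorem mainTheorem1 :
    (∀ (G : Type*) [Group G] [Finite G], Metacyclic.IsMetacyclic G →
      (∃ F : Metacyclic.Factorization G, F.IsMinimal) ∧
      (∀ F : Metacyclic.Factorization G, F.IsMinimal → F.invariant = Metacyclic.MCINV G) ∧
      (Metacyclic.MCINV G).2.2.2.1 ∣ (Metacyclic.MCINV G).1 ∧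
      IsCyclic (Metacyclic.MCINV G).2.2.2.2) ∧
    (∀ (G : Type*) (H : Type*) [Group G] [Finite G] [Group H] [Finite H],
      Metacyclic.IsMetacyclic G → Metacyclic.IsMetacyclic H →
      (Nonempty (G ≃* H) ↔ Metacyclic.MCINV G = Metacyclic.MCINV H)) := by
  refine ⟨fun G _ _ hG => ?_, fun G H _ _ _ _ hG hH => ⟨fun ⟨e⟩ => ?_, fun h => ?_⟩⟩
  · obtain ⟨F, hF⟩ := hG.exists_isMinimal
    refine ⟨⟨F, hF⟩, fun F' hF' => hF'.invariant_eq_MCINV, ?_⟩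
    obtain ⟨m, n, s, t, u, a, b, h, hu, hw, hi⟩ := F.exists_genPair_weight
    rw [← hF.invariant_eq_MCINV, hi]
    have hq := Metacyclic.modulus_dvd h.left_ne_zero (Subgroup.zpowers u) n s
    exact ⟨hq, Metacyclic.isCyclic_res hq u⟩
  · exact Metacyclic.MCINV_congr hG e
  · exact Metacyclic.nonempty_mulEquiv_of_MCINV_eq hG hH h
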